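/- Let $c\in\mathbb C$. Let $V_c = M(c,0)/\,\mathcal U(\mathfrak{vir})L_{-1}\bar w_{c,0}$ be the universal Virasoro vertex operator algebra of central charge $c$, with vacuum $\mathsf 1=[\bar w_{c,0}]$ and conformal vector $\omega=L_{-2}\mathsf 1$. Here $M(c,h)$ denotes the Verma module of the Virasoro algebra $\mathfrak{vir}$ of central charge $c$ and conformal weight $h\in\mathbb C$, with highest weight vector $\bar w_{c,h}$. View each $M(c,h)$ as a $V_c$-module, by the unique module structure for which $Y(\omega,\zeta)=\sum_{n\in\mathbb Z}L_n\zeta^{-n-2}$, and let $M(c,h)'$ be its contragredient module: the restricted dual, with $$\langle Y'(v,\zeta)f,w\rangle=\langle f,\,Y(e^{\zeta L_1}(-\zeta^{-2})^{L_0}v,\zeta^{-1})w\rangle .$$ For $V_c$-modules $W_1,W_2,W_3$, an intertwining operator of type $\binom{W_3}{W_1\;W_2}$ is a linear map $\mathcal Y(\cdot,x)$ that sends each $w\in W_1$ to a formal series $\mathcal Y(w,x)=\sum_{\alpha\in\mathbb C}w_{[\alpha]}x^{\alpha}$ with coefficients $w_{[\alpha]}\in\mathrm{Hom}(W_2,W_3)$,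 such that * for all $w\in W_1$, $u\in W_2$, $\alpha\in\mathbb C$ one has $w_{[\alpha-n]}u=0$ for all sufficiently large $n\in\mathbb N$; * the Jacobi identity $$\xi^{-1}\delta\Big(\tfrac{\zeta-x}{\xi}\Big)Y_{W_3}(v,\zeta)\mathcal Y(w,x)-\xi^{-1}\delta\Big(\tfrac{x-\zeta}{-\xi}\Big)\mathcal Y(w,x)Y_{W_2}(v,\zeta)=x^{-1}\delta\Big(\tfrac{\zeta-\xi}{x}\Big)\mathcal Y\big(Y_{W_1}(v,\xi)w,x\big)$$ holds for all $v\in V_c$ and $w\in W_1$, where $\delta(z)=\sum_{m\in\mathbb Z}z^m$ and binomials are expanded in non-negative powers of the second variable; * $\mathcal Y(L_{-1}w,x)=\frac{d}{dx}\mathcal Y(w,x)$ for all $w\in W_1$. Then for all $h_{\mathrm{mid}},h_{\mathrm{in}},h_{\mathrm{out}}\in\mathbb C$ the complex vector space of intertwining operators of type $\binom{M(c,h_{\mathrm{out}})'}{M(c,h_{\mathrm{mid}})\;M(c,h_{\mathrm{in}})}$ is exactly one-dimensional. -/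

import Mathlib

namespace VirVOA

noncomputable section

/-- The underlying vector space of the Virasoro algebra: the span of the `L n`, `n : ℤ`,
plus a one-dimensional central part. -/
def Vir : Type := (ℤ →₀ ℂ) × ℂ

namespace Vir

instance : AddCommGroup Vir := inferInstanceAs (AddCommGroup ((ℤ →₀ ℂ) × ℂ))
instance : Module ℂ Vir := inferInstanceAs (Module ℂ ((ℤ →₀ ℂ) × ℂ))

/-- The basis vector `L_n`. -/
def L (n : ℤ) : Vir := (Finsupp.single n 1, 0)

/-- The central basis vector `C`. -/
def C : Vir := (0, 1)

/-- The value `(m - n) L_{m+n} + (m³ - m)/12 δ_{m+n,0} C` of the bracket of `L_m` and `L_n`. -/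
def structureConst (m n : ℤ) : Vir :=
  ((m : ℂ) - n) • L (m + n) +
    (if m + n = 0 then (((m : ℂ) ^ 3 - m) / 12) • C else 0)

/-- The coordinates with respect to the `L_n`. -/
def coord : Vir →ₗ[ℂ] (ℤ →₀ ℂ) := LinearMap.fst ℂ (ℤ →₀ ℂ) ℂ

@[simp] theorem coord_L (n : ℤ) : coord (L n) = Finsupp.single n 1 := rfl

@[simp] theorem coord_C : coord C = 0 := rfl

/-- The coordinate with respect to `C`. -/
def ccoord : Vir →ₗ[ℂ] ℂ := LinearMap.snd ℂ (ℤ →₀ ℂ) ℂ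

@[simp] theorem ccoord_L (n : ℤ) : ccoord (L n) = 0 := rfl

@[simp] theorem ccoord_C : ccoord C = 1 := rfl

/-- The bracket as a bilinear map: determined by its values on the `L_n`, with `C` central. -/
def bracket : Vir →ₗ[ℂ] Vir →ₗ[ℂ] Vir :=
  (Finsupp.linearCombination ℂ fun m : ℤ =>
      Finsupp.linearCombination ℂ fun n : ℤ => structureConst m n).compl₁₂ coord coord

theorem bracket_L_L (m n : ℤ) : bracket (L m) (L n) = structureConst m n := by
  simp [bracket]

theorem bracket_C_left (x : Vir) : bracket C x = 0 := by
  simp [bracket]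

theorem bracket_C_right (x : Vir) : bracket x C = 0 := by
  simp [bracket]

/-- Two linear maps on the Virasoro algebra agree if they agree on all `L_n` and on `C`. -/
theorem hom_ext {M : Type*} [AddCommMonoid M] [Module ℂ M] {f g : Vir →ₗ[ℂ] M}
    (hL : ∀ n, f (L n) = g (L n)) (hC : f C = g C) : f = g := by
  refine LinearMap.prod_ext (R := ℂ) (M := ℤ →₀ ℂ) (M₂ := ℂ) ?_ ?_
  · refine Finsupp.lhom_ext' fun n => LinearMap.ext_ring ?_
    exact hL n
  · exact LinearMap.ext_ring hC

theorem bracket_skew (x y : Vir) : bracket x y = -bracket y x := by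
  have h : bracket = -bracket.flip := by
    refine hom_ext (fun m => hom_ext (fun n => ?_) ?_) (hom_ext (fun n => ?_) ?_)
    · simp only [bracket_L_L, LinearMap.neg_apply, LinearMap.flip_apply, structureConst,
        add_comm n m]
      split_ifs with h
      · obtain rfl : n = -m := by omega
        push_cast
        module
      · module
    · simp [bracket_C_left, bracket_C_right]
    · simp [bracket_C_left, bracket_C_right]
    · simp [bracket_C_left]
  exact congrArg (fun f : Vir →ₗ[ℂ] Vir →ₗ[ℂ] Vir => f x y) h

theorem bracket_L_structureConst (k m n : ℤ) :
    bracket (L k) (structureConst m n) =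
      ((m : ℂ) - n) • structureConst k (m + n) := by
  rw [structureConst, map_add, map_smul, bracket_L_L]
  split_ifs <;> simp [bracket_C_right]

theorem bracket_leibniz (x y z : Vir) :
    bracket x (bracket y z) = bracket (bracket x y) z + bracket y (bracket x z) := by
  have hL : ∀ k m n : ℤ, bracket (L k) (bracket (L m) (L n)) =
      bracket (bracket (L k) (L m)) (L n) + bracket (L m) (bracket (L k) (L n)) := by
    intro k m n
    rw [bracket_skew (bracket (L k) (L m))]
    simp only [bracket_L_L, bracket_L_structureConst]
    simp only [structureConst]
    rw [show n + (k + m) = k + (m + n) by ring, show m + (k + n) = k + (m + n) by ring]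
    split_ifs with h
    · obtain rfl : k = -m - n := by omega
      push_cast
      module
    · push_cast
      module
  have h1 : ∀ k m : ℤ, ∀ z : Vir, bracket (L k) (bracket (L m) z) =
      bracket (bracket (L k) (L m)) z + bracket (L m) (bracket (L k) z) := by
    intro k m z
    have : (bracket (L k)).comp (bracket (L m)) =
        bracket (bracket (L k) (L m)) + (bracket (L m)).comp (bracket (L k)) :=
      hom_ext (fun n => hL k m n) (by simp [bracket_C_right])
    exact congrArg (fun f : Vir →ₗ[ℂ] Vir => f z) this
  have h2 : ∀ k : ℤ, ∀ y z : Vir, bracket (L k) (bracket y z) =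
      bracket (bracket (L k) y) z + bracket y (bracket (L k) z) := by
    intro k y z
    have : (bracket (L k)).comp (bracket.flip z) =
        (bracket.flip z).comp (bracket (L k)) + bracket.flip (bracket (L k) z) :=
      hom_ext (fun n => h1 k n z) (by simp [bracket_C_left, bracket_C_right])
    exact congrArg (fun f : Vir →ₗ[ℂ] Vir => f y) this
  have : bracket.flip (bracket y z) =
      (bracket.flip z).comp (bracket.flip y) + (bracket y).comp (bracket.flip z) :=
    hom_ext (fun n => h2 n y z) (by simp [bracket_C_left])
  exact congrArg (fun f : Vir →ₗ[ℂ] Vir => f x) this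

instance : Bracket Vir Vir := ⟨fun x y => bracket x y⟩

theorem lie_def (x y : Vir) : ⁅x, y⁆ = bracket x y := rfl

instance : LieRing Vir where
  add_lie x y z := by simp [lie_def]
  lie_add x y z := by simp [lie_def]
  lie_self x := by
    have h := bracket_skew x x
    rw [lie_def]
    have h2 : (2 : ℂ) • bracket x x = 0 := by
      rw [two_smul]
      nth_rewrite 1 [h]
      exact neg_add_cancel _
    exact (smul_eq_zero.mp h2).resolve_left two_ne_zero
  leibniz_lie x y z := bracket_leibniz x y z

instance : LieAlgebra ℂ Vir where
  lie_smul t x y := by simp [lie_def]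

theorem lie_L_L (m n : ℤ) : ⁅L m, L n⁆ = ((m : ℂ) - n) • L (m + n) +
    (if m + n = 0 then (((m : ℂ) ^ 3 - m) / 12) • C else 0) := bracket_L_L m n

theorem lie_C (x : Vir) : ⁅C, x⁆ = 0 := bracket_C_left x

end Vir

attribute [local instance] LieRing.ofAssociativeRing

/-- The universal enveloping algebra of the Virasoro algebra. -/
abbrev UVir : Type := UniversalEnvelopingAlgebra ℂ Vir

/-- The generator `L_n` in the universal enveloping algebra. -/
def uL (n : ℤ) : UVir := UniversalEnvelopingAlgebra.ι ℂ (Vir.L n)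

/-- The generator `C` in the universal enveloping algebra. -/
def uC : UVir := UniversalEnvelopingAlgebra.ι ℂ Vir.C

theorem uL_mul_uL (m n : ℤ) : uL m * uL n = uL n * uL m + (((m : ℂ) - n) • uL (m + n) +
    (if m + n = 0 then (((m : ℂ) ^ 3 - m) / 12) • uC else 0)) := by
  have h := (UniversalEnvelopingAlgebra.ι ℂ).map_lie (Vir.L m) (Vir.L n)
  rw [Vir.lie_L_L, map_add, map_smul, LieRing.of_associative_ring_bracket] at h
  rw [← sub_eq_iff_eq_add']
  refine Eq.trans h.symm ?_
  split_ifs <;> simp [uL, uC]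

theorem uC_mul (x : Vir) : uC * UniversalEnvelopingAlgebra.ι ℂ x =
    UniversalEnvelopingAlgebra.ι ℂ x * uC := by
  have h := (UniversalEnvelopingAlgebra.ι ℂ).map_lie Vir.C x
  rw [Vir.lie_C, map_zero, LieRing.of_associative_ring_bracket] at h
  exact sub_eq_zero.mp h.symm

theorem uC_mul_uL (n : ℤ) : uC * uL n = uL n * uC := uC_mul _

/-- A subspace of a `U(vir)`-module that is stable under all `L_n` and under `C` is stable
under `U(vir)`. -/
theorem stable_of_generators {M : Type*} [AddCommGroup M] [Module ℂ M] [Module UVir M]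
    [IsScalarTower ℂ UVir M] (S : Submodule ℂ M) (hL : ∀ n, ∀ x ∈ S, uL n • x ∈ S)
    (hC : ∀ x ∈ S, uC • x ∈ S) (u : UVir) : ∀ x ∈ S, u • x ∈ S := by
  have hv : ∀ y : Vir, ∀ x ∈ S, UniversalEnvelopingAlgebra.ι ℂ y • x ∈ S := by
    intro y x hx
    let f : Vir →ₗ[ℂ] (M ⧸ S) :=
      S.mkQ.comp ((LinearMap.toSpanSingleton UVir M x).restrictScalars ℂ |>.comp
        (LieHom.toLinearMap (UniversalEnvelopingAlgebra.ι ℂ (L := Vir))))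
    have hf : f = 0 := by
      refine Vir.hom_ext (fun n => ?_) ?_
      · exact (Submodule.Quotient.mk_eq_zero S).mpr (hL n x hx)
      · exact (Submodule.Quotient.mk_eq_zero S).mpr (hC x hx)
    have := congrArg (fun g : Vir →ₗ[ℂ] (M ⧸ S) => g y) hf
    exact (Submodule.Quotient.mk_eq_zero S).mp this
  let A : Subalgebra ℂ UVir :=
    { carrier := {u | ∀ x ∈ S, u • x ∈ S}
      mul_mem' := fun {a b} ha hb x hx => by
        rw [mul_smul]
        exact ha _ (hb _ hx)
      add_mem' := fun {a b} ha hb x hx => by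
        rw [add_smul]
        exact S.add_mem (ha _ hx) (hb _ hx)
      algebraMap_mem' := fun r x hx => by
        rw [algebraMap_smul]
        exact S.smul_mem r hx }
  let φ : Vir →ₗ⁅ℂ⁆ A :=
    { toFun := fun y => ⟨UniversalEnvelopingAlgebra.ι ℂ y, hv y⟩
      map_add' := fun a b => Subtype.ext (map_add _ a b)
      map_smul' := fun r a => Subtype.ext (map_smul _ r a)
      map_lie' := fun {a b} => Subtype.ext ((UniversalEnvelopingAlgebra.ι ℂ).map_lie a b) }
  have hid : A.val.comp (UniversalEnvelopingAlgebra.lift ℂ φ) = AlgHom.id ℂ UVir := by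
    refine UniversalEnvelopingAlgebra.hom_ext ℂ (LieHom.ext fun y => ?_)
    change A.val (UniversalEnvelopingAlgebra.lift ℂ φ (UniversalEnvelopingAlgebra.ι ℂ y)) = _
    rw [UniversalEnvelopingAlgebra.lift_ι_apply]
    rfl
  have := (UniversalEnvelopingAlgebra.lift ℂ φ u).2
  have h2 : ((UniversalEnvelopingAlgebra.lift ℂ φ u : A) : UVir) = u :=
    congrArg (fun g : UVir →ₐ[ℂ] UVir => g u) hid
  rw [h2] at this
  exact this

/-- The left ideal of `U(vir)` generated by `C - c`, `L_0 - h` and the `L_n` with `n > 0`. -/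
def vermaIdeal (c h : ℂ) : Submodule UVir UVir :=
  Submodule.span UVir
    ({uC - algebraMap ℂ UVir c, uL 0 - algebraMap ℂ UVir h} ∪ {x | ∃ n : ℤ, 0 < n ∧ x = uL n})

/-- The Verma module of central charge `c` and conformal weight `h`. -/
abbrev Verma (c h : ℂ) : Type := UVir ⧸ vermaIdeal c h

/-- The highest weight vector of the Verma module. -/
def Verma.hwv (c h : ℂ) : Verma c h := (vermaIdeal c h).mkQ 1

/-- The universal Virasoro vertex operator algebra `V_c`, as a representation:
the quotient of the Verma module of weight `0` by the subrepresentation that `L_{-1}` applied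
to the highest weight vector generates. -/
abbrev Vc (c : ℂ) : Type :=
  Verma c 0 ⧸ Submodule.span UVir {uL (-1) • Verma.hwv c 0}

/-- The vacuum vector of `V_c`. -/
def vacuum (c : ℂ) : Vc c :=
  (Submodule.span UVir {uL (-1) • Verma.hwv c 0}).mkQ (Verma.hwv c 0)

/-- The conformal vector `L_{-2} 1` of `V_c`. -/
def conformalVector (c : ℂ) : Vc c := uL (-2) • vacuum c

theorem Verma.uC_hwv (c h : ℂ) : uC • Verma.hwv c h = c • Verma.hwv c h := by
  have : uC - algebraMap ℂ UVir c ∈ vermaIdeal c h :=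
    Submodule.subset_span (Or.inl (Or.inl rfl))
  rw [← algebraMap_smul UVir c, ← sub_eq_zero, ← sub_smul, Verma.hwv, ← map_smul, smul_eq_mul,
    mul_one]
  exact (Submodule.Quotient.mk_eq_zero _).mpr this

theorem Verma.uL_zero_hwv (c h : ℂ) : uL 0 • Verma.hwv c h = h • Verma.hwv c h := by
  have : uL 0 - algebraMap ℂ UVir h ∈ vermaIdeal c h :=
    Submodule.subset_span (Or.inl (Or.inr rfl))
  rw [← algebraMap_smul UVir h, ← sub_eq_zero, ← sub_smul, Verma.hwv, ← map_smul, smul_eq_mul,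
    mul_one]
  exact (Submodule.Quotient.mk_eq_zero _).mpr this

theorem Verma.uL_pos_hwv (c h : ℂ) {n : ℤ} (hn : 0 < n) : uL n • Verma.hwv c h = 0 := by
  have : uL n ∈ vermaIdeal c h := Submodule.subset_span (Or.inr ⟨n, hn, rfl⟩)
  rw [Verma.hwv, ← map_smul, smul_eq_mul, mul_one]
  exact (Submodule.Quotient.mk_eq_zero _).mpr this

/-- `IsHighestWeightVector c h v`: the vector `v` generates the representation and satisfies
`C v = c v`, `L_0 v = h v` and `L_n v = 0` for `n > 0`. -/
structure IsHighestWeightVector {M : Type*} [AddCommGroup M] [Module ℂ M] [Module UVir M]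
    (c h : ℂ) (v : M) : Prop where
  central : uC • v = c • v
  weight : uL 0 • v = h • v
  pos : ∀ n : ℤ, 0 < n → uL n • v = 0
  cyclic : ∀ x : M, ∃ u : UVir, x = u • v

theorem Verma.isHighestWeightVector (c h : ℂ) : IsHighestWeightVector c h (Verma.hwv c h) where
  central := Verma.uC_hwv c h
  weight := Verma.uL_zero_hwv c h
  pos _ hn := Verma.uL_pos_hwv c h hn
  cyclic x := by
    obtain ⟨u, rfl⟩ := Submodule.mkQ_surjective _ x
    exact ⟨u, by rw [Verma.hwv, ← map_smul, smul_eq_mul, mul_one]⟩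

theorem vacuum_isHighestWeightVector (c : ℂ) : IsHighestWeightVector c 0 (vacuum c) where
  central := by
    rw [vacuum, ← map_smul, Verma.uC_hwv]
    rfl
  weight := by
    rw [vacuum, ← map_smul, Verma.uL_zero_hwv]
    rfl
  pos n hn := by rw [vacuum, ← map_smul, Verma.uL_pos_hwv c 0 hn, map_zero]
  cyclic x := by
    obtain ⟨y, rfl⟩ := Submodule.mkQ_surjective _ x
    obtain ⟨u, rfl⟩ := (Verma.isHighestWeightVector c 0).cyclic y
    exact ⟨u, by rw [vacuum, ← map_smul]⟩

/-- A representation of the Virasoro algebra on which `C` acts as the scalar `c` and such that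
every vector is annihilated by `L_n` for `n` large. -/
structure SmoothRep (c : ℂ) (W : Type*) [AddCommGroup W] [Module ℂ W] where
  L : ℤ → Module.End ℂ W
  comm : ∀ (m n : ℤ) (w : W), L m (L n w) = L n (L m w) + (((m : ℂ) - n) • L (m + n) w +
    (if m + n = 0 then (((m : ℂ) ^ 3 - m) / 12 * c) • w else 0))
  smooth : ∀ w, ∃ N : ℕ, ∀ n : ℤ, (N : ℤ) ≤ n → L n w = 0

namespace IsHighestWeightVector

variable {M : Type*} [AddCommGroup M] [Module ℂ M] [Module UVir M] [IsScalarTower ℂ UVir M]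
  {c h : ℂ} {v : M}

theorem induction (hv : IsHighestWeightVector c h v) (S : Submodule ℂ M) (h0 : v ∈ S)
    (hL : ∀ n, ∀ x ∈ S, uL n • x ∈ S) (hC : ∀ x ∈ S, uC • x ∈ S) (x : M) : x ∈ S := by
  obtain ⟨u, rfl⟩ := hv.cyclic x
  exact stable_of_generators S hL hC u v h0

theorem uC_smul (hv : IsHighestWeightVector c h v) (x : M) : uC • x = c • x := by
  have key : ∀ (r : ℂ) (n : ℤ) (y : M), uL n • (r • y) = r • (uL n • y) := fun r n y => by
    rw [← algebraMap_smul UVir r y, ← mul_smul, ← Algebra.commutes, mul_smul, algebraMap_smul]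
  let S : Submodule ℂ M :=
    { carrier := {x | uC • x = c • x}
      add_mem' := fun {a b} ha hb => by
        simp only [Set.mem_ofPred_eq] at *
        rw [smul_add, smul_add, ha, hb]
      zero_mem' := by simp
      smul_mem' := fun r a ha => by
        simp only [Set.mem_ofPred_eq] at *
        rw [← algebraMap_smul UVir r a, ← mul_smul, ← Algebra.commutes, mul_smul, ha,
          algebraMap_smul, algebraMap_smul, smul_comm] }
  refine hv.induction S hv.central (fun n y hy => ?_) (fun y hy => ?_) x
  · change uC • uL n • y = c • uL n • y
    rw [← mul_smul, uC_mul_uL, mul_smul, show uC • y = c • y from hy, key]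
  · rw [show uC • y = c • y from hy]
    exact S.smul_mem _ hy

/-- The operators by which the `L_n` act. -/
def op (M : Type*) [AddCommGroup M] [Module ℂ M] [Module UVir M] [IsScalarTower ℂ UVir M]
    (n : ℤ) : Module.End ℂ M := Algebra.lsmul ℂ ℂ M (uL n)

theorem op_apply (n : ℤ) (x : M) : op M n x = uL n • x := rfl

theorem op_comm (hv : IsHighestWeightVector c h v) (m n : ℤ) (w : M) :
    op M m (op M n w) = op M n (op M m w) + (((m : ℂ) - n) • op M (m + n) w +
      (if m + n = 0 then (((m : ℂ) ^ 3 - m) / 12 * c) • w else 0)) := by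
  simp only [op_apply]
  rw [← mul_smul, uL_mul_uL, add_smul, add_smul, smul_assoc]
  split_ifs
  · rw [smul_assoc, hv.uC_smul, smul_smul, smul_smul]
  · simp [mul_smul]

/-- The representation of the Virasoro algebra on a highest weight module. -/
def rep (hv : IsHighestWeightVector c h v) : SmoothRep c M where
  L := op M
  comm := hv.op_comm
  smooth := by
    let S : Submodule ℂ M :=
      { carrier := {x | ∃ N : ℕ, ∀ n : ℤ, (N : ℤ) ≤ n → op M n x = 0}
        add_mem' := fun {a b} ⟨N, hN⟩ ⟨K, hK⟩ => ⟨N + K, fun n hn => by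
          rw [map_add, hN n (by omega), hK n (by omega),
            add_zero]⟩
        zero_mem' := ⟨0, fun n _ => map_zero _⟩
        smul_mem' := fun r a ⟨N, hN⟩ => ⟨N, fun n hn => by rw [map_smul, hN n hn, smul_zero]⟩ }
    refine hv.induction S ⟨1, fun n hn => hv.pos n (by omega)⟩ ?_ ?_
    · rintro m x ⟨N, hN⟩
      refine ⟨N + m.natAbs + 1, fun n hn => ?_⟩
      change op M n (op M m x) = 0
      rw [hv.op_comm, hN n (by omega), hN (n + m) (by omega), if_neg (by omega)]
      simp
    · intro x hx
      rw [hv.uC_smul]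
      exact S.smul_mem _ hx

end IsHighestWeightVector

/-- Generalized binomial coefficients `m (m-1) ⋯ (m-j+1) / j!`, for an integer `m`. -/
abbrev bin (m : ℤ) (j : ℕ) : ℤ := Ring.choose m j

section Binomial

theorem bin_succ (x : ℤ) (i : ℕ) : bin x (i + 1) = bin (x - 1) i + bin (x - 1) (i + 1) := by
  have := Ring.choose_succ_succ (x - 1) i
  rwa [sub_add_cancel] at this

theorem succ_mul_bin (x : ℤ) (i : ℕ) : ((i : ℤ) + 1) * bin x (i + 1) = x * bin (x - 1) i := by
  have := Ring.choose_smul_choose x (n := i + 1) (k := 1) (by omega)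
  simpa [Ring.choose_one_right] using this

theorem sub_mul_bin (x : ℤ) (i : ℕ) : (x - i) * bin x i = x * bin (x - 1) i := by
  cases i with
  | zero => simp
  | succ i =>
    have h1 := succ_mul_bin x i
    have h2 := bin_succ x i
    push_cast
    linear_combination (-1 : ℤ) * h1 + x * h2

theorem vandermonde (x y : ℤ) (s : ℕ) :
    ∑ p ∈ Finset.HasAntidiagonal.antidiagonal s, bin x p.1 * bin y p.2 = bin (x + y) s :=
  (Ring.add_choose_eq s (Commute.all x y)).symm

theorem vandermonde_fst (x y : ℤ) (s : ℕ) :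
    ∑ p ∈ Finset.HasAntidiagonal.antidiagonal (s + 1), (p.1 : ℤ) * (bin x p.1 * bin y p.2) =
      x * bin (x + y - 1) s := by
  rw [Finset.Nat.sum_antidiagonal_succ]
  have := vandermonde (x - 1) y s
  rw [show x + y - 1 = x - 1 + y by ring, ← this, Finset.mul_sum]
  simp only [Nat.cast_zero, zero_mul, zero_add]
  refine Finset.sum_congr rfl fun p _ => ?_
  have h := succ_mul_bin x p.1
  push_cast
  linear_combination bin y p.2 * h

theorem vandermonde_snd (x y : ℤ) (s : ℕ) :
    ∑ p ∈ Finset.HasAntidiagonal.antidiagonal (s + 1), (p.2 : ℤ) * (bin x p.1 * bin y p.2) =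
      y * bin (x + y - 1) s := by
  rw [← Finset.Nat.sum_antidiagonal_swap, add_comm x y, ← vandermonde_fst y x s]
  exact Finset.sum_congr rfl fun p _ => by simp [mul_comm]

theorem bin_sum_left (m n : ℤ) (s : ℕ) :
    ∑ p ∈ Finset.HasAntidiagonal.antidiagonal s, ((m - p.1) - (n - p.2)) * (bin (m + 1) p.1 * bin (n + 1) p.2) =
      (m - n) * bin (m + n + 1) s := by
  cases s with
  | zero => simp
  | succ s =>
    have h0 := vandermonde (m + 1) (n + 1) (s + 1)
    have h1 := vandermonde_fst (m + 1) (n + 1) s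
    have h2 := vandermonde_snd (m + 1) (n + 1) s
    have h3 := bin_succ (m + 1 + (n + 1)) s
    rw [show m + 1 + (n + 1) - 1 = m + n + 1 by ring] at h1 h2 h3
    have : ∀ p : ℕ × ℕ, ((m - p.1) - (n - p.2)) * (bin (m + 1) p.1 * bin (n + 1) p.2) =
        (m - n) * (bin (m + 1) p.1 * bin (n + 1) p.2)
          - p.1 * (bin (m + 1) p.1 * bin (n + 1) p.2)
          + p.2 * (bin (m + 1) p.1 * bin (n + 1) p.2) := fun p => by ring
    simp only [this, Finset.sum_add_distrib, Finset.sum_sub_distrib, ← Finset.mul_sum]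
    rw [h0, h1, h2]
    linear_combination (m - n) * h3

theorem bin_sum_right (m n : ℤ) (s : ℕ) :
    ∑ p ∈ Finset.HasAntidiagonal.antidiagonal (s + 1),
      ((p.2 : ℤ) - p.1) * (bin (m + 1) p.1 * bin (n + 1) p.2) =
      (n - m) * bin (m + n + 1) s := by
  have h1 := vandermonde_fst (m + 1) (n + 1) s
  have h2 := vandermonde_snd (m + 1) (n + 1) s
  rw [show m + 1 + (n + 1) - 1 = m + n + 1 by ring] at h1 h2
  simp only [sub_mul, Finset.sum_sub_distrib]
  rw [h1, h2]
  ring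

theorem bin_sum_central (m n : ℤ) (s : ℕ) (hs : m + n = s) :
    ∑ p ∈ Finset.HasAntidiagonal.antidiagonal s,
      ((m - p.1) ^ 3 - (m - p.1)) * (bin (m + 1) p.1 * bin (n + 1) p.2) =
      if s = 0 then m ^ 3 - m else 0 := by
  have h : ∀ p : ℕ × ℕ, ((m - p.1) ^ 3 - (m - p.1)) * (bin (m + 1) p.1 * bin (n + 1) p.2) =
      ((m + 1) * m * (m - 1)) * (bin (m - 2) p.1 * bin (n + 1) p.2) := by
    intro p
    have h1 := sub_mul_bin (m + 1) p.1
    have h2 := sub_mul_bin m p.1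
    have h3 := sub_mul_bin (m - 1) p.1
    rw [show m + 1 - 1 = m by ring] at h1
    rw [show m - 1 - 1 = m - 2 by ring] at h3
    linear_combination bin (n + 1) p.2 * ((m - p.1) * (m - p.1 - 1) * h1
      + (m + 1) * (m - p.1 - 1) * h2 + (m + 1) * m * h3)
  simp only [h, ← Finset.mul_sum]
  rw [vandermonde, show m - 2 + (n + 1) = (s : ℤ) - 1 by linarith]
  cases s with
  | zero => simp; ring
  | succ s =>
    rw [show ((s + 1 : ℕ) : ℤ) - 1 = (s : ℤ) by push_cast; ring, bin, Ring.choose_natCast]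
    simp

end Binomial

section Sums

variable {W : Type*} [AddCommGroup W]

theorem finsum_eq_range {f : ℕ → W} {N : ℕ} (h : ∀ i, N ≤ i → f i = 0) :
    ∑ᶠ i, f i = ∑ i ∈ Finset.range N, f i := by
  refine finsum_eq_sum_of_support_subset f fun i hi => ?_
  by_contra hc
  exact hi (h i (by simpa using hc))

theorem sum_triangle (f : ℕ → ℕ → W) (M : ℕ) (h : ∀ i j, M ≤ i + j → f i j = 0) :
    ∑ i ∈ Finset.range M, ∑ j ∈ Finset.range M, f i j =
      ∑ s ∈ Finset.range M, ∑ p ∈ Finset.HasAntidiagonal.antidiagonal s, f p.1 p.2 := by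
  rw [← Finset.sum_product', Finset.sum_sigma']
  symm
  refine Finset.sum_bij_ne_zero (fun x _ _ => x.2) ?_ ?_ ?_ ?_
  · rintro ⟨s, i, j⟩ hx _
    simp at hx ⊢
    omega
  · rintro ⟨s, i, j⟩ hx _ ⟨s', i', j'⟩ hx' _ he
    simp at hx hx' he
    obtain ⟨rfl, rfl⟩ := he
    obtain rfl : s = s' := by omega
    rfl
  · rintro ⟨i, j⟩ _ hne
    refine ⟨⟨i + j, i, j⟩, ?_, hne, rfl⟩
    have : ¬ M ≤ i + j := fun hc => hne (h i j hc)
    simp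
    omega
  · intros
    rfl

end Sums

section Fields

variable {c : ℂ} {W : Type*} [AddCommGroup W] [Module ℂ W]

/-- The fields on `W`: formal series `∑ a_(n) z^{-n-1}` with coefficients `a_(n)` in `End W` such
that for every vector `w` one has `a_(n) w = 0` for `n` large. A field is given by the
function `n ↦ a_(n)`. -/
def fields (W : Type*) [AddCommGroup W] [Module ℂ W] : Submodule ℂ (ℤ → Module.End ℂ W) where
  carrier := {a | ∀ w, ∃ N : ℕ, ∀ n : ℤ, (N : ℤ) ≤ n → a n w = 0}
  add_mem' := fun {a b} ha hb w => by
    obtain ⟨N, hN⟩ := ha w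
    obtain ⟨K, hK⟩ := hb w
    exact ⟨N + K, fun n hn => by
      rw [Pi.add_apply, LinearMap.add_apply, hN n (by omega), hK n (by omega), add_zero]⟩
  zero_mem' := fun w => ⟨0, fun n _ => rfl⟩
  smul_mem' := fun r a ha w => by
    obtain ⟨N, hN⟩ := ha w
    exact ⟨N, fun n hn => by rw [Pi.smul_apply, LinearMap.smul_apply, hN n hn, smul_zero]⟩

/-- The pointwise finite sum of a sequence of linear maps. -/
def sumEnd {U V : Type*} [AddCommGroup U] [Module ℂ U] [AddCommGroup V] [Module ℂ V]
    (f : ℕ → U →ₗ[ℂ] V) (hf : ∀ w, ∃ N : ℕ, ∀ j, N ≤ j → f j w = 0) : U →ₗ[ℂ] V where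
  toFun w := ∑ᶠ j, f j w
  map_add' x y := by
    obtain ⟨N, hN⟩ := hf x
    obtain ⟨K, hK⟩ := hf y
    rw [finsum_eq_range (N := N + K) (fun i hi => hN i (by omega)),
      finsum_eq_range (N := N + K) (fun i hi => hK i (by omega)),
      finsum_eq_range (N := N + K) (fun i hi => by
        rw [map_add, hN i (by omega), hK i (by omega), add_zero]), ← Finset.sum_add_distrib]
    simp
  map_smul' r x := by
    obtain ⟨N, hN⟩ := hf x
    rw [finsum_eq_range hN, finsum_eq_range (N := N) (fun i hi => by
        rw [map_smul, hN i hi, smul_zero])]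
    simp [Finset.smul_sum]

namespace SmoothRep

variable (R : SmoothRep c W)

/-- The coefficient of `z^j ζ^{m+1-j}` in `(ζ - z)^{m+1}`, expanded in powers of `z`. -/
def lc (m : ℤ) (j : ℕ) : ℂ := (-1) ^ j * (bin (m + 1) j : ℂ)

/-- The coefficient of `z^{m+1-j} ζ^j` in `(-z + ζ)^{m+1}`, expanded in powers of `ζ`. -/
def rc (m : ℤ) (j : ℕ) : ℂ := (-1) ^ (m + 1 - j) * (bin (m + 1) j : ℂ)

theorem left_fin (m : ℤ) (a : fields W) (k : ℤ) (w : W) :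
    ∃ N : ℕ, ∀ j, N ≤ j → (lc m j • (R.L (m - j) ∘ₗ a.1 (k + j))) w = 0 := by
  obtain ⟨N, hN⟩ := a.2 w
  refine ⟨N + k.natAbs, fun j hj => ?_⟩
  rw [LinearMap.smul_apply, LinearMap.comp_apply, hN (k + j) (by omega), map_zero, smul_zero]

theorem right_fin (m : ℤ) (a : fields W) (k : ℤ) (w : W) :
    ∃ N : ℕ, ∀ j : ℕ, N ≤ j →
      (rc m j • (a.1 (k + m + 1 - j) ∘ₗ R.L ((j : ℤ) - 1))) w = 0 := by
  obtain ⟨N, hN⟩ := R.smooth w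
  refine ⟨N + 1, fun j hj => ?_⟩
  rw [LinearMap.smul_apply, LinearMap.comp_apply, hN (j - 1) (by omega), map_zero, smul_zero]

/-- The residue in `ζ` of `(ζ - z)^{m+1} T(ζ) a(z)`, where `T(ζ) = ∑ L_n ζ^{-n-2}` and
`(ζ - z)^{m+1}` is expanded in powers of `z`. -/
def left (m : ℤ) (a : fields W) (k : ℤ) : Module.End ℂ W :=
  sumEnd (fun j : ℕ => lc m j • (R.L (m - j) ∘ₗ a.1 (k + j))) (R.left_fin m a k)

/-- The residue in `ζ` of `(-z + ζ)^{m+1} a(z) T(ζ)`, where `T(ζ) = ∑ L_n ζ^{-n-2}` and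
`(-z + ζ)^{m+1}` is expanded in powers of `ζ`. -/
def right (m : ℤ) (a : fields W) (k : ℤ) : Module.End ℂ W :=
  sumEnd (fun j : ℕ => rc m j • (a.1 (k + m + 1 - j) ∘ₗ R.L ((j : ℤ) - 1))) (R.right_fin m a k)

theorem left_eq (m : ℤ) (a : fields W) (k : ℤ) (w : W) (N : ℕ)
    (hN : ∀ j : ℕ, N ≤ j → a.1 (k + j) w = 0) :
    R.left m a k w = ∑ j ∈ Finset.range N, lc m j • R.L (m - j) (a.1 (k + j) w) :=
  finsum_eq_range fun j hj => by
    rw [LinearMap.smul_apply, LinearMap.comp_apply, hN j hj, map_zero, smul_zero]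

theorem right_eq (m : ℤ) (a : fields W) (k : ℤ) (w : W) (N : ℕ)
    (hN : ∀ j : ℕ, N ≤ j → a.1 (k + m + 1 - j) (R.L ((j : ℤ) - 1) w) = 0) :
    R.right m a k w =
      ∑ j ∈ Finset.range N, rc m j • a.1 (k + m + 1 - j) (R.L ((j : ℤ) - 1) w) :=
  finsum_eq_range fun j hj => by
    rw [LinearMap.smul_apply, LinearMap.comp_apply, hN j hj, smul_zero]

/-- Uniform vanishing of `a_(p) L_{j-1} w`: for `j` large, and for `p` large. -/
theorem field_L_bound (a : fields W) (w : W) : ∃ N : ℕ, ∀ (j : ℕ) (p : ℤ),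
    (N ≤ j ∨ (N : ℤ) ≤ p) → a.1 p (R.L ((j : ℤ) - 1) w) = 0 := by
  obtain ⟨N, hN⟩ := R.smooth w
  choose K hK using fun j : ℕ => a.2 (R.L ((j : ℤ) - 1) w)
  refine ⟨N + 1 + ∑ j ∈ Finset.range (N + 1), K j, fun j p h => ?_⟩
  by_cases hj : N + 1 ≤ j
  · rw [hN (j - 1) (by omega), map_zero]
  · rcases h with h | h
    · omega
    · refine hK j p (le_trans ?_ h)
      have := Finset.single_le_sum (f := K) (fun i _ => Nat.zero_le _)
        (Finset.mem_range.mpr (not_le.mp hj))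
      push_cast
      have h2 : (K j : ℤ) ≤ ((∑ j ∈ Finset.range (N + 1), K j : ℕ) : ℤ) := by exact_mod_cast this
      push_cast at h2
      linarith

theorem left_mem (m : ℤ) (a : fields W) : R.left m a ∈ fields W := by
  intro w
  obtain ⟨N, hN⟩ := a.2 w
  refine ⟨N, fun n hn => ?_⟩
  rw [R.left_eq m a n w 0 (fun j _ => hN _ (by omega))]
  simp

theorem right_mem (m : ℤ) (a : fields W) : R.right m a ∈ fields W := by
  intro w
  obtain ⟨N, hN⟩ := R.field_L_bound a w
  refine ⟨2 * N + (m + 1).natAbs, fun n hn => ?_⟩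
  rw [R.right_eq m a n w 0 (fun j _ => hN _ _ ?_)]
  · simp
  · by_cases h : N ≤ j
    · exact Or.inl h
    · right
      omega

/-- `left` as an operator on fields. -/
def leftOp (m : ℤ) : Module.End ℂ (fields W) where
  toFun a := ⟨R.left m a, R.left_mem m a⟩
  map_add' a b := by
    refine Subtype.ext (funext fun k => LinearMap.ext fun w => ?_)
    obtain ⟨N, hN⟩ := a.2 w
    obtain ⟨K, hK⟩ := b.2 w
    change R.left m (a + b) k w = R.left m a k w + R.left m b k w
    have ha : ∀ j : ℕ, N + K + k.natAbs ≤ j → a.1 (k + j) w = 0 := fun j hj => hN _ (by omega)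
    have hb : ∀ j : ℕ, N + K + k.natAbs ≤ j → b.1 (k + j) w = 0 := fun j hj => hK _ (by omega)
    rw [R.left_eq m a k w _ ha, R.left_eq m b k w _ hb,
      R.left_eq m (a + b) k w (N + K + k.natAbs) (fun j hj => by
        change a.1 (k + j) w + b.1 (k + j) w = 0
        rw [ha j hj, hb j hj, add_zero]), ← Finset.sum_add_distrib]
    refine Finset.sum_congr rfl fun j _ => ?_
    change lc m j • R.L (m - j) (a.1 (k + j) w + b.1 (k + j) w) = _
    rw [map_add, smul_add]
  map_smul' r a := by
    refine Subtype.ext (funext fun k => LinearMap.ext fun w => ?_)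
    obtain ⟨N, hN⟩ := a.2 w
    change R.left m (r • a) k w = r • R.left m a k w
    have ha : ∀ j : ℕ, N + k.natAbs ≤ j → a.1 (k + j) w = 0 := fun j hj => hN _ (by omega)
    rw [R.left_eq m a k w _ ha,
      R.left_eq m (r • a) k w (N + k.natAbs) (fun j hj => by
        change r • a.1 (k + j) w = 0
        rw [ha j hj, smul_zero]), Finset.smul_sum]
    refine Finset.sum_congr rfl fun j _ => ?_
    change lc m j • R.L (m - j) (r • a.1 (k + j) w) = _
    rw [map_smul, smul_comm]

/-- `right` as an operator on fields. -/
def rightOp (m : ℤ) : Module.End ℂ (fields W) where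
  toFun a := ⟨R.right m a, R.right_mem m a⟩
  map_add' a b := by
    refine Subtype.ext (funext fun k => LinearMap.ext fun w => ?_)
    obtain ⟨N, hN⟩ := R.field_L_bound a w
    obtain ⟨K, hK⟩ := R.field_L_bound b w
    change R.right m (a + b) k w = R.right m a k w + R.right m b k w
    rw [R.right_eq m a k w (N + K) (fun j hj => hN _ _ (Or.inl (by omega))),
      R.right_eq m b k w (N + K) (fun j hj => hK _ _ (Or.inl (by omega))),
      R.right_eq m (a + b) k w (N + K) (fun j hj => by
        change a.1 _ _ + b.1 _ _ = 0
        rw [hN _ _ (Or.inl (by omega)), hK _ _ (Or.inl (by omega)), add_zero]),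
      ← Finset.sum_add_distrib]
    refine Finset.sum_congr rfl fun j _ => ?_
    rw [← smul_add]
    rfl
  map_smul' r a := by
    refine Subtype.ext (funext fun k => LinearMap.ext fun w => ?_)
    obtain ⟨N, hN⟩ := R.field_L_bound a w
    change R.right m (r • a) k w = r • R.right m a k w
    rw [R.right_eq m a k w N (fun j hj => hN _ _ (Or.inl (by omega))),
      R.right_eq m (r • a) k w N (fun j hj => by
        change r • a.1 _ _ = 0
        rw [hN _ _ (Or.inl (by omega)), smul_zero]), Finset.smul_sum]
    refine Finset.sum_congr rfl fun j _ => ?_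
    rw [smul_comm]
    rfl

/-- The action of `L_m` on fields: `a(z)` is sent to the product `T(z)_(m+1) a(z)`, that is to
`Res_ζ ((ζ - z)^{m+1} T(ζ) a(z) - (-z + ζ)^{m+1} a(z) T(ζ))`. -/
def fieldOp (m : ℤ) : Module.End ℂ (fields W) := R.leftOp m - R.rightOp m

theorem left_right_comm (m n : ℤ) (a : fields W) :
    R.leftOp m (R.rightOp n a) = R.rightOp n (R.leftOp m a) := by
  refine Subtype.ext (funext fun k => LinearMap.ext fun w => ?_)
  change R.left m (R.rightOp n a) k w = R.right n (R.leftOp m a) k w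
  obtain ⟨N, hN⟩ := R.field_L_bound a w
  let M := 2 * N + k.natAbs + (n + 1).natAbs
  have hb : ∀ i j : ℕ, (M ≤ i ∨ N ≤ j) →
      a.1 (k + i + n + 1 - j) (R.L ((j : ℤ) - 1) w) = 0 := by
    intro i j h
    by_cases hj : N ≤ j
    · exact hN _ _ (Or.inl hj)
    · refine hN _ _ (Or.inr ?_)
      simp only [M] at h
      omega
  have hr : ∀ i : ℕ, R.right n a (k + i) w =
      ∑ j ∈ Finset.range N, rc n j • a.1 (k + i + n + 1 - j) (R.L ((j : ℤ) - 1) w) :=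
    fun i => R.right_eq n a (k + i) w N (fun j hj => hb i j (Or.inr hj))
  have hl : ∀ j : ℕ, R.left m a (k + n + 1 - j) (R.L ((j : ℤ) - 1) w) =
      ∑ i ∈ Finset.range M,
        lc m i • R.L (m - i) (a.1 (k + i + n + 1 - j) (R.L ((j : ℤ) - 1) w)) := by
    intro j
    have he : ∀ i : ℕ, k + n + 1 - j + i = k + i + n + 1 - (j : ℤ) := fun i => by ring
    rw [R.left_eq m a _ _ M (fun i hi => by rw [he]; exact hb i j (Or.inl hi))]
    exact Finset.sum_congr rfl fun i _ => by rw [he]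
  rw [R.left_eq m (R.rightOp n a) k w M (fun i hi => by
      change R.right n a (k + i) w = 0
      rw [hr]
      exact Finset.sum_eq_zero fun j _ => by rw [hb i j (Or.inl hi), smul_zero]),
    R.right_eq n (R.leftOp m a) k w N (fun j hj => by
      change R.left m a (k + n + 1 - j) (R.L ((j : ℤ) - 1) w) = 0
      rw [hl]
      exact Finset.sum_eq_zero fun i _ => by rw [hb i j (Or.inr hj), map_zero, smul_zero])]
  have e1 : ∀ i : ℕ, lc m i • R.L (m - i) ((R.rightOp n a).1 (k + i) w) =
      ∑ j ∈ Finset.range N, (lc m i * rc n j) •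
        R.L (m - i) (a.1 (k + i + n + 1 - j) (R.L ((j : ℤ) - 1) w)) := by
    intro i
    change lc m i • R.L (m - i) (R.right n a (k + i) w) = _
    rw [hr, map_sum, Finset.smul_sum]
    exact Finset.sum_congr rfl fun j _ => by rw [map_smul, smul_smul]
  have e2 : ∀ j : ℕ, rc n j • (R.leftOp m a).1 (k + n + 1 - j) (R.L ((j : ℤ) - 1) w) =
      ∑ i ∈ Finset.range M, (lc m i * rc n j) •
        R.L (m - i) (a.1 (k + i + n + 1 - j) (R.L ((j : ℤ) - 1) w)) := by
    intro j
    change rc n j • R.left m a (k + n + 1 - j) (R.L ((j : ℤ) - 1) w) = _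
    rw [hl, Finset.smul_sum]
    exact Finset.sum_congr rfl fun i _ => by rw [smul_smul, mul_comm]
  simp only [e1, e2]
  exact Finset.sum_comm

theorem left_left (m n : ℤ) (a : fields W) (k : ℤ) (w : W) (M : ℕ)
    (hM : ∀ j : ℕ, M ≤ j → a.1 (k + j) w = 0) :
    R.left m (R.leftOp n a) k w = ∑ i ∈ Finset.range M, ∑ j ∈ Finset.range M,
      (lc m i * lc n j) • R.L (m - i) (R.L (n - j) (a.1 (k + (i + j : ℕ)) w)) := by
  have he : ∀ i j : ℕ, k + i + j = k + ((i + j : ℕ) : ℤ) := fun i j => by push_cast; ring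
  have hl : ∀ i : ℕ, R.left n a (k + i) w =
      ∑ j ∈ Finset.range M, lc n j • R.L (n - j) (a.1 (k + (i + j : ℕ)) w) := by
    intro i
    rw [R.left_eq n a _ _ M (fun j hj => by rw [he]; exact hM _ (by omega))]
    exact Finset.sum_congr rfl fun j _ => by rw [he]
  rw [R.left_eq m (R.leftOp n a) k w M (fun i hi => by
    change R.left n a (k + i) w = 0
    rw [hl]
    exact Finset.sum_eq_zero fun j _ => by rw [hM _ (by omega), map_zero, smul_zero])]
  refine Finset.sum_congr rfl fun i _ => ?_
  change lc m i • R.L (m - i) (R.left n a (k + i) w) = _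
  rw [hl, map_sum, Finset.smul_sum]
  exact Finset.sum_congr rfl fun j _ => by rw [map_smul, smul_smul]

theorem left_comm' (m n : ℤ) (a : fields W) :
    R.leftOp m (R.leftOp n a) - R.leftOp n (R.leftOp m a) =
      ((m : ℂ) - n) • R.leftOp (m + n) a +
        (if m + n = 0 then (((m : ℂ) ^ 3 - m) / 12 * c) • a else 0) := by
  refine Subtype.ext (funext fun k => LinearMap.ext fun w => ?_)
  obtain ⟨N, hN⟩ := a.2 w
  obtain ⟨M, hM1, hM⟩ : ∃ M : ℕ, 1 ≤ M ∧ ∀ j : ℕ, M ≤ j → a.1 (k + j) w = 0 :=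
    ⟨N + k.natAbs + 1, by omega, fun j hj => hN _ (by omega)⟩
  have hif : (if m + n = 0 then (((m : ℂ) ^ 3 - m) / 12 * c) • a else 0 : fields W).1 k w =
      if m + n = 0 then (((m : ℂ) ^ 3 - m) / 12 * c) • a.1 k w else 0 := by
    split_ifs <;> rfl
  change R.left m (R.leftOp n a) k w - R.left n (R.leftOp m a) k w =
    ((m : ℂ) - n) • R.left (m + n) a k w + _
  rw [hif, R.left_left m n a k w M hM, R.left_left n m a k w M hM,
    R.left_eq (m + n) a k w M hM, Finset.sum_comm (s := Finset.range M) (t := Finset.range M)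
      (f := fun i j => (lc n i * lc m j) • R.L (n - i) (R.L (m - j) (a.1 (k + (i + j : ℕ)) w))),
    ← Finset.sum_sub_distrib]
  simp only [← Finset.sum_sub_distrib]
  have hterm : ∀ i j : ℕ,
      (lc m i * lc n j) • R.L (m - i) (R.L (n - j) (a.1 (k + (i + j : ℕ)) w)) -
        (lc n j * lc m i) • R.L (n - j) (R.L (m - i) (a.1 (k + (j + i : ℕ)) w)) =
      ((-1 : ℂ) ^ (i + j) * ((((m - i) - (n - j)) * (bin (m + 1) i * bin (n + 1) j) : ℤ) : ℂ)) •
          R.L (m + n - (i + j : ℕ)) (a.1 (k + (i + j : ℕ)) w) +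
        (if m + n = ((i + j : ℕ) : ℤ) then
          ((-1 : ℂ) ^ (i + j) * ((((m - i) ^ 3 - (m - i)) *
            (bin (m + 1) i * bin (n + 1) j) : ℤ) : ℂ) / 12 * c) •
            a.1 (k + (i + j : ℕ)) w else 0) := by
    intro i j
    rw [add_comm j i, R.comm (m - i) (n - j),
      show m - i + (n - j) = m + n - ((i + j : ℕ) : ℤ) by push_cast; ring]
    simp only [sub_eq_zero, lc]
    split_ifs <;> push_cast <;> module
  simp only [hterm]
  rw [sum_triangle _ M (fun i j hij => by rw [hM _ hij]; simp)]
  have hdiag : ∀ s : ℕ, ∑ p ∈ Finset.HasAntidiagonal.antidiagonal s,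
      (((-1 : ℂ) ^ (p.1 + p.2) *
        ((((m - p.1) - (n - p.2)) * (bin (m + 1) p.1 * bin (n + 1) p.2) : ℤ) : ℂ)) •
          R.L (m + n - (p.1 + p.2 : ℕ)) (a.1 (k + (p.1 + p.2 : ℕ)) w) +
        (if m + n = ((p.1 + p.2 : ℕ) : ℤ) then
          ((-1 : ℂ) ^ (p.1 + p.2) * ((((m - p.1) ^ 3 - (m - p.1)) *
            (bin (m + 1) p.1 * bin (n + 1) p.2) : ℤ) : ℂ) / 12 * c) •
            a.1 (k + (p.1 + p.2 : ℕ)) w else 0)) =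
      ((m : ℂ) - n) • (lc (m + n) s • R.L (m + n - s) (a.1 (k + s) w)) +
        (if s = 0 then
          (if m + n = 0 then (((m : ℂ) ^ 3 - m) / 12 * c) • a.1 k w else 0) else 0) := by
    intro s
    have h1 : ∀ p ∈ Finset.HasAntidiagonal.antidiagonal s, p.1 + p.2 = s :=
      fun p hp => Finset.HasAntidiagonal.mem_antidiagonal.mp hp
    rw [Finset.sum_congr rfl (fun p hp => by rw [h1 p hp]), Finset.sum_add_distrib,
      ← Finset.sum_smul, ← Finset.mul_sum, ← Int.cast_sum, bin_sum_left]
    congr 1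
    · rw [smul_smul, lc]
      push_cast
      congr 1
      ring
    · by_cases hs : m + n = s
      · simp only [hs, if_true]
        rw [← Finset.sum_smul, ← Finset.sum_mul, ← Finset.sum_div, ← Finset.mul_sum,
          ← Int.cast_sum, bin_sum_central m n s hs]
        by_cases h0 : s = 0
        · subst h0
          simp
        · have h0' : (s : ℤ) ≠ 0 := by exact_mod_cast h0
          simp [h0]
      · simp only [hs, if_false, Finset.sum_const_zero]
        by_cases h0 : s = 0
        · subst h0
          rw [if_pos rfl, if_neg (by simpa using hs)]
        · rw [if_neg h0]
  simp only [hdiag]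
  rw [Finset.sum_add_distrib, ← Finset.smul_sum, Finset.sum_ite_eq' (Finset.range M) 0,
    if_pos (Finset.mem_range.mpr hM1)]

theorem right_right (m n : ℤ) (a : fields W) (k : ℤ) (w : W) : ∃ N : ℕ, ∀ M : ℕ, N ≤ M →
    R.right m (R.rightOp n a) k w = ∑ i ∈ Finset.range M, ∑ j ∈ Finset.range M,
      (rc m i * rc n j) • a.1 (k + m + n + 2 - (i + j : ℕ))
        (R.L ((j : ℤ) - 1) (R.L ((i : ℤ) - 1) w)) := by
  obtain ⟨N, hN⟩ := R.smooth w
  choose K hK using fun i : ℕ => R.smooth (R.L ((i : ℤ) - 1) w)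
  have hz : ∀ i j : ℕ, (N + 1 + ∑ i ∈ Finset.range (N + 1), K i + 1 ≤ i ∨
      N + 1 + ∑ i ∈ Finset.range (N + 1), K i + 1 ≤ j) →
      R.L ((j : ℤ) - 1) (R.L ((i : ℤ) - 1) w) = 0 := by
    intro i j h
    by_cases hi : N + 1 ≤ i
    · rw [hN (i - 1) (by omega), map_zero]
    · have := Finset.single_le_sum (f := K) (fun i _ => Nat.zero_le _)
        (Finset.mem_range.mpr (not_le.mp hi))
      exact hK i _ (by omega)
  refine ⟨N + 1 + ∑ i ∈ Finset.range (N + 1), K i + 1, fun M hM => ?_⟩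
  have he : ∀ i j : ℕ, k + m + 1 - i + n + 1 - j = k + m + n + 2 - ((i + j : ℕ) : ℤ) :=
    fun i j => by push_cast; ring
  have hr : ∀ i : ℕ, R.right n a (k + m + 1 - i) (R.L ((i : ℤ) - 1) w) =
      ∑ j ∈ Finset.range M, rc n j • a.1 (k + m + n + 2 - (i + j : ℕ))
        (R.L ((j : ℤ) - 1) (R.L ((i : ℤ) - 1) w)) := by
    intro i
    rw [R.right_eq n a _ _ M (fun j hj => by rw [hz i j (Or.inr (by omega)), map_zero])]
    exact Finset.sum_congr rfl fun j _ => by rw [he]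
  rw [R.right_eq m (R.rightOp n a) k w M (fun i hi => by
    change R.right n a (k + m + 1 - i) (R.L ((i : ℤ) - 1) w) = 0
    rw [hr]
    exact Finset.sum_eq_zero fun j _ => by
      rw [hz i j (Or.inl (by omega)), map_zero, smul_zero])]
  refine Finset.sum_congr rfl fun i _ => ?_
  change rc m i • R.right n a (k + m + 1 - i) (R.L ((i : ℤ) - 1) w) = _
  rw [hr, Finset.smul_sum]
  exact Finset.sum_congr rfl fun j _ => by rw [smul_smul]

theorem neg_one_zpow_sub_natCast (m : ℤ) (j : ℕ) : (-1 : ℂ) ^ (m - j) = (-1) ^ m * (-1) ^ j := by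
  rw [zpow_sub₀ (by norm_num), zpow_natCast, div_eq_mul_inv, ← inv_pow]
  norm_num

theorem right_comm' (m n : ℤ) (a : fields W) :
    R.rightOp m (R.rightOp n a) - R.rightOp n (R.rightOp m a) =
      -(((m : ℂ) - n) • R.rightOp (m + n) a) := by
  refine Subtype.ext (funext fun k => LinearMap.ext fun w => ?_)
  obtain ⟨N₁, h₁⟩ := R.right_right m n a k w
  obtain ⟨N₂, h₂⟩ := R.right_right n m a k w
  obtain ⟨N, hN⟩ := R.smooth w
  obtain ⟨M, hM1, hM2, hM⟩ : ∃ M : ℕ, N₁ ≤ M + 1 ∧ N₂ ≤ M + 1 ∧ N + 1 ≤ M :=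
    ⟨N₁ + N₂ + N + 1, by omega, by omega, by omega⟩
  change R.right m (R.rightOp n a) k w - R.right n (R.rightOp m a) k w =
    -(((m : ℂ) - n) • R.right (m + n) a k w)
  rw [h₁ (M + 1) hM1, h₂ (M + 1) hM2,
    R.right_eq (m + n) a k w M (fun j hj => by rw [hN (j - 1) (by omega), map_zero]),
    Finset.sum_comm (s := Finset.range (M + 1)) (t := Finset.range (M + 1))
      (f := fun i j => (rc n i * rc m j) • a.1 (k + n + m + 2 - (i + j : ℕ))
        (R.L ((j : ℤ) - 1) (R.L ((i : ℤ) - 1) w))),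
    ← Finset.sum_sub_distrib]
  simp only [← Finset.sum_sub_distrib]
  have hterm : ∀ i j : ℕ,
      (rc m i * rc n j) • a.1 (k + m + n + 2 - (i + j : ℕ))
          (R.L ((j : ℤ) - 1) (R.L ((i : ℤ) - 1) w)) -
        (rc n j * rc m i) • a.1 (k + n + m + 2 - (j + i : ℕ))
          (R.L ((i : ℤ) - 1) (R.L ((j : ℤ) - 1) w)) =
      ((-1 : ℂ) ^ (m + n) * (-1) ^ (i + j) *
          (((j - i : ℤ) * (bin (m + 1) i * bin (n + 1) j) : ℤ) : ℂ)) •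
        a.1 (k + m + n + 2 - (i + j : ℕ)) (R.L ((i + j : ℕ) - 2) w) := by
    intro i j
    have hc : (((j : ℤ) - 1 : ℤ) : ℂ) ^ 3 - (((j : ℤ) - 1 : ℤ) : ℂ) = 0 ∨
        ¬ (j : ℤ) - 1 + ((i : ℤ) - 1) = 0 := by
      by_cases h : (j : ℤ) - 1 + ((i : ℤ) - 1) = 0
      · left
        have : j = 0 ∨ j = 1 ∨ j = 2 := by omega
        rcases this with rfl | rfl | rfl <;> norm_num
      · exact Or.inr h
    have hz : (if (j : ℤ) - 1 + ((i : ℤ) - 1) = 0 then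
        (((((j : ℤ) - 1 : ℤ) : ℂ) ^ 3 - (((j : ℤ) - 1 : ℤ) : ℂ)) / 12 * c) • w else 0) = 0 := by
      rcases hc with hc | hc
      · rw [hc]
        simp
      · rw [if_neg hc]
    rw [add_comm j i, R.comm ((j : ℤ) - 1) ((i : ℤ) - 1), hz, add_zero, map_add, map_smul,
      show (j : ℤ) - 1 + ((i : ℤ) - 1) = ((i + j : ℕ) : ℤ) - 2 by push_cast; ring,
      show k + n + m + 2 = k + m + n + 2 by ring]
    have hs : rc m i * rc n j = (-1 : ℂ) ^ (m + n) * (-1) ^ (i + j) *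
        ((bin (m + 1) i * bin (n + 1) j : ℤ) : ℂ) := by
      rw [rc, rc, neg_one_zpow_sub_natCast, neg_one_zpow_sub_natCast,
        zpow_add₀ (by norm_num), zpow_add₀ (by norm_num), zpow_add₀ (by norm_num)]
      push_cast
      ring
    rw [mul_comm (rc n j), hs]
    push_cast
    module
  simp only [hterm]
  rw [sum_triangle _ (M + 1) (fun i j hij => by
    rw [hN ((i + j : ℕ) - 2) (by omega), map_zero, smul_zero])]
  have hdiag : ∀ s : ℕ, ∑ p ∈ Finset.HasAntidiagonal.antidiagonal s,
      ((-1 : ℂ) ^ (m + n) * (-1) ^ (p.1 + p.2) *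
          (((p.2 - p.1 : ℤ) * (bin (m + 1) p.1 * bin (n + 1) p.2) : ℤ) : ℂ)) •
        a.1 (k + m + n + 2 - (p.1 + p.2 : ℕ)) (R.L ((p.1 + p.2 : ℕ) - 2) w) =
      ((-1 : ℂ) ^ (m + n) * (-1) ^ s * ((∑ p ∈ Finset.HasAntidiagonal.antidiagonal s,
          (p.2 - p.1 : ℤ) * (bin (m + 1) p.1 * bin (n + 1) p.2) : ℤ) : ℂ)) •
        a.1 (k + m + n + 2 - s) (R.L (s - 2) w) := by
    intro s
    have h1 : ∀ p ∈ Finset.HasAntidiagonal.antidiagonal s, p.1 + p.2 = s :=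
      fun p hp => Finset.HasAntidiagonal.mem_antidiagonal.mp hp
    rw [Finset.sum_congr rfl (fun p hp => by rw [h1 p hp]), ← Finset.sum_smul, ← Finset.mul_sum,
      ← Int.cast_sum]
  simp only [hdiag]
  rw [Finset.sum_range_succ']
  simp only [bin_sum_right]
  rw [Finset.smul_sum, ← Finset.sum_neg_distrib]
  simp only [Finset.HasAntidiagonal.antidiagonal_zero, Finset.sum_singleton, Nat.cast_zero,
    sub_self, zero_mul, Int.cast_zero, mul_zero, zero_smul, add_zero]
  refine Finset.sum_congr rfl fun s _ => ?_
  rw [show ((s + 1 : ℕ) : ℤ) - 2 = s - 1 by push_cast; ring,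
    show k + m + n + 2 - ((s + 1 : ℕ) : ℤ) = k + (m + n) + 1 - s by push_cast; ring, smul_smul,
    ← neg_smul, rc, neg_one_zpow_sub_natCast, zpow_add_one₀ (by norm_num)]
  congr 1
  push_cast
  ring

theorem fieldOp_comm (m n : ℤ) (a : fields W) :
    R.fieldOp m (R.fieldOp n a) - R.fieldOp n (R.fieldOp m a) =
      ((m : ℂ) - n) • R.fieldOp (m + n) a +
        (if m + n = 0 then (((m : ℂ) ^ 3 - m) / 12 * c) • a else 0) := by
  have h1 := R.left_comm' m n a
  have h2 := R.right_comm' m n a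
  simp only [fieldOp, LinearMap.sub_apply, map_sub, R.left_right_comm, smul_sub]
  rw [sub_eq_iff_eq_add] at h1 h2
  rw [h1, h2]
  abel

/-- The action of the Virasoro algebra on fields. -/
def fieldLin : Vir →ₗ[ℂ] Module.End ℂ (fields W) :=
  (Finsupp.linearCombination ℂ R.fieldOp).comp Vir.coord +
    LinearMap.toSpanSingleton ℂ _ (c • (1 : Module.End ℂ (fields W))) ∘ₗ Vir.ccoord

theorem fieldLin_L (n : ℤ) : R.fieldLin (Vir.L n) = R.fieldOp n := by
  simp [fieldLin]

theorem fieldLin_C : R.fieldLin Vir.C = c • (1 : Module.End ℂ (fields W)) := by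
  simp [fieldLin]

theorem fieldLin_lie (x y : Vir) : R.fieldLin ⁅x, y⁆ =
    R.fieldLin x * R.fieldLin y - R.fieldLin y * R.fieldLin x := by
  let B : Vir →ₗ[ℂ] Vir →ₗ[ℂ] Module.End ℂ (fields W) :=
    (LinearMap.mul ℂ (Module.End ℂ (fields W))).compl₁₂ R.fieldLin R.fieldLin
  let F : Vir →ₗ[ℂ] Vir →ₗ[ℂ] Module.End ℂ (fields W) := Vir.bracket.compr₂ R.fieldLin
  let B' : Vir →ₗ[ℂ] Vir →ₗ[ℂ] Module.End ℂ (fields W) := B.flip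
  have hLL : ∀ m n : ℤ, F (Vir.L m) (Vir.L n) + B' (Vir.L m) (Vir.L n) =
      B (Vir.L m) (Vir.L n) := by
    intro m n
    refine LinearMap.ext fun a => ?_
    have := R.fieldOp_comm m n a
    simp only [LinearMap.compr₂_apply, Vir.bracket_L_L, Vir.structureConst, map_add, map_smul,
      R.fieldLin_L, LinearMap.flip_apply, F, B', B, LinearMap.compl₁₂_apply,
      LinearMap.mul_apply', Module.End.mul_apply, LinearMap.add_apply, LinearMap.smul_apply]
    rw [← eq_sub_iff_add_eq, this]
    split_ifs
    · rw [map_smul, R.fieldLin_C, smul_smul]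
      rfl
    · rw [map_zero]
      rfl
  have hL : ∀ m : ℤ, F (Vir.L m) + B' (Vir.L m) = B (Vir.L m) := by
    intro m
    refine Vir.hom_ext (hLL m) ?_
    simp [F, B', B, Vir.bracket_C_right, R.fieldLin_C]
  have hC : F Vir.C + B' Vir.C = B Vir.C := by
    refine LinearMap.ext fun y => ?_
    simp [F, B', B, Vir.bracket_C_left, R.fieldLin_C]
  have h : F + B' = B := Vir.hom_ext hL hC
  have h2 : F x y + B' x y = B x y :=
    congrArg (fun f : Vir →ₗ[ℂ] Vir →ₗ[ℂ] Module.End ℂ (fields W) => f x y) h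
  refine LinearMap.ext fun a => ?_
  have h3 : F x y a + B' x y a = B x y a := congrArg (fun f : Module.End ℂ (fields W) => f a) h2
  change F x y a = B x y a - B' x y a
  rw [← h3, add_sub_cancel_right]

/-- The action of `U(vir)` on fields. -/
def fieldAlg : UVir →ₐ[ℂ] Module.End ℂ (fields W) :=
  UniversalEnvelopingAlgebra.lift ℂ
    { R.fieldLin with map_lie' := fun {x y} => R.fieldLin_lie x y }

theorem fieldAlg_uL (n : ℤ) : R.fieldAlg (uL n) = R.fieldOp n :=
  (UniversalEnvelopingAlgebra.lift_ι_apply ℂ _ _).trans (R.fieldLin_L n)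

theorem fieldAlg_uC : R.fieldAlg uC = c • (1 : Module.End ℂ (fields W)) :=
  (UniversalEnvelopingAlgebra.lift_ι_apply ℂ _ _).trans R.fieldLin_C

/-- The identity field: the constant series `id`. -/
def idField (W : Type*) [AddCommGroup W] [Module ℂ W] : fields W :=
  ⟨fun n => if n = -1 then 1 else 0, fun w => ⟨0, fun n hn => by
    simp only [if_neg (show ¬ n = -1 by omega)]
    rfl⟩⟩

theorem idField_apply (k : ℤ) (w : W) : (idField W).1 k w = if k = -1 then w else 0 := by
  change (if k = -1 then (1 : Module.End ℂ W) else 0) w = _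
  split_ifs <;> rfl

theorem left_idField (m k : ℤ) (w : W) : R.left m (idField W) k w =
    if k ≤ -1 then lc m (-1 - k).toNat • R.L (m + 1 + k) w else 0 := by
  change ∑ᶠ j : ℕ, lc m j • R.L (m - j) ((idField W).1 (k + j) w) = _
  simp only [idField_apply]
  split_ifs with h
  · rw [finsum_eq_single _ (-1 - k).toNat (fun j hj => by
      rw [if_neg (by omega), map_zero, smul_zero]), if_pos (by omega),
      show m - ((-1 - k).toNat : ℤ) = m + 1 + k by omega]
  · refine (finsum_congr fun j => ?_).trans finsum_zero
    rw [if_neg (by omega), map_zero, smul_zero]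

theorem right_idField (m k : ℤ) (w : W) : R.right m (idField W) k w =
    if 0 ≤ k + m + 2 then rc m (k + m + 2).toNat • R.L (m + 1 + k) w else 0 := by
  change ∑ᶠ j : ℕ, rc m j • (idField W).1 (k + m + 1 - j) (R.L ((j : ℤ) - 1) w) = _
  simp only [idField_apply]
  split_ifs with h
  · rw [finsum_eq_single _ (k + m + 2).toNat (fun j hj => by
      rw [if_neg (by omega), smul_zero]), if_pos (by omega),
      show ((k + m + 2).toNat : ℤ) - 1 = m + 1 + k by omega]
  · refine (finsum_congr fun j => ?_).trans finsum_zero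
    rw [if_neg (by omega), smul_zero]

/-- For `m ≥ -1` the two expansions of `(ζ - z)^{m+1}` agree, so that the two terms cancel on
the identity field. -/
theorem fieldOp_idField (m : ℤ) (hm : -1 ≤ m) : R.fieldOp m (idField W) = 0 := by
  refine Subtype.ext (funext fun k => LinearMap.ext fun w => ?_)
  change R.left m (idField W) k w - R.right m (idField W) k w = 0
  obtain ⟨p, rfl⟩ : ∃ p : ℕ, m = p - 1 := ⟨(m + 1).toNat, by omega⟩
  rw [left_idField, right_idField]
  have hl : ∀ j : ℕ, lc ((p : ℤ) - 1) j = (-1) ^ j * (p.choose j : ℂ) := fun j => by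
    rw [lc, sub_add_cancel, bin, Ring.choose_natCast]
    push_cast
    rfl
  have hr : ∀ j : ℕ, rc ((p : ℤ) - 1) j = (-1) ^ (p + j) * (p.choose j : ℂ) := fun j => by
    rw [rc, sub_add_cancel, bin, Ring.choose_natCast, neg_one_zpow_sub_natCast, zpow_natCast,
      pow_add]
    push_cast
    rfl
  rw [hl, hr]
  by_cases h1 : k ≤ -1
  · rw [if_pos h1]
    by_cases h2 : 0 ≤ k + ((p : ℤ) - 1) + 2
    · rw [if_pos h2]
      obtain ⟨j, hj⟩ : ∃ j : ℕ, k = -1 - j := ⟨(-1 - k).toNat, by omega⟩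
      subst hj
      rw [show (-1 - (-1 - (j : ℤ))).toNat = j by omega,
        show (-1 - (j : ℤ) + ((p : ℤ) - 1) + 2).toNat = p - j by omega,
        Nat.choose_symm (by omega : j ≤ p), ← sub_smul]
      rw [show p + (p - j) = 2 * (p - j) + j by omega, pow_add, pow_mul]
      simp
    · rw [if_neg h2, Nat.choose_eq_zero_of_lt (by omega)]
      simp
  · rw [if_neg h1, if_pos (by omega), Nat.choose_eq_zero_of_lt (by omega)]
    simp

/-- The conformal vector acts through the field `∑ L_n z^{-n-2}`. -/
theorem fieldOp_neg_two_idField (k : ℤ) :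
    (R.fieldOp (-2) (idField W)).1 k = R.L (k - 1) := by
  refine LinearMap.ext fun w => ?_
  change R.left (-2) (idField W) k w - R.right (-2) (idField W) k w = _
  have hb : ∀ j : ℕ, bin (-2 + 1) j = (-1) ^ j := fun j => by
    rw [show (-2 + 1 : ℤ) = -1 by norm_num, bin, Ring.choose_neg]
    rw [show (1 : ℤ) + j - 1 = (j : ℕ) by ring, Ring.choose_natCast, Nat.choose_self]
    simp [Units.smul_def, Int.negOnePow_def]
  have hl : ∀ j : ℕ, lc (-2) j = 1 := fun j => by
    rw [lc, hb]
    push_cast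
    rw [← mul_pow]
    norm_num
  have hr : ∀ j : ℕ, rc (-2) j = -1 := fun j => by
    rw [rc, neg_one_zpow_sub_natCast, hb]
    push_cast
    rw [mul_assoc, ← mul_pow]
    norm_num
  rw [left_idField, right_idField, hl, hr, show -2 + 1 + k = k - 1 by ring]
  by_cases h1 : k ≤ -1
  · rw [if_pos h1, if_neg (by omega)]
    simp
  · rw [if_neg h1, if_pos (by omega)]
    simp

/-- The linear map `u ↦ u · id` from `U(vir)` to fields. -/
def fieldOrbit : UVir →ₗ[ℂ] fields W :=
  LinearMap.applyₗ (idField W) ∘ₗ R.fieldAlg.toLinearMap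

theorem fieldOrbit_apply (u : UVir) : R.fieldOrbit u = R.fieldAlg u (idField W) := rfl

theorem fieldOrbit_mul (u v : UVir) : R.fieldOrbit (u * v) = R.fieldAlg u (R.fieldOrbit v) := by
  rw [fieldOrbit_apply, map_mul]
  rfl

theorem fieldOrbit_vermaIdeal (u : UVir) (hu : u ∈ vermaIdeal c 0) : R.fieldOrbit u = 0 := by
  induction hu using Submodule.span_induction with
  | mem x hx =>
    rcases hx with (rfl | rfl) | ⟨n, hn, rfl⟩
    · rw [fieldOrbit_apply, map_sub, fieldAlg_uC, AlgHom.commutes, ← Algebra.algebraMap_eq_smul_one,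
        sub_self]
      rfl
    · rw [fieldOrbit_apply, map_zero, sub_zero, fieldAlg_uL, R.fieldOp_idField 0 (by norm_num)]
    · rw [fieldOrbit_apply, fieldAlg_uL, R.fieldOp_idField n (by omega)]
  | zero => exact map_zero _
  | add x y _ _ hx hy => rw [map_add, hx, hy, add_zero]
  | smul a x _ hx => rw [smul_eq_mul, fieldOrbit_mul, hx, map_zero]

/-- The induced map from the Verma module of weight `0` to fields. -/
def vermaToFields : Verma c 0 →ₗ[ℂ] fields W :=
  ((vermaIdeal c 0).restrictScalars ℂ).liftQ R.fieldOrbit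
      (fun u hu => R.fieldOrbit_vermaIdeal u hu) ∘ₗ
    (Submodule.Quotient.restrictScalarsEquiv ℂ (vermaIdeal c 0)).symm.toLinearMap

theorem vermaToFields_smul_hwv (u : UVir) :
    R.vermaToFields (u • Verma.hwv c 0) = R.fieldAlg u (idField W) := by
  rw [Verma.hwv, ← map_smul, smul_eq_mul, mul_one]
  rfl

theorem vermaToFields_smul (u : UVir) (x : Verma c 0) :
    R.vermaToFields (u • x) = R.fieldAlg u (R.vermaToFields x) := by
  obtain ⟨y, rfl⟩ := (Verma.isHighestWeightVector c 0).cyclic x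
  rw [← mul_smul, vermaToFields_smul_hwv, vermaToFields_smul_hwv, map_mul]
  rfl

theorem vermaToFields_span (x : Verma c 0)
    (hx : x ∈ Submodule.span UVir {uL (-1) • Verma.hwv c 0}) : R.vermaToFields x = 0 := by
  obtain ⟨u, rfl⟩ := Submodule.mem_span_singleton.mp hx
  rw [vermaToFields_smul, vermaToFields_smul_hwv, fieldAlg_uL,
    R.fieldOp_idField (-1) le_rfl, map_zero]

/-- The vertex operator map `v ↦ Y_W(v, z)` of `V_c` on a smooth representation `W` of central
charge `c`. It is the linear map with `Y_W(1, z) = id` and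
`Y_W(L_m v, z) = Res_ζ ((ζ - z)^{m+1} T(ζ) Y_W(v, z) - (-z + ζ)^{m+1} Y_W(v, z) T(ζ))`,
where `T(ζ) = ∑ L_n ζ^{-n-2}`; in particular `Y_W(ω, z) = T(z)`. -/
def Y : Vc c →ₗ[ℂ] fields W :=
  ((Submodule.span UVir {uL (-1) • Verma.hwv c 0}).restrictScalars ℂ).liftQ R.vermaToFields
      (fun x hx => R.vermaToFields_span x hx) ∘ₗ
    (Submodule.Quotient.restrictScalarsEquiv ℂ
      (Submodule.span UVir {uL (-1) • Verma.hwv c 0})).symm.toLinearMap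

theorem Y_smul_vacuum (u : UVir) : R.Y (u • vacuum c) = R.fieldAlg u (idField W) := by
  rw [vacuum, ← map_smul]
  exact R.vermaToFields_smul_hwv u

theorem Y_vacuum : R.Y (vacuum c) = idField W := by
  have := R.Y_smul_vacuum 1
  rwa [one_smul, map_one] at this

theorem Y_uL (m : ℤ) (v : Vc c) : R.Y (uL m • v) = R.fieldOp m (R.Y v) := by
  obtain ⟨u, rfl⟩ := (vacuum_isHighestWeightVector c).cyclic v
  rw [← mul_smul, Y_smul_vacuum, Y_smul_vacuum, map_mul, fieldAlg_uL]
  rfl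

theorem Y_conformalVector (k : ℤ) : (R.Y (conformalVector c)).1 k = R.L (k - 1) := by
  rw [conformalVector, Y_uL, Y_vacuum, fieldOp_neg_two_idField]

end SmoothRep

end Fields

section Derivative

variable {c : ℂ} {W : Type*} [AddCommGroup W] [Module ℂ W]

/-- The derivative `d/dz` of a field. -/
def der : Module.End ℂ (fields W) where
  toFun a := ⟨fun k => (-k : ℂ) • a.1 (k - 1), fun w => by
    obtain ⟨N, hN⟩ := a.2 w
    refine ⟨N + 1, fun n hn => ?_⟩
    simp only [LinearMap.smul_apply]
    rw [hN (n - 1) (by omega), smul_zero]⟩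
  map_add' a b := Subtype.ext (funext fun _ => smul_add _ _ _)
  map_smul' r a := Subtype.ext (funext fun k => LinearMap.ext fun w =>
    smul_comm (-k : ℂ) r (a.1 (k - 1) w))

theorem der_apply (a : fields W) (k : ℤ) (w : W) :
    (der a).1 k w = (-k : ℂ) • a.1 (k - 1) w := rfl

namespace SmoothRep

variable (R : SmoothRep c W)

theorem lc_succ (m : ℤ) (i : ℕ) :
    ((i : ℂ) + 1) * lc m (i + 1) = -((m : ℂ) + 1) * lc (m - 1) i := by
  have h : (((i : ℤ) + 1) * bin (m + 1) (i + 1) : ℤ) = ((m + 1) * bin (m + 1 - 1) i : ℤ) :=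
    succ_mul_bin (m + 1) i
  have h2 := congrArg (fun x : ℤ => (x : ℂ)) h
  push_cast at h2
  rw [lc, lc, show m - 1 + 1 = m + 1 - 1 by ring, pow_succ]
  linear_combination (-(-1 : ℂ) ^ i) * h2

theorem sub_mul_rc (m : ℤ) (j : ℕ) :
    ((m : ℂ) + 1 - j) * rc m j = -((m : ℂ) + 1) * rc (m - 1) j := by
  have h := sub_mul_bin (m + 1) j
  have h2 := congrArg (fun x : ℤ => (x : ℂ)) h
  push_cast at h2
  rw [rc, rc, neg_one_zpow_sub_natCast, neg_one_zpow_sub_natCast,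
    show m - 1 + 1 = m + 1 - 1 by ring, zpow_sub_one₀ (by norm_num)]
  norm_num
  rw [add_sub_cancel_right] at h2
  linear_combination ((-1 : ℂ) ^ (m + 1) * (-1) ^ j) * h2

theorem der_leftOp (m : ℤ) (a : fields W) :
    der (R.leftOp m a) = R.leftOp m (der a) - ((m : ℂ) + 1) • R.leftOp (m - 1) a := by
  refine Subtype.ext (funext fun k => LinearMap.ext fun w => ?_)
  obtain ⟨N, hN⟩ := a.2 w
  obtain ⟨M, hM⟩ : ∃ M : ℕ, ∀ p : ℤ, k - 1 + M ≤ p → a.1 p w = 0 :=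
    ⟨N + k.natAbs + 1, fun p hp => hN p (by omega)⟩
  change (-k : ℂ) • R.left m a (k - 1) w =
    R.left m (der a) k w - ((m : ℂ) + 1) • R.left (m - 1) a k w
  rw [R.left_eq m a (k - 1) w (M + 1) (fun j hj => hM _ (by omega)),
    R.left_eq m (der a) k w (M + 1) (fun j hj => by
      rw [der_apply, hM _ (by omega), smul_zero]),
    R.left_eq (m - 1) a k w M (fun j hj => hM _ (by omega))]
  have h1 : ∀ j : ℕ, lc m j • R.L (m - j) ((der a).1 (k + j) w) =
      (-k : ℂ) • lc m j • R.L (m - j) (a.1 (k - 1 + j) w) -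
        ((j : ℂ) * lc m j) • R.L (m - j) (a.1 (k - 1 + j) w) := by
    intro j
    rw [der_apply, map_smul, show k + (j : ℤ) - 1 = k - 1 + j by ring]
    push_cast
    module
  simp only [h1]
  rw [Finset.sum_sub_distrib, Finset.smul_sum,
    Finset.sum_range_succ' (fun j : ℕ => ((j : ℂ) * lc m j) • R.L (m - j) (a.1 (k - 1 + j) w)),
    Finset.smul_sum]
  have h2 : ∀ i : ℕ, (((i + 1 : ℕ) : ℂ) * lc m (i + 1)) • R.L (m - ((i + 1 : ℕ) : ℤ))
      (a.1 (k - 1 + ((i + 1 : ℕ) : ℤ)) w) =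
      -(((m : ℂ) + 1) • lc (m - 1) i • R.L (m - 1 - i) (a.1 (k + i) w)) := by
    intro i
    rw [show ((i + 1 : ℕ) : ℂ) = (i : ℂ) + 1 by push_cast; ring, lc_succ,
      show m - ((i + 1 : ℕ) : ℤ) = m - 1 - i by push_cast; ring,
      show k - 1 + ((i + 1 : ℕ) : ℤ) = k + i by push_cast; ring]
    module
  simp only [h2, Finset.sum_neg_distrib]
  simp

theorem der_rightOp (m : ℤ) (a : fields W) :
    der (R.rightOp m a) = R.rightOp m (der a) - ((m : ℂ) + 1) • R.rightOp (m - 1) a := by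
  refine Subtype.ext (funext fun k => LinearMap.ext fun w => ?_)
  obtain ⟨N, hN⟩ := R.field_L_bound a w
  change (-k : ℂ) • R.right m a (k - 1) w =
    R.right m (der a) k w - ((m : ℂ) + 1) • R.right (m - 1) a k w
  rw [R.right_eq m a (k - 1) w N (fun j hj => hN _ _ (Or.inl hj)),
    R.right_eq m (der a) k w N (fun j hj => by
      rw [der_apply, hN _ _ (Or.inl hj), smul_zero]),
    R.right_eq (m - 1) a k w N (fun j hj => hN _ _ (Or.inl hj)), Finset.smul_sum,
    Finset.smul_sum, ← Finset.sum_sub_distrib]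
  refine Finset.sum_congr rfl fun j _ => ?_
  rw [der_apply, show k + m + 1 - (j : ℤ) - 1 = k - 1 + m + 1 - j by ring,
    show k + (m - 1) + 1 - (j : ℤ) = k - 1 + m + 1 - j by ring, smul_smul, smul_smul, smul_smul,
    ← sub_smul]
  congr 1
  have := sub_mul_rc m j
  push_cast
  linear_combination this

theorem der_fieldOp (m : ℤ) (a : fields W) :
    der (R.fieldOp m a) = R.fieldOp m (der a) - ((m : ℂ) + 1) • R.fieldOp (m - 1) a := by
  simp only [fieldOp, LinearMap.sub_apply, map_sub, der_leftOp, der_rightOp, smul_sub]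
  abel

/-- The derivative property `Y_W(L_{-1} v, z) = d/dz Y_W(v, z)`. -/
theorem Y_derivative (v : Vc c) : R.Y (uL (-1) • v) = der (R.Y v) := by
  let S : Submodule ℂ (Vc c) := LinearMap.ker ((R.fieldOp (-1) - der) ∘ₗ R.Y)
  have hS : ∀ x : Vc c, x ∈ S ↔ R.fieldOp (-1) (R.Y x) = der (R.Y x) := fun x => by
    rw [LinearMap.mem_ker, LinearMap.comp_apply, LinearMap.sub_apply, sub_eq_zero]
  rw [Y_uL]
  refine (hS v).mp ((vacuum_isHighestWeightVector c).induction S ?_ ?_ ?_ v)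
  · rw [hS, Y_vacuum, R.fieldOp_idField (-1) le_rfl]
    refine (Subtype.ext (funext fun k => LinearMap.ext fun w => ?_)).symm
    rw [der_apply, idField_apply]
    split_ifs with h
    · obtain rfl : k = 0 := by omega
      simp
    · simp
  · intro m x hx
    rw [hS] at hx ⊢
    have h := R.fieldOp_comm (-1) m (R.Y x)
    rw [Y_uL, der_fieldOp, ← hx]
    rw [sub_eq_iff_eq_add] at h
    rw [h, show -1 + m = m - 1 by ring]
    split_ifs with h0
    · obtain rfl : m = 1 := by omega
      norm_num
      module
    · push_cast
      module
  · intro x hx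
    rw [(vacuum_isHighestWeightVector c).uC_smul]
    exact S.smul_mem _ hx

theorem fieldOp_neg_one_apply (a : fields W) (k : ℤ) (w : W) :
    (R.fieldOp (-1) a).1 k w = R.L (-1) (a.1 k w) - a.1 k (R.L (-1) w) := by
  change R.left (-1) a k w - R.right (-1) a k w = _
  have hb : ∀ j : ℕ, j ≠ 0 → bin 0 j = 0 := fun j hj => by
    rw [bin, Ring.choose_zero_pos ℤ (Nat.pos_of_ne_zero hj)]
  congr 1
  · refine (finsum_eq_single _ 0 fun j hj => ?_).trans ?_
    · simp [lc, hb j hj]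
    · simp [lc]
  · refine (finsum_eq_single _ 0 fun j hj => ?_).trans ?_
    · simp [rc, hb j hj]
    · simp [rc]

theorem fieldOp_zero_apply (a : fields W) (k : ℤ) (w : W) :
    (R.fieldOp 0 a).1 k w = R.L 0 (a.1 k w) - a.1 k (R.L 0 w) -
      (R.fieldOp (-1) a).1 (k + 1) w := by
  rw [fieldOp_neg_one_apply]
  change R.left 0 a k w - R.right 0 a k w = _
  have hb : ∀ j : ℕ, 2 ≤ j → bin 1 j = 0 := fun j hj => by
    have h := Ring.choose_natCast (R := ℤ) 1 j
    rw [Nat.choose_eq_zero_of_lt hj] at h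
    simpa using h
  have hl : R.left 0 a k w = R.L 0 (a.1 k w) - R.L (-1) (a.1 (k + 1) w) := by
    refine (finsum_eq_range (N := 2) fun j hj => ?_).trans ?_
    · simp [lc, hb j hj]
    · simp [Finset.sum_range_succ, lc, sub_eq_add_neg]
  have hr : R.right 0 a k w = a.1 k (R.L 0 w) - a.1 (k + 1) (R.L (-1) w) := by
    refine (finsum_eq_range (N := 2) fun j hj => ?_).trans ?_
    · simp [rc, hb j hj]
    · simp [Finset.sum_range_succ, rc, sub_eq_add_neg, add_comm]
  rw [hl, hr]
  abel

/-- For `v` of weight `e`, the mode `v_(m)` shifts the `L_0`-eigenvalue by `e - m - 1`. -/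
theorem mode_weight {e : ℂ} {v : Vc c} (hv : uL 0 • v = e • v) (m : ℤ) {η : ℂ} {w : W}
    (hw : R.L 0 w = η • w) :
    R.L 0 ((R.Y v).1 m w) = (η + e - m - 1) • (R.Y v).1 m w := by
  have h := R.fieldOp_zero_apply (R.Y v) m w
  rw [← Y_uL, ← Y_uL, Y_derivative, der_apply, hv, map_smul, hw, map_smul] at h
  change e • (R.Y v).1 m w = _ at h
  rw [add_sub_cancel_right] at h
  have h2 : R.L 0 ((R.Y v).1 m w) = e • (R.Y v).1 m w + η • (R.Y v).1 m w +
      (-((m + 1 : ℤ) : ℂ)) • (R.Y v).1 m w := by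
    rw [h]
    abel
  rw [h2]
  push_cast
  module

end SmoothRep

end Derivative

section Grading

open IsHighestWeightVector

theorem op_weight {M : Type*} [AddCommGroup M] [Module ℂ M] [Module UVir M]
    [IsScalarTower ℂ UVir M] {c h : ℂ} {v : M} (hv : IsHighestWeightVector c h v)
    (n : ℤ) {η : ℂ} {x : M} (hx : x ∈ (op M 0).eigenspace η) :
    op M n x ∈ (op M 0).eigenspace (η - n) := by
  rw [Module.End.mem_eigenspace_iff] at hx ⊢
  rw [hv.op_comm, hx, zero_add, map_smul]
  split_ifs
  · norm_num
    module
  · norm_num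
    module

/-- A highest weight module is the sum of the `L_0`-eigenspaces of eigenvalues `h + d` with
`d = 0, 1, 2, …`. -/
theorem iSup_eigenspace_eq_top {M : Type*} [AddCommGroup M] [Module ℂ M] [Module UVir M]
    [IsScalarTower ℂ UVir M] {c h : ℂ} {v : M} (hv : IsHighestWeightVector c h v) :
    ⨆ d : ℕ, (op M 0).eigenspace (h + d) = ⊤ := by
  let good : Set (Submodule ℂ M) :=
    {T | v ∈ T ∧ ∀ n : ℤ, n < 0 → ∀ x ∈ T, op M n x ∈ T}
  let P : Submodule ℂ M := sInf good
  have hPv : v ∈ P := Submodule.mem_sInf.mpr fun T hT => hT.1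
  have hPL : ∀ n : ℤ, n < 0 → ∀ x ∈ P, op M n x ∈ P := fun n hn x hx =>
    Submodule.mem_sInf.mpr fun T hT => hT.2 n hn x (Submodule.mem_sInf.mp hx T hT)
  have hP : ∀ x ∈ P, ∀ m : ℤ, op M m x ∈ P := by
    let T : Submodule ℂ M := P ⊓ ⨅ m : ℤ, P.comap (op M m)
    have hT : ∀ x, x ∈ T ↔ x ∈ P ∧ ∀ m : ℤ, op M m x ∈ P := fun x => by
      simp [T, Submodule.mem_iInf]
    have hle : P ≤ T := by
      refine sInf_le ⟨(hT v).mpr ⟨hPv, fun m => ?_⟩, fun n hn x hx => ?_⟩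
      · rcases lt_trichotomy m 0 with hm | rfl | hm
        · exact hPL m hm v hPv
        · rw [op_apply, hv.weight]
          exact P.smul_mem _ hPv
        · rw [op_apply, hv.pos m hm]
          exact P.zero_mem
      · rw [hT] at hx ⊢
        refine ⟨hPL n hn x hx.1, fun m => ?_⟩
        rw [hv.op_comm]
        refine P.add_mem (hPL n hn _ (hx.2 m)) (P.add_mem (P.smul_mem _ (hx.2 _)) ?_)
        split_ifs
        · exact P.smul_mem _ hx.1
        · exact P.zero_mem
    exact fun x hx => ((hT x).mp (hle hx)).2
  have htop : P = ⊤ := by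
    refine eq_top_iff.mpr fun x _ => hv.induction P hPv (fun n x hx => hP x hx n) ?_ x
    intro x hx
    rw [hv.uC_smul]
    exact P.smul_mem _ hx
  rw [eq_top_iff, ← htop]
  refine sInf_le ⟨?_, fun n hn x hx => ?_⟩
  · refine Submodule.mem_iSup_of_mem 0 ?_
    rw [Module.End.mem_eigenspace_iff, op_apply, hv.weight]
    simp
  · have hmap : (⨆ d : ℕ, (op M 0).eigenspace (h + d)) ≤
        (⨆ d : ℕ, (op M 0).eigenspace (h + d)).comap (op M n) := by
      refine iSup_le fun d y hy => ?_
      have := op_weight hv n hy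
      refine Submodule.mem_iSup_of_mem (d + (-n).toNat) ?_
      have hz : (((-n).toNat : ℤ) : ℂ) = ((-n : ℤ) : ℂ) := by
        rw [Int.toNat_of_nonneg (by omega)]
      push_cast at hz ⊢
      rw [hz]
      convert this using 2
      ring
    exact hmap hx

/-- The homogeneous subspace of weight `d` of `V_c`. -/
def Vgr (c : ℂ) (d : ℕ) : Submodule ℂ (Vc c) := (op (Vc c) 0).eigenspace (d : ℂ)

theorem mem_Vgr {c : ℂ} {d : ℕ} {v : Vc c} : v ∈ Vgr c d ↔ uL 0 • v = (d : ℂ) • v :=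
  Module.End.mem_eigenspace_iff

theorem iSup_Vgr (c : ℂ) : ⨆ d : ℕ, Vgr c d = ⊤ := by
  have := iSup_eigenspace_eq_top (vacuum_isHighestWeightVector c)
  simp only [zero_add] at this
  exact this

theorem Vgr_isInternal (c : ℂ) : DirectSum.IsInternal (Vgr c) := by
  refine DirectSum.isInternal_submodule_of_iSupIndep_of_iSup_eq_top ?_ (iSup_Vgr c)
  exact (op (Vc c) 0).eigenspaces_iSupIndep.comp Nat.cast_injective

/-- The decomposition of `V_c` into its homogeneous subspaces. -/
def gradingEquiv (c : ℂ) : (DirectSum ℕ fun d => Vgr c d) ≃ₗ[ℂ] Vc c :=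
  LinearEquiv.ofBijective (DirectSum.coeLinearMap (Vgr c)) (Vgr_isInternal c)

theorem uL_one_pow_weight {c : ℂ} {d : ℕ} {v : Vc c} (hv : v ∈ Vgr c d) (i : ℕ) :
    uL 0 • ((op (Vc c) 1 ^ i) v) = ((d : ℂ) - i) • ((op (Vc c) 1 ^ i) v) := by
  induction i with
  | zero => simpa using mem_Vgr.mp hv
  | succ i ih =>
    rw [pow_succ', Module.End.mul_apply]
    have := op_weight (vacuum_isHighestWeightVector c) 1
      (Module.End.mem_eigenspace_iff.mpr ih)
    rw [Module.End.mem_eigenspace_iff] at this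
    refine this.trans ?_
    push_cast
    congr 1
    ring

/-- Negative weights do not occur in `V_c`: one has `L_1^i v = 0` when `i` exceeds the weight
of `v`. -/
theorem uL_one_pow_eq_zero {c : ℂ} {d : ℕ} {v : Vc c} (hv : v ∈ Vgr c d) {i : ℕ} (hi : d < i) :
    (op (Vc c) 1 ^ i) v = 0 := by
  have hind := (op (Vc c) 0).eigenspaces_iSupIndep ((d : ℂ) - i)
  have htop : ⨆ ν : ℂ, ⨆ _ : ν ≠ (d : ℂ) - i, (op (Vc c) 0).eigenspace ν = ⊤ := by
    rw [eq_top_iff, ← iSup_Vgr c]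
    refine iSup_le fun e => le_iSup₂_of_le (e : ℂ) ?_ le_rfl
    intro he
    have : ((e + i : ℕ) : ℂ) = (d : ℂ) := by
      push_cast
      rw [he]
      ring
    have h2 : e + i = d := by exact_mod_cast this
    omega
  rw [htop, disjoint_top] at hind
  have hmem : (op (Vc c) 1 ^ i) v ∈ (op (Vc c) 0).eigenspace ((d : ℂ) - i) :=
    Module.End.mem_eigenspace_iff.mpr (uL_one_pow_weight hv i)
  rw [hind] at hmem
  simpa using hmem

end Grading

section Contragredient

open IsHighestWeightVector

namespace SmoothRep

variable {c : ℂ} {W : Type*} [AddCommGroup W] [Module ℂ W] (R : SmoothRep c W)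

/-- The restricted dual `⨁_η W_(η)^*` of a module `W = ⨁_η W_(η)`, where `W_(η)` is the
`L_0`-eigenspace of eigenvalue `η`: the linear functionals that vanish on `W_(η)` for all but
finitely many `η`. -/
def restrictedDual : Submodule ℂ (Module.Dual ℂ W) where
  carrier := {f | {η : ℂ | ∃ w ∈ (R.L 0).eigenspace η, f w ≠ 0}.Finite}
  add_mem' := fun {f g} hf hg => by
    refine (Set.Finite.union hf hg).subset ?_
    rintro η ⟨w, hw, h⟩
    by_cases h0 : f w = 0
    · refine Or.inr ⟨w, hw, fun h1 => h ?_⟩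
      rw [LinearMap.add_apply, h0, h1, add_zero]
    · exact Or.inl ⟨w, hw, h0⟩
  zero_mem' := by
    refine Set.finite_empty.subset ?_
    rintro η ⟨w, hw, h⟩
    exact h rfl
  smul_mem' := fun r f hf => by
    refine Set.Finite.subset hf ?_
    rintro η ⟨w, hw, h⟩
    refine ⟨w, hw, fun h0 => h ?_⟩
    rw [LinearMap.smul_apply, h0, smul_zero]

theorem comp_mode_mem {e : ℂ} {v : Vc c} (hv : uL 0 • v = e • v) (m : ℤ)
    {f : Module.Dual ℂ W} (hf : f ∈ R.restrictedDual) :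
    f ∘ₗ (R.Y v).1 m ∈ R.restrictedDual := by
  refine Set.Finite.subset
    (Set.Finite.preimage (f := fun η : ℂ => η + e - m - 1) (fun a _ b _ h => by simpa using h) hf)
    ?_
  rintro η ⟨w, hw, h⟩
  refine ⟨(R.Y v).1 m w, ?_, h⟩
  rw [Module.End.mem_eigenspace_iff] at hw ⊢
  exact R.mode_weight hv m hw

/-- The coefficient of `z^{-n-1}` in `Y_W(e^{z L_1} (-z^{-2})^{L_0} v, z^{-1})` for `v` of
weight `d`. As `L_1^i v = 0` for `i > d`, the exponential is the sum over `i ≤ d`; the term of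
index `i` is `(-1)^d z^{i-2d} / i! · Y_W(L_1^i v, z^{-1})`, where
`Y_W(u, z^{-1}) = ∑_m u_(m) z^{m+1}`. -/
def oppositeMode (d : ℕ) (n : ℤ) : Vc c →ₗ[ℂ] Module.End ℂ W :=
  (-1 : ℂ) ^ d • ∑ i ∈ Finset.range (d + 1), ((i.factorial : ℂ)⁻¹) •
    (LinearMap.proj (2 * (d : ℤ) - i - n - 2) ∘ₗ (fields W).subtype ∘ₗ R.Y ∘ₗ (op (Vc c) 1 ^ i))

theorem oppositeMode_apply (d : ℕ) (n : ℤ) (v : Vc c) : R.oppositeMode d n v =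
    (-1 : ℂ) ^ d • ∑ i ∈ Finset.range (d + 1), ((i.factorial : ℂ)⁻¹) •
      (R.Y ((op (Vc c) 1 ^ i) v)).1 (2 * (d : ℤ) - i - n - 2) := by
  simp [oppositeMode, LinearMap.sum_apply]

theorem comp_oppositeMode_mem {d : ℕ} {v : Vc c} (hv : v ∈ Vgr c d) (n : ℤ)
    {f : Module.Dual ℂ W} (hf : f ∈ R.restrictedDual) :
    f ∘ₗ R.oppositeMode d n v ∈ R.restrictedDual := by
  have : f ∘ₗ R.oppositeMode d n v = (-1 : ℂ) ^ d • ∑ i ∈ Finset.range (d + 1),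
      ((i.factorial : ℂ)⁻¹) •
        (f ∘ₗ (R.Y ((op (Vc c) 1 ^ i) v)).1 (2 * (d : ℤ) - i - n - 2)) := by
    rw [oppositeMode_apply]
    refine LinearMap.ext fun w => ?_
    simp [LinearMap.sum_apply]
  rw [this]
  exact Submodule.smul_mem _ _ (Submodule.sum_mem _ fun i _ => Submodule.smul_mem _ _
    (R.comp_mode_mem (uL_one_pow_weight hv i) _ hf))

/-- The vertex operator map of the contragredient module on vectors of weight `d`. -/
def contragredientHom (d : ℕ) : Vgr c d →ₗ[ℂ] (ℤ → Module.End ℂ R.restrictedDual) where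
  toFun v n :=
    { toFun := fun f => ⟨f.1 ∘ₗ R.oppositeMode d n v, R.comp_oppositeMode_mem v.2 n f.2⟩
      map_add' := fun f g => Subtype.ext (LinearMap.add_comp _ _ _)
      map_smul' := fun r f => Subtype.ext (LinearMap.smul_comp _ _ _) }
  map_add' u v := by
    refine funext fun n => LinearMap.ext fun f => Subtype.ext (LinearMap.ext fun w => ?_)
    change f.1 (R.oppositeMode d n ((u : Vc c) + v) w) = _
    rw [map_add, LinearMap.add_apply, map_add]
    rfl
  map_smul' r v := by
    refine funext fun n => LinearMap.ext fun f => Subtype.ext (LinearMap.ext fun w => ?_)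
    change f.1 (R.oppositeMode d n (r • (v : Vc c)) w) = _
    rw [map_smul, LinearMap.smul_apply, map_smul]
    rfl

/-- The vertex operator map `Y_{W'}` of the contragredient module `W'`, as the modes
`v ↦ (n ↦ v_(n))`, determined by
`⟨Y_{W'}(v, z) f, w⟩ = ⟨f, Y_W(e^{z L_1} (-z^{-2})^{L_0} v, z^{-1}) w⟩`. -/
def contragredientY : Vc c →ₗ[ℂ] (ℤ → Module.End ℂ R.restrictedDual) :=
  DirectSum.toModule ℂ ℕ _ R.contragredientHom ∘ₗ (gradingEquiv c).symm.toLinearMap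

theorem contragredientY_apply {d : ℕ} {v : Vc c} (hv : v ∈ Vgr c d) (n : ℤ)
    (f : R.restrictedDual) (w : W) :
    (R.contragredientY v n f).1 w = f.1 (R.oppositeMode d n v w) := by
  have : (gradingEquiv c).symm v = DirectSum.lof ℂ ℕ (fun d => Vgr c d) d ⟨v, hv⟩ := by
    rw [LinearEquiv.symm_apply_eq]
    exact (DirectSum.coeLinearMap_lof (Vgr c) d ⟨v, hv⟩).symm
  change (DirectSum.toModule ℂ ℕ _ R.contragredientHom ((gradingEquiv c).symm v) n f).1 w = _
  rw [this, DirectSum.toModule_lof]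
  rfl

end SmoothRep

end Contragredient

section Intertwining

variable {V Wmid Win Wout : Type*} [AddCommGroup V] [Module ℂ V]
  [AddCommGroup Wmid] [Module ℂ Wmid] [AddCommGroup Win] [Module ℂ Win]
  [AddCommGroup Wout] [Module ℂ Wout]

/-- The conditions on an intertwining operator `𝒴(·, x)` of type `(Wout over Wmid, Win)` for
modules with vertex operator maps `Ymid`, `Yin`, `Yout` (given by the modes `v_(n)`, the
coefficients of `ζ^{-n-1}`), where `ω` is the conformal vector, so that `L_{-1} = ω_(0)`.
The coefficient of `x^α`, `α ∈ ℂ`, in `𝒴(w, x)` is `𝒴 w α`.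

* `truncation`: for all `w`, `u` and `α`, the coefficients of `x^{α-n}` in `𝒴(w, x) u` vanish for
  `n` large; by this the products of series in the Jacobi identity are well defined.
* `jacobi`: the Jacobi identity
  `ξ⁻¹ δ((ζ-x)/ξ) Yout(v,ζ) 𝒴(w,x) - ξ⁻¹ δ((x-ζ)/(-ξ)) 𝒴(w,x) Yin(v,ζ)
    = x⁻¹ δ((ζ-ξ)/x) 𝒴(Ymid(v,ξ) w, x)`,
  stated as the equality of the coefficients of `ξ^{-m-1} ζ^{-k-1} x^α`. For the right-hand side,
  the coefficient of `x^{k-n} ζ^{-k-1} ξ^n` in `x⁻¹ δ((ζ-ξ)/x)` is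
  `(-1)^n (n-k-1 choose n) = (k choose n)`.
* `translation`: `𝒴(L_{-1} w, x) = d/dx 𝒴(w, x)`. -/
structure IsIntertwining (ω : V) (Ymid : V →ₗ[ℂ] fields Wmid) (Yin : V →ₗ[ℂ] fields Win)
    (Yout : V →ₗ[ℂ] (ℤ → Module.End ℂ Wout)) (I : Wmid →ₗ[ℂ] (ℂ → (Win →ₗ[ℂ] Wout))) :
    Prop where
  truncation : ∀ (w : Wmid) (u : Win) (α : ℂ), ∃ N : ℕ, ∀ n : ℕ, N ≤ n → I w (α - n) u = 0
  jacobi : ∀ (v : V) (w : Wmid) (u : Win) (m k : ℤ) (α : ℂ),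
    (∑ᶠ n : ℕ, ((-1 : ℂ) ^ n * (bin m n : ℂ)) • Yout v (m + k - n) (I w (α - n) u)) -
      (∑ᶠ n : ℕ, ((-1 : ℂ) ^ (m + n) * (bin m n : ℂ)) •
        I w (α - m + n) ((Yin v).1 (k + n) u)) =
      ∑ᶠ n : ℕ, (bin k n : ℂ) • I ((Ymid v).1 (m + n) w) (α - k + n) u
  translation : ∀ (w : Wmid) (α : ℂ), I ((Ymid ω).1 0 w) α = (α + 1) • I w (α + 1)

end Intertwining

section Spaces

variable {V Wmid Win Wout : Type*} [AddCommGroup V] [Module ℂ V]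
  [AddCommGroup Wmid] [Module ℂ Wmid] [AddCommGroup Win] [Module ℂ Win]
  [AddCommGroup Wout] [Module ℂ Wout]

theorem finsum_combine {W : Type*} [AddCommGroup W] [Module ℂ W] {f g : ℕ → W}
    (hf : ∃ N : ℕ, ∀ n, N ≤ n → f n = 0) (hg : ∃ N : ℕ, ∀ n, N ≤ n → g n = 0) (r : ℂ) :
    ∑ᶠ n, (r • f n + g n) = r • (∑ᶠ n, f n) + ∑ᶠ n, g n := by
  obtain ⟨N, hN⟩ := hf
  obtain ⟨K, hK⟩ := hg
  rw [finsum_eq_range (N := N + K) (fun i hi => hN i (by omega)),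
    finsum_eq_range (N := N + K) (fun i hi => hK i (by omega)),
    finsum_eq_range (N := N + K) (fun i hi => by
      rw [hN i (by omega), hK i (by omega), smul_zero, add_zero]),
    Finset.sum_add_distrib, Finset.smul_sum]

namespace IsIntertwining

variable {ω : V} {Ymid : V →ₗ[ℂ] fields Wmid} {Yin : V →ₗ[ℂ] fields Win}
  {Yout : V →ₗ[ℂ] (ℤ → Module.End ℂ Wout)} {I J : Wmid →ₗ[ℂ] (ℂ → (Win →ₗ[ℂ] Wout))}

theorem zero : IsIntertwining ω Ymid Yin Yout 0 where
  truncation _ _ _ := ⟨0, fun _ _ => rfl⟩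
  jacobi _ _ _ _ _ _ := by simp
  translation _ _ := by simp

theorem smul_add_mem (hI : IsIntertwining ω Ymid Yin Yout I)
    (hJ : IsIntertwining ω Ymid Yin Yout J) (r : ℂ) :
    IsIntertwining ω Ymid Yin Yout (r • I + J) where
  truncation w u α := by
    obtain ⟨N, hN⟩ := hI.truncation w u α
    obtain ⟨K, hK⟩ := hJ.truncation w u α
    refine ⟨N + K, fun n hn => ?_⟩
    simp [hN n (by omega), hK n (by omega)]
  jacobi v w u m k α := by
    have t1 : ∀ {I : Wmid →ₗ[ℂ] (ℂ → (Win →ₗ[ℂ] Wout))}, IsIntertwining ω Ymid Yin Yout I →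
        ∃ N : ℕ, ∀ n : ℕ, N ≤ n →
          ((-1 : ℂ) ^ n * (bin m n : ℂ)) • Yout v (m + k - n) (I w (α - n) u) = 0 := by
      intro I hI
      obtain ⟨N, hN⟩ := hI.truncation w u α
      exact ⟨N, fun n hn => by rw [hN n hn, map_zero, smul_zero]⟩
    have t2 : ∀ I : Wmid →ₗ[ℂ] (ℂ → (Win →ₗ[ℂ] Wout)),
        ∃ N : ℕ, ∀ n : ℕ, N ≤ n →
          ((-1 : ℂ) ^ (m + n) * (bin m n : ℂ)) •
            I w (α - m + n) ((Yin v).1 (k + n) u) = 0 := by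
      intro I
      obtain ⟨N, hN⟩ := (Yin v).2 u
      exact ⟨N + k.natAbs, fun n hn => by rw [hN (k + n) (by omega), map_zero, smul_zero]⟩
    have t3 : ∀ I : Wmid →ₗ[ℂ] (ℂ → (Win →ₗ[ℂ] Wout)),
        ∃ N : ℕ, ∀ n : ℕ, N ≤ n →
          (bin k n : ℂ) • I ((Ymid v).1 (m + n) w) (α - k + n) u = 0 := by
      intro I
      obtain ⟨N, hN⟩ := (Ymid v).2 w
      exact ⟨N + m.natAbs, fun n hn => by
        rw [hN (m + n) (by omega), map_zero, Pi.zero_apply, LinearMap.zero_apply, smul_zero]⟩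
    have e1 := finsum_combine (t1 hI) (t1 hJ) r
    have e2 := finsum_combine (t2 I) (t2 J) r
    have e3 := finsum_combine (t3 I) (t3 J) r
    have hIj := hI.jacobi v w u m k α
    have hJj := hJ.jacobi v w u m k α
    simp only [LinearMap.add_apply, LinearMap.smul_apply, Pi.add_apply, Pi.smul_apply, map_add,
      map_smul, smul_add]
    simp only [smul_comm _ r]
    rw [e1, e2, e3, ← hIj, ← hJj, smul_sub]
    abel
  translation w α := by
    simp only [LinearMap.add_apply, LinearMap.smul_apply, Pi.add_apply, Pi.smul_apply, smul_add,
      hI.translation, hJ.translation, smul_comm r]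

end IsIntertwining

/-- The vector space of intertwining operators of type `(Wout over Wmid, Win)`. -/
def intertwiningOperators (ω : V) (Ymid : V →ₗ[ℂ] fields Wmid) (Yin : V →ₗ[ℂ] fields Win)
    (Yout : V →ₗ[ℂ] (ℤ → Module.End ℂ Wout)) :
    Submodule ℂ (Wmid →ₗ[ℂ] (ℂ → (Win →ₗ[ℂ] Wout))) where
  carrier := {I | IsIntertwining ω Ymid Yin Yout I}
  add_mem' := fun {I J} hI hJ => by
    have := IsIntertwining.smul_add_mem hI hJ 1
    rwa [one_smul] at this
  zero_mem' := IsIntertwining.zero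
  smul_mem' := fun r I hI => by
    have := IsIntertwining.smul_add_mem hI IsIntertwining.zero r
    rwa [add_zero] at this

/-- The Verma module as a smooth representation; `(vermaRep c h).Y` is the vertex operator map
of the Verma module as a `V_c`-module. -/
def vermaRep (c h : ℂ) : SmoothRep c (Verma c h) := (Verma.isHighestWeightVector c h).rep

end Spaces
end
end VirVOA

namespace VirVOA

noncomputable section

attribute [local instance] LieRing.ofAssociativeRing

section Induced

/-- A linear subspace of an enveloping algebra that contains `1` and is stable under left
multiplication by the Lie algebra is everything. -/
theorem universalEnveloping_induction {N : Type*} [LieRing N] [LieAlgebra ℂ N]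
    (S : Submodule ℂ (UniversalEnvelopingAlgebra ℂ N)) (h1 : 1 ∈ S)
    (hι : ∀ x : N, ∀ y ∈ S, UniversalEnvelopingAlgebra.ι ℂ x * y ∈ S)
    (u : UniversalEnvelopingAlgebra ℂ N) : u ∈ S := by
  let A : Subalgebra ℂ (UniversalEnvelopingAlgebra ℂ N) :=
    { carrier := {u | ∀ x ∈ S, u * x ∈ S}
      mul_mem' := fun {a b} ha hb x hx => by
        rw [mul_assoc]
        exact ha _ (hb _ hx)
      add_mem' := fun {a b} ha hb x hx => by
        rw [add_mul]
        exact S.add_mem (ha _ hx) (hb _ hx)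
      algebraMap_mem' := fun r x hx => by
        rw [← Algebra.smul_def]
        exact S.smul_mem r hx }
  let φ : N →ₗ⁅ℂ⁆ A :=
    { toFun := fun y => ⟨UniversalEnvelopingAlgebra.ι ℂ y, hι y⟩
      map_add' := fun a b => Subtype.ext (map_add _ a b)
      map_smul' := fun r a => Subtype.ext (map_smul _ r a)
      map_lie' := fun {a b} => Subtype.ext ((UniversalEnvelopingAlgebra.ι ℂ).map_lie a b) }
  have hid : A.val.comp (UniversalEnvelopingAlgebra.lift ℂ φ) = AlgHom.id ℂ _ := by
    refine UniversalEnvelopingAlgebra.hom_ext ℂ (LieHom.ext fun y => ?_)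
    change A.val (UniversalEnvelopingAlgebra.lift ℂ φ (UniversalEnvelopingAlgebra.ι ℂ y)) = _
    rw [UniversalEnvelopingAlgebra.lift_ι_apply]
    rfl
  have := (UniversalEnvelopingAlgebra.lift ℂ φ u).2 1 h1
  have h2 : ((UniversalEnvelopingAlgebra.lift ℂ φ u : A) : UniversalEnvelopingAlgebra ℂ N) = u :=
    congrArg (fun g : UniversalEnvelopingAlgebra ℂ N →ₐ[ℂ] _ => g u) hid
  rwa [h2, mul_one] at this

variable {g : Type*} [LieRing g] [LieAlgebra ℂ g] (n : LieSubalgebra ℂ g)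

/-- The enveloping algebra of a Lie subalgebra. -/
abbrev Env : Type _ := UniversalEnvelopingAlgebra ℂ n

/-- The action of a Lie subalgebra `n` of `g` on the linear maps from `g` to `U(n)`. -/
def coadj : n →ₗ⁅ℂ⁆ Module.End ℂ (g →ₗ[ℂ] Env n) where
  toFun x :=
    { toFun := fun θ => LinearMap.mulLeft ℂ (UniversalEnvelopingAlgebra.ι ℂ x) ∘ₗ θ -
        θ ∘ₗ (LieAlgebra.ad ℂ g (x : g) : g →ₗ[ℂ] g)
      map_add' := fun a b => by
        ext z
        simp [mul_add]
        abel
      map_smul' := fun r a => by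
        ext z
        simp [smul_sub] }
  map_add' x y := by
    ext θ z
    simp [add_mul]
    abel
  map_smul' r x := by
    ext θ z
    simp [smul_sub]
  map_lie' {x y} := by
    ext θ z
    simp [LieRing.of_associative_ring_bracket, mul_sub, sub_mul, mul_assoc]
    abel

variable (π : g →ₗ[ℂ] n) (χ : g →ₗ[ℂ] ℂ)

/-- The value at `1` of the action of `g` on the induced module. -/
def inducedOne : g →ₗ[ℂ] Env n :=
  (UniversalEnvelopingAlgebra.ι ℂ : n →ₗ⁅ℂ⁆ Env n).toLinearMap ∘ₗ π +
    LinearMap.toSpanSingleton ℂ (Env n) 1 ∘ₗ χ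

/-- The operators by which a Lie algebra `g` acts on the module induced from a character `χ` of
a subalgebra that is complementary to `n`. The complementary subalgebra is the kernel of the
projection `π` onto `n`. The induced module is identified with `U(n)`. -/
def inducedOp (z : g) : Module.End ℂ (Env n) :=
  LinearMap.applyₗ z ∘ₗ LinearMap.applyₗ (inducedOne n π χ) ∘ₗ
    (UniversalEnvelopingAlgebra.lift ℂ (coadj n)).toLinearMap

theorem inducedOp_one (z : g) :
    inducedOp n π χ z 1 = UniversalEnvelopingAlgebra.ι ℂ (π z) + χ z • (1 : Env n) := by
  change (UniversalEnvelopingAlgebra.lift ℂ (coadj n) 1) (inducedOne n π χ) z = _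
  rw [map_one]
  rfl

theorem inducedOp_ι_mul (z : g) (x : n) (y : Env n) :
    inducedOp n π χ z (UniversalEnvelopingAlgebra.ι ℂ x * y) =
      UniversalEnvelopingAlgebra.ι ℂ x * inducedOp n π χ z y - inducedOp n π χ ⁅(x : g), z⁆ y := by
  change (UniversalEnvelopingAlgebra.lift ℂ (coadj n) _) (inducedOne n π χ) z = _
  rw [map_mul, UniversalEnvelopingAlgebra.lift_ι_apply]
  rfl

theorem inducedOp_add (z z' : g) (y : Env n) :
    inducedOp n π χ (z + z') y = inducedOp n π χ z y + inducedOp n π χ z' y :=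
  map_add ((UniversalEnvelopingAlgebra.lift ℂ (coadj n) y) (inducedOne n π χ)) z z'

theorem inducedOp_smul (r : ℂ) (z : g) (y : Env n) :
    inducedOp n π χ (r • z) y = r • inducedOp n π χ z y :=
  map_smul ((UniversalEnvelopingAlgebra.lift ℂ (coadj n) y) (inducedOne n π χ)) r z

variable {n π χ}

theorem inducedOp_coe (hπ : ∀ x : n, π x = x) (hχ : ∀ x : n, χ x = 0) (x : n) (y : Env n) :
    inducedOp n π χ x y = UniversalEnvelopingAlgebra.ι ℂ x * y := by
  let S : Submodule ℂ (Env n) :=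
    { carrier := {y | ∀ x : n, inducedOp n π χ x y = UniversalEnvelopingAlgebra.ι ℂ x * y}
      add_mem' := fun {a b} ha hb x => by rw [map_add, ha, hb, mul_add]
      zero_mem' := fun x => by rw [map_zero, mul_zero]
      smul_mem' := fun r a ha x => by rw [map_smul, ha, mul_smul_comm] }
  refine universalEnveloping_induction S (fun x => ?_) (fun x y hy z => ?_) y x
  · rw [inducedOp_one, hπ, hχ, zero_smul, add_zero, mul_one]
  · have h := hy ⁅x, z⁆
    rw [LieSubalgebra.coe_bracket] at h
    rw [inducedOp_ι_mul, hy z, h, LieHom.map_lie, LieRing.of_associative_ring_bracket, sub_mul,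
      mul_assoc, mul_assoc, sub_sub_cancel]

theorem inducedOp_lie (hπ : ∀ x : n, π x = x) (hχ : ∀ x : n, χ x = 0)
    (hb : ∀ x y : g, π x = 0 → π y = 0 → π ⁅x, y⁆ = 0 ∧ χ ⁅x, y⁆ = 0) (z w : g) (y : Env n) :
    inducedOp n π χ ⁅z, w⁆ y =
      inducedOp n π χ z (inducedOp n π χ w y) - inducedOp n π χ w (inducedOp n π χ z y) := by
  have hcoe := inducedOp_coe hπ hχ
  have hneg : ∀ (z : g) (y : Env n), inducedOp n π χ (-z) y = -inducedOp n π χ z y := fun z y => by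
    rw [← neg_one_smul ℂ, inducedOp_smul, neg_one_smul]
  have hn : ∀ (x : n) (w : g) (y : Env n), inducedOp n π χ ⁅(x : g), w⁆ y =
      inducedOp n π χ x (inducedOp n π χ w y) - inducedOp n π χ w (inducedOp n π χ x y) := by
    intro x w y
    rw [hcoe, hcoe, inducedOp_ι_mul, sub_sub_cancel]
  let S : Submodule ℂ (Env n) :=
    { carrier := {y | ∀ z w : g, inducedOp n π χ ⁅z, w⁆ y =
        inducedOp n π χ z (inducedOp n π χ w y) - inducedOp n π χ w (inducedOp n π χ z y)}
      add_mem' := fun {a b} ha hb z w => by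
        simp only [map_add, ha z w, hb z w]
        abel
      zero_mem' := fun z w => by simp only [map_zero, sub_zero]
      smul_mem' := fun r a ha z w => by simp only [map_smul, ha z w, smul_sub] }
  refine universalEnveloping_induction S (fun z w => ?_) (fun x y hy z w => ?_) y z w
  · have key : ∀ a b : g, π a = 0 → π b = 0 → inducedOp n π χ ⁅a, b⁆ 1 =
        inducedOp n π χ a (inducedOp n π χ b 1) - inducedOp n π χ b (inducedOp n π χ a 1) := by
      intro a b ha hb'
      rw [inducedOp_one, inducedOp_one n π χ b, inducedOp_one n π χ a, (hb a b ha hb').1,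
        (hb a b ha hb').2, ha, hb']
      simp only [map_zero, zero_add, map_smul, inducedOp_one, ha, hb', zero_smul, smul_smul]
      rw [mul_comm, sub_self]
    have hz : z = (π z : g) + (z - π z) := by abel
    have hw : w = (π w : g) + (w - π w) := by abel
    have hz0 : π (z - π z) = 0 := by rw [map_sub, hπ, sub_self]
    have hw0 : π (w - π w) = 0 := by rw [map_sub, hπ, sub_self]
    have k1 := key _ _ hz0 hw0
    have k2 := hn (π z) (w - π w) 1
    have k3 := hn (π w) (z - π z) 1
    have k4 := hn (π z) (π w) 1
    have hexp : ⁅z, w⁆ = ⁅(π z : g), (π w : g)⁆ + ⁅(π z : g), w - π w⁆ +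
        (-⁅(π w : g), z - π z⁆) + ⁅z - π z, w - π w⁆ := by
      rw [lie_skew]
      nth_rewrite 1 [hz, hw]
      simp only [add_lie, lie_add]
      abel
    have ez : ∀ y, inducedOp n π χ z y = inducedOp n π χ (π z) y + inducedOp n π χ (z - π z) y :=
      fun y => by rw [← inducedOp_add, ← hz]
    have ew : ∀ y, inducedOp n π χ w y = inducedOp n π χ (π w) y + inducedOp n π χ (w - π w) y :=
      fun y => by rw [← inducedOp_add, ← hw]
    rw [hexp, inducedOp_add, inducedOp_add, inducedOp_add, hneg, k1, k2, k3, k4]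
    simp only [ez, ew, map_add]
    abel
  · rw [inducedOp_ι_mul, leibniz_lie, inducedOp_add, hy, inducedOp_ι_mul, inducedOp_ι_mul, map_sub,
      map_sub, inducedOp_ι_mul, inducedOp_ι_mul, hy ⁅(x : g), z⁆ w, hy z ⁅(x : g), w⁆, mul_sub]
    abel

end Induced


section GelfandFuchs

variable {A : Type*} [CommRing A] [Algebra ℂ A] (D : Derivation ℂ A A) (res : A →ₗ[ℂ] ℂ)

/-- The central extension by the Gelfand-Fuchs cocycle of the Lie algebra of vector fields `f D`,
`f ∈ A`, for a commutative algebra `A` with a derivation `D` and a residue functional `res` that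
vanishes on derivatives. -/
def GelfandFuchs (_ : ∀ f, res (D f) = 0) : Type _ := A × ℂ

variable {D res} (h : ∀ f, res (D f) = 0)

namespace GelfandFuchs

instance : AddCommGroup (GelfandFuchs D res h) := inferInstanceAs (AddCommGroup (A × ℂ))
instance : Module ℂ (GelfandFuchs D res h) := inferInstanceAs (Module ℂ (A × ℂ))

/-- The element of the central extension with components `f` and `a`. -/
def mk (f : A) (a : ℂ) : GelfandFuchs D res h := (f, a)

theorem mk_fst (f : A) (a : ℂ) : (mk h f a).1 = f := rfl

theorem mk_snd (f : A) (a : ℂ) : (mk h f a).2 = a := rfl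

instance : Bracket (GelfandFuchs D res h) (GelfandFuchs D res h) :=
  ⟨fun x y => (x.1 * D y.1 - D x.1 * y.1, res (D (D (D x.1)) * y.1) / 12)⟩

theorem lie_fst (x y : GelfandFuchs D res h) : ⁅x, y⁆.1 = x.1 * D y.1 - D x.1 * y.1 := rfl

theorem lie_snd (x y : GelfandFuchs D res h) : ⁅x, y⁆.2 = res (D (D (D x.1)) * y.1) / 12 := rfl

theorem add_fst (x y : GelfandFuchs D res h) : (x + y).1 = x.1 + y.1 := rfl

theorem add_snd (x y : GelfandFuchs D res h) : (x + y).2 = x.2 + y.2 := rfl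

instance : LieRing (GelfandFuchs D res h) where
  add_lie x y z := by
    refine Prod.ext ?_ ?_
    · simp only [lie_fst, add_fst, map_add]
      ring
    · simp only [lie_snd, add_fst, add_snd, map_add, add_mul]
      ring
  lie_add x y z := by
    refine Prod.ext ?_ ?_
    · simp only [lie_fst, add_fst, map_add]
      ring
    · simp only [lie_snd, add_fst, add_snd, map_add, mul_add]
      ring
  lie_self x := by
    refine Prod.ext ?_ ?_
    · rw [lie_fst, mul_comm, sub_self]
      rfl
    · rw [lie_snd]
      have h1 : (2 : ℂ) * res (D (D (D x.1)) * x.1) = 0 := by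
        have h2 := h ((2 : ℂ) • (D (D x.1) * x.1) - D x.1 * D x.1)
        have h3 : D ((2 : ℂ) • (D (D x.1) * x.1) - D x.1 * D x.1) =
            (2 : ℂ) • (D (D (D x.1)) * x.1) := by
          rw [two_smul, two_smul]
          simp only [map_sub, map_add, Derivation.leibniz, smul_eq_mul]
          ring
        rwa [h3, map_smul, smul_eq_mul] at h2
      have h4 : res (D (D (D x.1)) * x.1) = 0 := by simpa using h1
      rw [h4, zero_div]
      rfl
  leibniz_lie x y z := by
    refine Prod.ext ?_ ?_
    · simp only [lie_fst, add_fst, map_sub, Derivation.leibniz, smul_eq_mul]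
      ring
    · simp only [lie_snd, lie_fst, add_snd]
      have h1 := h (D (D (D x.1)) * y.1 * z.1 - x.1 * D (D (D y.1)) * z.1)
      rw [← add_div, ← map_add]
      congr 1
      rw [← sub_eq_zero, ← map_sub, ← h1]
      congr 1
      simp only [map_sub, map_add, Derivation.leibniz, smul_eq_mul]
      ring

instance : LieAlgebra ℂ (GelfandFuchs D res h) where
  lie_smul r x y := by
    refine Prod.ext ?_ ?_
    · change x.1 * D (r • y.1) - D x.1 * (r • y.1) = r • (x.1 * D y.1 - D x.1 * y.1)
      rw [Derivation.map_smul, mul_smul_comm, mul_smul_comm, smul_sub]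
    · change res (D (D (D x.1)) * (r • y.1)) / 12 = r * (res (D (D (D x.1)) * y.1) / 12)
      rw [mul_smul_comm, map_smul, smul_eq_mul, mul_div_assoc]

end GelfandFuchs

end GelfandFuchs

section Laurent

/-- Laurent series over `ℂ`. -/
abbrev Lau : Type := LaurentSeries ℂ

instance lauAlgebra : Algebra ℂ Lau where
  algebraMap := HahnSeries.C
  smul_def' r x := by
    ext
    simp
  commutes' r x := mul_comm _ _

instance lauScalarTower : IsScalarTower ℂ Lau Lau :=
  ⟨fun r f g => by
    rw [smul_eq_mul, smul_eq_mul, ← HahnSeries.C_mul_eq_smul, ← HahnSeries.C_mul_eq_smul,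
      mul_assoc]⟩

instance lauSMulComm : SMulCommClass ℂ Lau Lau :=
  ⟨fun r f g => by
    rw [smul_eq_mul, smul_eq_mul, ← HahnSeries.C_mul_eq_smul, ← HahnSeries.C_mul_eq_smul,
      mul_left_comm]⟩

theorem lau_exists_bound (f : Lau) : ∃ N : ℤ, ∀ n, n < N → f.coeff n = 0 :=
  ⟨f.order, fun _ hn => HahnSeries.coeff_eq_zero_of_lt_order hn⟩

/-- The derivative of a Laurent series. -/
def lauDerFun (f : Lau) : Lau :=
  HahnSeries.ofSuppBddBelow (fun n => ((n : ℂ) + 1) * f.coeff (n + 1)) (by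
    refine ⟨f.order - 1, fun x h => ?_⟩
    contrapose! h
    rw [Function.notMem_support, HahnSeries.coeff_eq_zero_of_lt_order (by omega), mul_zero])

theorem lauDerFun_coeff (f : Lau) (n : ℤ) :
    (lauDerFun f).coeff n = ((n : ℂ) + 1) * f.coeff (n + 1) := rfl

/-- The derivative `x d/dx` of a Laurent series. -/
def lauEuler (f : Lau) : Lau :=
  HahnSeries.ofSuppBddBelow (fun n => (n : ℂ) * f.coeff n) (by
    refine ⟨f.order, fun x h => ?_⟩
    contrapose! h
    rw [Function.notMem_support, HahnSeries.coeff_eq_zero_of_lt_order h, mul_zero])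

theorem lauEuler_coeff (f : Lau) (n : ℤ) : (lauEuler f).coeff n = (n : ℂ) * f.coeff n := rfl

theorem lauEuler_support (f : Lau) : (lauEuler f).support ⊆ f.support := by
  intro n hn
  rw [HahnSeries.mem_support, lauEuler_coeff] at hn
  exact right_ne_zero_of_mul hn

theorem lauEuler_mul (f g : Lau) : lauEuler (f * g) = f * lauEuler g + g * lauEuler f := by
  ext n
  rw [mul_comm g, HahnSeries.coeff_add,
    HahnSeries.coeff_mul_right' g.isPWO_support (lauEuler_support g),
    HahnSeries.coeff_mul_left' f.isPWO_support (lauEuler_support f), ← Finset.sum_add_distrib,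
    lauEuler_coeff, HahnSeries.coeff_mul, Finset.mul_sum]
  refine Finset.sum_congr rfl fun p hp => ?_
  have : p.1 + p.2 = n := (Finset.mem_antidiagonal.mp hp).2.2
  rw [lauEuler_coeff, lauEuler_coeff, ← this]
  push_cast
  ring

theorem lauDerFun_eq (f : Lau) : lauDerFun f = lauEuler f * HahnSeries.single (-1) 1 := by
  ext n
  rw [HahnSeries.coeff_mul_single, lauDerFun_coeff, lauEuler_coeff, sub_neg_eq_add]
  push_cast
  ring

/-- The derivation `d/dx` of Laurent series. -/
def lauDer : Derivation ℂ Lau Lau where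
  toFun := lauDerFun
  map_add' f g := by
    ext n
    simp only [lauDerFun_coeff, HahnSeries.coeff_add]
    ring
  map_smul' r f := by
    ext n
    simp only [lauDerFun_coeff, HahnSeries.coeff_smul, RingHom.id_apply, smul_eq_mul]
    ring
  map_one_eq_zero' := by
    change lauDerFun 1 = 0
    ext n
    rw [lauDerFun_coeff, HahnSeries.coeff_one, HahnSeries.coeff_zero]
    split_ifs with h
    · obtain rfl : n = -1 := by omega
      simp
    · simp
  leibniz' f g := by
    change lauDerFun (f * g) = f • lauDerFun g + g • lauDerFun f
    rw [lauDerFun_eq, lauDerFun_eq, lauDerFun_eq, lauEuler_mul, smul_eq_mul, smul_eq_mul]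
    ring

theorem lauDer_coeff (f : Lau) (n : ℤ) :
    (lauDer f).coeff n = ((n : ℂ) + 1) * f.coeff (n + 1) := rfl

end Laurent


section LaurentProducts

/-- The coefficients of `f` of index less than `a` vanish. -/
def OrdGE (f : Lau) (a : ℤ) : Prop := ∀ n, n < a → f.coeff n = 0

theorem OrdGE.mono {f : Lau} {a b : ℤ} (hf : OrdGE f a) (h : b ≤ a) : OrdGE f b :=
  fun n hn => hf n (by omega)

theorem OrdGE.mul {f g : Lau} {a b : ℤ} (hf : OrdGE f a) (hg : OrdGE g b) :
    OrdGE (f * g) (a + b) := by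
  intro n hn
  rw [HahnSeries.coeff_mul]
  refine Finset.sum_eq_zero fun p hp => ?_
  have hs : p.1 + p.2 = n := (Finset.mem_antidiagonal.mp hp).2.2
  by_cases h1 : p.1 < a
  · rw [hf _ h1, zero_mul]
  · rw [hg _ (by omega), mul_zero]

theorem OrdGE.add {f g : Lau} {a : ℤ} (hf : OrdGE f a) (hg : OrdGE g a) : OrdGE (f + g) a :=
  fun n hn => by rw [HahnSeries.coeff_add, hf n hn, hg n hn, add_zero]

theorem OrdGE.sub {f g : Lau} {a : ℤ} (hf : OrdGE f a) (hg : OrdGE g a) : OrdGE (f - g) a :=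
  fun n hn => by rw [HahnSeries.coeff_sub, hf n hn, hg n hn, sub_zero]

theorem OrdGE.smul {f : Lau} {a : ℤ} (r : ℂ) (hf : OrdGE f a) : OrdGE (r • f) a :=
  fun n hn => by rw [HahnSeries.coeff_smul, hf n hn, smul_zero]

theorem OrdGE.zero (a : ℤ) : OrdGE 0 a := fun _ _ => rfl

theorem OrdGE.coeff_mul_add {f g : Lau} {a b : ℤ} (hf : OrdGE f a) (hg : OrdGE g b) :
    (f * g).coeff (a + b) = f.coeff a * g.coeff b := by
  rw [HahnSeries.coeff_mul]
  by_cases h : f.coeff a * g.coeff b = 0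
  · rw [h]
    refine Finset.sum_eq_zero fun p hp => ?_
    have hs : p.1 + p.2 = a + b := (Finset.mem_antidiagonal.mp hp).2.2
    rcases lt_trichotomy p.1 a with h1 | h1 | h1
    · rw [hf _ h1, zero_mul]
    · rw [h1, show p.2 = b by omega, h]
    · rw [hg p.2 (by omega), mul_zero]
  · rw [Finset.sum_eq_single (a, b)]
    · intro p hp hne
      have hs : p.1 + p.2 = a + b := (Finset.mem_antidiagonal.mp hp).2.2
      rcases lt_trichotomy p.1 a with h1 | h1 | h1
      · rw [hf _ h1, zero_mul]
      · exact absurd (Prod.ext h1 (by dsimp; omega)) hne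
      · rw [hg p.2 (by omega), mul_zero]
    · intro hn
      refine absurd (Finset.mem_antidiagonal.mpr ⟨?_, ?_, rfl⟩) hn
      · exact left_ne_zero_of_mul h
      · exact right_ne_zero_of_mul h

/-- The product of a Laurent series without polar part with a Laurent series. -/
theorem coeff_mul_eq_finsum {f : Lau} (hf : OrdGE f 0) (g : Lau) (N : ℤ) :
    (f * g).coeff N = ∑ᶠ i : ℕ, f.coeff i * g.coeff (N - i) := by
  obtain ⟨B, hB⟩ := lau_exists_bound g
  rw [finsum_eq_range (N := (N - B + 1).toNat) (fun i hi => by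
    rw [hB _ (by omega), mul_zero]), HahnSeries.coeff_mul]
  refine Finset.sum_bij_ne_zero (fun p _ _ => p.1.toNat) ?_ ?_ ?_ ?_
  · intro p hp hne
    have hs : p.1 + p.2 = N := (Finset.mem_antidiagonal.mp hp).2.2
    have h1 : ¬ p.1 < 0 := fun h => hne (by rw [hf _ h, zero_mul])
    have h2 : ¬ p.2 < B := fun h => hne (by rw [hB _ h, mul_zero])
    rw [Finset.mem_range]
    omega
  · intro p hp hne q hq hne' h
    have hs : p.1 + p.2 = N := (Finset.mem_antidiagonal.mp hp).2.2
    have hs' : q.1 + q.2 = N := (Finset.mem_antidiagonal.mp hq).2.2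
    have h1 : ¬ p.1 < 0 := fun h => hne (by rw [hf _ h, zero_mul])
    have h1' : ¬ q.1 < 0 := fun h => hne' (by rw [hf _ h, zero_mul])
    exact Prod.ext (by omega) (by omega)
  · intro i hi hne
    refine ⟨(i, N - i), Finset.mem_antidiagonal.mpr
      ⟨left_ne_zero_of_mul hne, right_ne_zero_of_mul hne, by dsimp; omega⟩, hne, rfl⟩
  · intro p hp hne
    have hs : p.1 + p.2 = N := (Finset.mem_antidiagonal.mp hp).2.2
    have h1 : ¬ p.1 < 0 := fun h => hne (by rw [hf _ h, zero_mul])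
    rw [show ((p.1.toNat : ℕ) : ℤ) = p.1 by omega, show N - p.1 = p.2 by omega]

theorem lauDer_ordGE {f : Lau} {a : ℤ} (hf : OrdGE f a) : OrdGE (lauDer f) (a - 1) :=
  fun n hn => by rw [lauDer_coeff, hf _ (by omega), mul_zero]

theorem lauDer_ordGE_zero {f : Lau} (hf : OrdGE f 0) : OrdGE (lauDer f) 0 := by
  intro n hn
  rw [lauDer_coeff]
  by_cases h : n = -1
  · subst h
    simp
  · rw [hf _ (by omega), mul_zero]

end LaurentProducts

section Binomial

/-- The monomial `x^n`. -/
def lauX (n : ℤ) : Lau := HahnSeries.single n 1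

theorem lauX_coeff (n k : ℤ) : (lauX n).coeff k = if k = n then 1 else 0 := by
  rw [lauX, HahnSeries.coeff_single]
  congr

theorem lauX_mul (m n : ℤ) : lauX m * lauX n = lauX (m + n) := by
  rw [lauX, lauX, lauX, HahnSeries.single_mul_single, mul_one]

theorem lauX_mul_coeff (m : ℤ) (f : Lau) (n : ℤ) : (lauX m * f).coeff n = f.coeff (n - m) := by
  rw [mul_comm, lauX, HahnSeries.coeff_mul_single, mul_one]

theorem lauX_ordGE (n : ℤ) : OrdGE (lauX n) n := fun k hk => by
  rw [lauX_coeff, if_neg (by omega)]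

/-- The series `(1 + s x)^m`, for an integer `m`. -/
def lauBin (s : ℂ) (m : ℤ) : Lau :=
  HahnSeries.ofPowerSeries ℤ ℂ (PowerSeries.rescale s (PowerSeries.binomialSeries ℂ m))

theorem lauBin_add (s : ℂ) (m n : ℤ) : lauBin s (m + n) = lauBin s m * lauBin s n := by
  rw [lauBin, PowerSeries.binomialSeries_add, map_mul, map_mul]
  rfl

theorem lauBin_zero (s : ℂ) : lauBin s 0 = 1 := by
  rw [lauBin, PowerSeries.binomialSeries_zero, map_one, map_one]

theorem lauBin_one (s : ℂ) : lauBin s 1 = 1 + s • lauX 1 := by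
  have h := PowerSeries.binomialSeries_nat (R := ℤ) (A := ℂ) 1
  rw [Nat.cast_one, pow_one] at h
  rw [lauBin, h, map_add, map_one, map_add, map_one, PowerSeries.rescale_X, map_mul,
    HahnSeries.ofPowerSeries_C, HahnSeries.ofPowerSeries_X, lauX, HahnSeries.C_mul_eq_smul]

theorem lauBin_coeff (s : ℂ) (m : ℤ) (i : ℕ) : (lauBin s m).coeff i = s ^ i * (bin m i : ℂ) := by
  rw [lauBin, HahnSeries.ofPowerSeries_apply_coeff, PowerSeries.coeff_rescale,
    PowerSeries.binomialSeries_coeff]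
  simp

theorem lauBin_ordGE (s : ℂ) (m : ℤ) : OrdGE (lauBin s m) 0 := by
  intro n hn
  exact (PowerSeries.coeff_coe _ n).trans (if_pos hn)

theorem lauBin_coeff_zero (s : ℂ) (m : ℤ) : (lauBin s m).coeff 0 = 1 := by
  have := lauBin_coeff s m 0
  simpa using this

end Binomial


section Tri

/-- Triples of Laurent series, thought of as expansions at the points `0`, `1` and `∞` of the
projective line, in the coordinates `ζ`, `ζ - 1` and `ζ⁻¹`. -/
abbrev Tri : Type := Lau × Lau × Lau

instance triScalarTower : IsScalarTower ℂ Tri Tri :=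
  ⟨fun r f g => Prod.ext (smul_assoc r f.1 g.1)
    (Prod.ext (smul_assoc r f.2.1 g.2.1) (smul_assoc r f.2.2 g.2.2))⟩

instance triSMulComm : SMulCommClass ℂ Tri Tri :=
  ⟨fun r f g => Prod.ext (smul_comm r f.1 g.1)
    (Prod.ext (smul_comm r f.2.1 g.2.1) (smul_comm r f.2.2 g.2.2))⟩

/-- The derivation `d/dζ`. -/
def triDer : Derivation ℂ Tri Tri :=
  Derivation.mk' (LinearMap.prodMap (lauDer : Lau →ₗ[ℂ] Lau)
      (LinearMap.prodMap (lauDer : Lau →ₗ[ℂ] Lau)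
        (-(LinearMap.mulLeft ℂ (lauX 2) ∘ₗ (lauDer : Lau →ₗ[ℂ] Lau))))) fun f g => by
    refine Prod.ext ?_ (Prod.ext ?_ ?_)
    · exact lauDer.leibniz f.1 g.1
    · exact lauDer.leibniz f.2.1 g.2.1
    · change -(lauX 2 * lauDer (f.2.2 * g.2.2)) =
        f.2.2 * -(lauX 2 * lauDer g.2.2) + g.2.2 * -(lauX 2 * lauDer f.2.2)
      rw [lauDer.leibniz, smul_eq_mul, smul_eq_mul]
      ring

theorem triDer_fst (t : Tri) : (triDer t).1 = lauDer t.1 := rfl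

theorem triDer_snd_fst (t : Tri) : (triDer t).2.1 = lauDer t.2.1 := rfl

theorem triDer_snd_snd (t : Tri) : (triDer t).2.2 = -(lauX 2 * lauDer t.2.2) := rfl

theorem triDer_snd_snd_coeff (t : Tri) (n : ℤ) :
    (triDer t).2.2.coeff n = -((n : ℂ) - 1) * t.2.2.coeff (n - 1) := by
  rw [triDer_snd_snd, HahnSeries.coeff_neg, lauX_mul_coeff, lauDer_coeff,
    show n - 2 + 1 = n - 1 by ring]
  push_cast
  ring

/-- The coefficient functional on Laurent series. -/
def lauCoeff (n : ℤ) : Lau →ₗ[ℂ] ℂ where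
  toFun f := f.coeff n
  map_add' _ _ := rfl
  map_smul' _ _ := rfl

/-- The sum of the residues of `f dζ` at `0`, `1` and `∞`. -/
def triRes : Tri →ₗ[ℂ] ℂ :=
  lauCoeff (-1) ∘ₗ LinearMap.fst ℂ _ _ +
    lauCoeff (-1) ∘ₗ LinearMap.fst ℂ _ _ ∘ₗ LinearMap.snd ℂ _ _ -
      lauCoeff 1 ∘ₗ LinearMap.snd ℂ _ _ ∘ₗ LinearMap.snd ℂ _ _

theorem triRes_apply (t : Tri) :
    triRes t = t.1.coeff (-1) + t.2.1.coeff (-1) - t.2.2.coeff 1 := rfl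

theorem triRes_triDer (t : Tri) : triRes (triDer t) = 0 := by
  rw [triRes_apply, triDer_fst, triDer_snd_fst, triDer_snd_snd_coeff, lauDer_coeff, lauDer_coeff]
  simp

theorem lau_neg_one_smul (f : Lau) : (-1 : ℂ) • f = -f := by
  ext n
  simp

/-- The expansions of `ζ^k (ζ - 1)^m`. -/
def triMono (k m : ℤ) : Tri :=
  (((-1 : ℂ) ^ m) • (lauX k * lauBin (-1) m), lauX m * lauBin 1 k,
    lauX (-k - m) * lauBin (-1) m)

theorem triMono_mul (k m k' m' : ℤ) :
    triMono k m * triMono k' m' = triMono (k + k') (m + m') := by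
  refine Prod.ext ?_ (Prod.ext ?_ ?_)
  · change ((-1 : ℂ) ^ m) • (lauX k * lauBin (-1) m) * ((-1 : ℂ) ^ m') •
      (lauX k' * lauBin (-1) m') = ((-1 : ℂ) ^ (m + m')) • (lauX (k + k') * lauBin (-1) (m + m'))
    rw [smul_mul_smul_comm, ← zpow_add₀ (by norm_num), lauBin_add, ← lauX_mul]
    ring_nf
  · change lauX m * lauBin 1 k * (lauX m' * lauBin 1 k') =
      lauX (m + m') * lauBin 1 (k + k')
    rw [lauBin_add, ← lauX_mul]
    ring
  · change lauX (-k - m) * lauBin (-1) m * (lauX (-k' - m') * lauBin (-1) m') =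
      lauX (-(k + k') - (m + m')) * lauBin (-1) (m + m')
    rw [lauBin_add, show -(k + k') - (m + m') = -k - m + (-k' - m') by ring, ← lauX_mul]
    ring

theorem lauX_zero : lauX 0 = 1 := rfl

theorem triMono_zero : triMono 0 0 = 1 := by
  refine Prod.ext ?_ (Prod.ext ?_ ?_) <;> simp [triMono, lauBin_zero, lauX_zero]

theorem triMono_one_zero : triMono 1 0 = (lauX 1, 1 + lauX 1, lauX (-1)) := by
  refine Prod.ext ?_ (Prod.ext ?_ ?_) <;> simp [triMono, lauBin_zero, lauBin_one, lauX_zero]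

theorem triMono_zero_one : triMono 0 1 = triMono 1 0 - 1 := by
  rw [triMono_one_zero]
  refine Prod.ext ?_ (Prod.ext ?_ ?_)
  · simp [triMono, lauBin_one, lauX_zero, sub_eq_add_neg, lau_neg_one_smul, add_comm]
  · simp [triMono, lauBin_zero]
  · simp only [triMono, lauBin_one, Prod.snd_sub, Prod.snd_one]
    rw [mul_add, mul_one, mul_smul_comm, lauX_mul]
    norm_num [lauX_zero]
    rw [lau_neg_one_smul, sub_eq_add_neg]

theorem triMono_add_one (k m : ℤ) : triMono k (m + 1) = triMono (k + 1) m - triMono k m := by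
  have h := triMono_mul k m 0 1
  rw [add_zero] at h
  rw [← h, triMono_zero_one, mul_sub, mul_one, triMono_mul, add_zero]

theorem lauDer_lauX (n : ℤ) : lauDer (lauX n) = (n : ℂ) • lauX (n - 1) := by
  ext k
  rw [lauDer_coeff, HahnSeries.coeff_smul, lauX_coeff, lauX_coeff, smul_eq_mul]
  by_cases h : k = n - 1
  · rw [if_pos (by omega), if_pos h, h]
    push_cast
    ring
  · rw [if_neg (by omega), if_neg h, mul_zero, mul_zero]

theorem triDer_one_zero : triDer (triMono 1 0) = 1 := by
  rw [triMono_one_zero]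
  refine Prod.ext ?_ (Prod.ext ?_ ?_)
  · rw [triDer_fst]
    simp [lauDer_lauX, lauX_zero]
  · rw [triDer_snd_fst]
    simp [lauDer_lauX, lauX_zero]
  · rw [triDer_snd_snd]
    simp only [lauDer_lauX, mul_smul_comm, lauX_mul]
    norm_num [lauX_zero, lau_neg_one_smul]

theorem derivation_zpow {A : Type*} [CommRing A] [Algebra ℂ A] (D : Derivation ℂ A A) (g : ℤ → A)
    (h0 : g 0 = 1) (hg : ∀ m n, g m * g n = g (m + n)) (h1 : D (g 1) = 1) (n : ℤ) :
    D (g n) = (n : ℂ) • g (n - 1) := by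
  induction n using Int.induction_on with
  | zero => simp [h0]
  | succ n ih =>
    rw [← hg, D.leibniz, ih, h1, smul_eq_mul, smul_eq_mul, mul_one, mul_smul_comm, hg,
      show 1 + ((n : ℤ) - 1) = n by ring, add_sub_cancel_right]
    push_cast
    module
  | pred n ih =>
    have h2 : g (-(n : ℤ)) = g (-(n : ℤ) - 1) * g 1 := by rw [hg, sub_add_cancel]
    rw [h2, D.leibniz, h1, smul_eq_mul, smul_eq_mul, mul_one] at ih
    have h3 := congrArg (fun x => g (-1) * x) ih
    simp only [mul_add, ← mul_assoc, mul_smul_comm, hg] at h3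
    rw [show (-1 : ℤ) + 1 = 0 by ring, h0, one_mul, show -1 + (-(n : ℤ) - 1) = -(n : ℤ) - 1 - 1 by
      ring]
      at h3
    rw [eq_sub_of_add_eq' h3]
    push_cast
    module

theorem triDer_triMono (k m : ℤ) :
    triDer (triMono k m) = (k : ℂ) • triMono (k - 1) m + (m : ℂ) • triMono k (m - 1) := by
  have h1 := derivation_zpow triDer (fun k => triMono k 0) triMono_zero
    (fun m n => by rw [triMono_mul, add_zero]) triDer_one_zero k
  have h2 := derivation_zpow triDer (fun k => triMono 0 k) triMono_zero
    (fun m n => by rw [triMono_mul, add_zero]) (by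
      rw [triMono_zero_one, map_sub, triDer_one_zero, Derivation.map_one_eq_zero, sub_zero]) m
  have h3 : triMono k m = triMono k 0 * triMono 0 m := by rw [triMono_mul, add_zero, zero_add]
  rw [h3, triDer.leibniz, h1, h2, smul_eq_mul, smul_eq_mul, mul_smul_comm, mul_smul_comm,
    triMono_mul, triMono_mul]
  simp only [add_zero, zero_add]
  rw [add_comm]

theorem triRes_triMono (k m : ℤ) : triRes (triMono k m) = 0 := by
  have hD : ∀ k m : ℤ, (k : ℂ) * triRes (triMono (k - 1) m) +
      (m : ℂ) * triRes (triMono k (m - 1)) = 0 := by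
    intro k m
    have := triRes_triDer (triMono k m)
    rwa [triDer_triMono, map_add, map_smul, map_smul] at this
  have hrec : ∀ k m : ℤ, triRes (triMono k (m + 1)) =
      triRes (triMono (k + 1) m) - triRes (triMono k m) := fun k m => by
    rw [triMono_add_one, map_sub]
  have hk0 : ∀ k : ℤ, triRes (triMono k 0) = 0 := by
    intro k
    by_cases h : k = -1
    · subst h
      rw [triRes_apply]
      simp only [triMono, lauBin_zero, zpow_zero, one_smul, mul_one,
        lauX_zero, one_mul]
      have := lauBin_ordGE 1 (-1) (-1) (by norm_num)
      rw [this, lauX_coeff, lauX_coeff]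
      norm_num
    · have := hD (k + 1) 0
      rw [add_sub_cancel_right, Int.cast_zero, zero_mul, add_zero] at this
      refine (mul_eq_zero.mp this).resolve_left ?_
      have h2 : k + 1 ≠ 0 := by omega
      exact_mod_cast h2
  have h0m : ∀ m : ℤ, triRes (triMono 0 m) = 0 := by
    intro m
    by_cases h : m = -1
    · subst h
      rw [triRes_apply]
      simp only [triMono, lauX_mul_coeff, lauBin_zero, HahnSeries.coeff_smul, mul_one,
        lauX_zero, one_mul]
      have := lauBin_ordGE (-1) (-1) (-1) (by norm_num)
      rw [this, lauX_coeff]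
      norm_num [lauBin_coeff_zero]
    · have := hD 0 (m + 1)
      rw [add_sub_cancel_right, Int.cast_zero, zero_mul, zero_add] at this
      refine (mul_eq_zero.mp this).resolve_left ?_
      have h2 : m + 1 ≠ 0 := by omega
      exact_mod_cast h2
  have hpos : ∀ m : ℕ, ∀ k : ℤ, triRes (triMono k m) = 0 := by
    intro m
    induction m with
    | zero => exact hk0
    | succ m ih =>
      intro k
      push_cast
      rw [hrec, ih, ih, sub_zero]
  have hneg : ∀ m : ℕ, ∀ k : ℤ, triRes (triMono k (-m)) = 0 := by
    intro m
    induction m with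
    | zero => exact fun k => by simpa using hk0 k
    | succ m ih =>
      intro k
      have hstep : ∀ k : ℤ, triRes (triMono (k + 1) (-((m + 1 : ℕ) : ℤ))) =
          triRes (triMono k (-((m + 1 : ℕ) : ℤ))) := by
        intro k
        have := hrec k (-((m + 1 : ℕ) : ℤ))
        rw [show -((m + 1 : ℕ) : ℤ) + 1 = -(m : ℤ) by push_cast; ring, ih] at this
        exact (sub_eq_zero.mp this.symm)
      induction k using Int.induction_on with
      | zero => exact h0m _
      | succ k ihk => rw [hstep, ihk]
      | pred k ihk => rw [← hstep, sub_add_cancel, ihk]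
  rcases le_total 0 m with h | h
  · rw [← Int.toNat_of_nonneg h]
    exact hpos _ _
  · have := hneg (-m).toNat k
    rwa [Int.toNat_of_nonneg (by omega), neg_neg] at this

/-- The functions on the projective line with poles at most at `0`, `1` and `∞`. -/
def triFun : Submodule ℂ Tri := Submodule.span ℂ (Set.range fun p : ℤ × ℤ => triMono p.1 p.2)

theorem triMono_mem (k m : ℤ) : triMono k m ∈ triFun := Submodule.subset_span ⟨(k, m), rfl⟩

theorem triFun_induction {S : Submodule ℂ Tri} (h : ∀ k m, triMono k m ∈ S) {t : Tri}
    (ht : t ∈ triFun) : t ∈ S := by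
  refine Submodule.span_le.mpr ?_ ht
  rintro _ ⟨p, rfl⟩
  exact h p.1 p.2

theorem triFun_one_mem : (1 : Tri) ∈ triFun := by
  rw [← triMono_zero]
  exact triMono_mem 0 0

theorem triFun_mul_mem {s t : Tri} (hs : s ∈ triFun) (ht : t ∈ triFun) : s * t ∈ triFun := by
  refine triFun_induction (S := triFun.comap (LinearMap.mulRight ℂ t)) (fun k m => ?_) hs
  refine triFun_induction (S := triFun.comap (LinearMap.mulLeft ℂ (triMono k m)))
    (fun k' m' => ?_) ht
  rw [Submodule.mem_comap, LinearMap.mulLeft_apply, triMono_mul]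
  exact triMono_mem _ _

theorem triFun_der_mem {t : Tri} (ht : t ∈ triFun) : triDer t ∈ triFun := by
  refine triFun_induction (S := triFun.comap (triDer : Tri →ₗ[ℂ] Tri)) (fun k m => ?_) ht
  change triDer (triMono k m) ∈ triFun
  rw [triDer_triMono]
  exact triFun.add_mem (triFun.smul_mem _ (triMono_mem _ _)) (triFun.smul_mem _ (triMono_mem _ _))

theorem triRes_eq_zero {t : Tri} (ht : t ∈ triFun) : triRes t = 0 :=
  triFun_induction (S := LinearMap.ker triRes) triRes_triMono ht

end Tri


section Decomposition

/-- The triples of Laurent series that vanish at the three points, as vector fields `f d/dζ`. -/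
def triReg : Submodule ℂ Tri where
  carrier := {t | OrdGE t.1 1 ∧ OrdGE t.2.1 1 ∧ OrdGE t.2.2 (-1)}
  add_mem' := fun ha hb => ⟨ha.1.add hb.1, ha.2.1.add hb.2.1, ha.2.2.add hb.2.2⟩
  zero_mem' := ⟨OrdGE.zero _, OrdGE.zero _, OrdGE.zero _⟩
  smul_mem' := fun r _ ha => ⟨ha.1.smul r, ha.2.1.smul r, ha.2.2.smul r⟩

theorem mem_triReg {t : Tri} :
    t ∈ triReg ↔ OrdGE t.1 1 ∧ OrdGE t.2.1 1 ∧ OrdGE t.2.2 (-1) := Iff.rfl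

theorem triMono_fst_ordGE (k m : ℤ) : OrdGE (triMono k m).1 k := by
  have := ((lauX_ordGE k).mul (lauBin_ordGE (-1) m)).smul ((-1 : ℂ) ^ m)
  rwa [add_zero] at this

theorem triMono_snd_fst_ordGE (k m : ℤ) : OrdGE (triMono k m).2.1 m := by
  have := (lauX_ordGE m).mul (lauBin_ordGE 1 k)
  rwa [add_zero] at this

theorem triMono_snd_snd_ordGE (k m : ℤ) : OrdGE (triMono k m).2.2 (-k - m) := by
  have := (lauX_ordGE (-k - m)).mul (lauBin_ordGE (-1) m)
  rwa [add_zero] at this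

theorem triMono_fst_coeff (k m : ℤ) (i : ℕ) :
    (triMono k m).1.coeff (k + i) = (-1 : ℂ) ^ m * ((-1) ^ i * (bin m i : ℂ)) := by
  rw [triMono, HahnSeries.coeff_smul, lauX_mul_coeff, add_sub_cancel_left, lauBin_coeff,
    smul_eq_mul]

theorem triMono_snd_fst_coeff (k m : ℤ) (i : ℕ) :
    (triMono k m).2.1.coeff (m + i) = (bin k i : ℂ) := by
  rw [triMono, lauX_mul_coeff, add_sub_cancel_left, lauBin_coeff, one_pow, one_mul]

theorem triMono_snd_snd_coeff (k m : ℤ) (i : ℕ) :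
    (triMono k m).2.2.coeff (-k - m + i) = (-1) ^ i * (bin m i : ℂ) := by
  rw [triMono, lauX_mul_coeff, add_sub_cancel_left, lauBin_coeff]

theorem triMono_fst_coeff_self (k m : ℤ) : (triMono k m).1.coeff k = (-1 : ℂ) ^ m := by
  have := triMono_fst_coeff k m 0
  simpa using this

theorem triMono_snd_fst_coeff_self (k m : ℤ) : (triMono k m).2.1.coeff m = 1 := by
  have := triMono_snd_fst_coeff k m 0
  simpa using this

theorem triMono_snd_snd_coeff_self (k m : ℤ) : (triMono k m).2.2.coeff (-k - m) = 1 := by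
  have := triMono_snd_snd_coeff k m 0
  simpa using this

theorem lau_exists_leading {f : Lau} (hf : f ≠ 0) {a : ℤ} (ha : OrdGE f a) :
    ∃ b, a ≤ b ∧ OrdGE f b ∧ f.coeff b ≠ 0 := by
  have h0 : f.coeff f.order ≠ 0 := HahnSeries.coeff_order_eq_zero.not.mpr hf
  refine ⟨f.order, ?_, fun n hn => HahnSeries.coeff_eq_zero_of_lt_order hn, h0⟩
  by_contra h
  exact h0 (ha _ (by omega))

theorem triFun_disjoint_triReg : Disjoint triFun triReg := by
  rw [Submodule.disjoint_def]
  intro t ht hr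
  obtain ⟨r0, r1, r2⟩ := mem_triReg.mp hr
  have hres : ∀ k m : ℤ, ((triMono k m).1 * t.1).coeff (-1) +
      ((triMono k m).2.1 * t.2.1).coeff (-1) - ((triMono k m).2.2 * t.2.2).coeff 1 = 0 :=
    fun k m => triRes_eq_zero (triFun_mul_mem (triMono_mem k m) ht)
  have e0 : t.1 = 0 := by
    by_contra h0
    obtain ⟨a, ha, hord, hne⟩ := lau_exists_leading h0 r0
    have h := hres (-1 - a) (-1)
    rw [((triMono_snd_fst_ordGE (-1 - a) (-1)).mul r1) (-1) (by omega),
      ((triMono_snd_snd_ordGE (-1 - a) (-1)).mul r2) 1 (by omega)] at h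
    have h2 := (triMono_fst_ordGE (-1 - a) (-1)).coeff_mul_add hord
    rw [triMono_fst_coeff_self, show -1 - a + a = -1 by ring] at h2
    rw [h2] at h
    norm_num at h
    exact hne h
  have e1 : t.2.1 = 0 := by
    by_contra h0
    obtain ⟨a, ha, hord, hne⟩ := lau_exists_leading h0 r1
    have h := hres (-1) (-1 - a)
    rw [((triMono_fst_ordGE (-1) (-1 - a)).mul r0) (-1) (by omega),
      ((triMono_snd_snd_ordGE (-1) (-1 - a)).mul r2) 1 (by omega)] at h
    have h2 := (triMono_snd_fst_ordGE (-1) (-1 - a)).coeff_mul_add hord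
    rw [triMono_snd_fst_coeff_self, show -1 - a + a = -1 by ring] at h2
    rw [h2] at h
    norm_num at h
    exact hne h
  have e2 : t.2.2 = 0 := by
    by_contra h0
    obtain ⟨a, ha, hord, hne⟩ := lau_exists_leading h0 r2
    have h := hres (a - 1) 0
    have h2 := (triMono_snd_snd_ordGE (a - 1) 0).coeff_mul_add hord
    rw [triMono_snd_snd_coeff_self, show -(a - 1) - 0 + a = 1 by ring] at h2
    rw [h2, e0, e1, mul_zero, mul_zero] at h
    norm_num at h
    exact hne h
  exact Prod.ext e0 (Prod.ext e1 e2)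

theorem triFun_sup_triReg : triFun ⊔ triReg = ⊤ := by
  have hm : ∀ {t : Tri}, t ∈ triReg → t ∈ triFun ⊔ triReg := fun h =>
    Submodule.mem_sup_right h
  have key0 : ∀ (N : ℕ) (f : Lau), OrdGE f (1 - N) → ((f, 0, 0) : Tri) ∈ triFun ⊔ triReg := by
    intro N
    induction N with
    | zero => exact fun f hf => hm ⟨by simpa using hf, OrdGE.zero _, OrdGE.zero _⟩
    | succ N ih =>
      intro f hf
      have hsplit : ((f, 0, 0) : Tri) = f.coeff (-N) • (-triMono (-N) 1) +
          (f + f.coeff (-N) • (triMono (-N) 1).1, 0, 0) +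
          (0, f.coeff (-N) • (triMono (-N) 1).2.1, f.coeff (-N) • (triMono (-N) 1).2.2) := by
        refine Prod.ext ?_ (Prod.ext ?_ ?_) <;> simp
      rw [hsplit]
      refine Submodule.add_mem _ (Submodule.add_mem _ (Submodule.mem_sup_left
        (triFun.smul_mem _ (triFun.neg_mem (triMono_mem _ _)))) (ih _ ?_)) (hm ⟨OrdGE.zero _, ?_,
          ?_⟩)
      · intro n hn
        rw [HahnSeries.coeff_add, HahnSeries.coeff_smul]
        by_cases h : n = -N
        · rw [h, triMono_fst_coeff_self]
          simp
        · rw [hf n (by push_cast; omega), triMono_fst_ordGE _ _ n (by omega)]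
          simp
      · exact (triMono_snd_fst_ordGE _ _).smul _
      · exact ((triMono_snd_snd_ordGE _ _).smul _).mono (by omega)
  have key1 : ∀ (N : ℕ) (f : Lau), OrdGE f (1 - N) → ((0, f, 0) : Tri) ∈ triFun ⊔ triReg := by
    intro N
    induction N with
    | zero => exact fun f hf => hm ⟨OrdGE.zero _, by simpa using hf, OrdGE.zero _⟩
    | succ N ih =>
      intro f hf
      have hsplit : ((0, f, 0) : Tri) = f.coeff (-N) • triMono 1 (-N) +
          (0, f - f.coeff (-N) • (triMono 1 (-N)).2.1, 0) +
          (-(f.coeff (-N) • (triMono 1 (-N)).1), 0, -(f.coeff (-N) • (triMono 1 (-N)).2.2)) := by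
        refine Prod.ext ?_ (Prod.ext ?_ ?_) <;> simp
      rw [hsplit]
      refine Submodule.add_mem _ (Submodule.add_mem _ (Submodule.mem_sup_left
        (triFun.smul_mem _ (triMono_mem _ _))) (ih _ ?_)) (hm ?_)
      · intro n hn
        rw [HahnSeries.coeff_sub, HahnSeries.coeff_smul]
        by_cases h : n = -N
        · rw [h, triMono_snd_fst_coeff_self]
          simp
        · rw [hf n (by push_cast; omega), triMono_snd_fst_ordGE _ _ n (by omega)]
          simp
      · rw [← neg_mem_iff]
        refine ⟨?_, ?_, ?_⟩
        · change OrdGE (- -(f.coeff (-N) • (triMono 1 (-N)).1)) 1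
          rw [neg_neg]
          exact (triMono_fst_ordGE _ _).smul _
        · change OrdGE (-0) 1
          rw [neg_zero]
          exact OrdGE.zero _
        · change OrdGE (- -(f.coeff (-N) • (triMono 1 (-N)).2.2)) (-1)
          rw [neg_neg]
          exact ((triMono_snd_snd_ordGE _ _).smul _).mono (by omega)
  have key2 : ∀ (N : ℕ) (f : Lau), OrdGE f (-1 - N) → ((0, 0, f) : Tri) ∈ triFun ⊔ triReg := by
    intro N
    induction N with
    | zero => exact fun f hf => hm ⟨OrdGE.zero _, OrdGE.zero _, by simpa using hf⟩
    | succ N ih =>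
      intro f hf
      have hsplit : ((0, 0, f) : Tri) = f.coeff (-2 - N) • triMono (N + 1) 1 +
          (0, 0, f - f.coeff (-2 - N) • (triMono (N + 1) 1).2.2) +
          (-(f.coeff (-2 - N) • (triMono (N + 1) 1).1),
            -(f.coeff (-2 - N) • (triMono (N + 1) 1).2.1), 0) := by
        refine Prod.ext ?_ (Prod.ext ?_ ?_) <;> simp
      rw [hsplit]
      refine Submodule.add_mem _ (Submodule.add_mem _ (Submodule.mem_sup_left
        (triFun.smul_mem _ (triMono_mem _ _))) (ih _ ?_)) (hm ?_)
      · intro n hn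
        rw [HahnSeries.coeff_sub, HahnSeries.coeff_smul]
        by_cases h : n = -2 - N
        · have := triMono_snd_snd_coeff_self (N + 1) 1
          rw [show -((N : ℤ) + 1) - 1 = -2 - N by ring] at this
          rw [h, this]
          simp
        · rw [hf n (by push_cast; omega), triMono_snd_snd_ordGE _ _ n (by omega)]
          simp
      · rw [← neg_mem_iff]
        refine ⟨?_, ?_, ?_⟩
        · change OrdGE (- -(f.coeff (-2 - N) • (triMono (N + 1) 1).1)) 1
          rw [neg_neg]
          exact ((triMono_fst_ordGE _ _).smul _).mono (by omega)
        · change OrdGE (- -(f.coeff (-2 - N) • (triMono (N + 1) 1).2.1)) 1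
          rw [neg_neg]
          exact (triMono_snd_fst_ordGE _ _).smul _
        · change OrdGE (-0) (-1)
          rw [neg_zero]
          exact OrdGE.zero _
  rw [eq_top_iff]
  rintro ⟨f, g, h⟩ -
  have hs : ((f, g, h) : Tri) = (f, 0, 0) + (0, g, 0) + (0, 0, h) := by
    refine Prod.ext ?_ (Prod.ext ?_ ?_) <;> simp
  obtain ⟨a, ha⟩ := lau_exists_bound f
  obtain ⟨b, hb⟩ := lau_exists_bound g
  obtain ⟨d, hd⟩ := lau_exists_bound h
  rw [hs]
  exact Submodule.add_mem _ (Submodule.add_mem _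
    (key0 (1 - a).toNat f fun n hn => ha n (by omega))
    (key1 (1 - b).toNat g fun n hn => hb n (by omega)))
    (key2 (-1 - d).toNat h fun n hn => hd n (by omega))

theorem triFun_isCompl_triReg : IsCompl triFun triReg :=
  ⟨triFun_disjoint_triReg, codisjoint_iff.mpr triFun_sup_triReg⟩

end Decomposition


section GlobalFields

/-- The central extension of the Lie algebra of triples of formal vector fields at `0`, `1`, `∞`. -/
abbrev TriVec : Type := GelfandFuchs triDer triRes triRes_triDer

/-- The Lie subalgebra of the vector fields on the projective line with poles at `0`, `1`, `∞`. -/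
def globalVec : LieSubalgebra ℂ TriVec where
  carrier := {x | x.1 ∈ triFun ∧ x.2 = 0}
  add_mem' := fun {a b} ha hb => ⟨triFun.add_mem ha.1 hb.1, by
    change a.2 + b.2 = 0
    rw [ha.2, hb.2, add_zero]⟩
  zero_mem' := ⟨triFun.zero_mem, rfl⟩
  smul_mem' := fun r a ha => ⟨triFun.smul_mem r ha.1, by
    change r * a.2 = 0
    rw [ha.2, mul_zero]⟩
  lie_mem' := fun {a b} ha hb => by
    refine ⟨?_, ?_⟩
    · rw [GelfandFuchs.lie_fst]
      exact triFun.sub_mem (triFun_mul_mem ha.1 (triFun_der_mem hb.1))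
        (triFun_mul_mem (triFun_der_mem ha.1) hb.1)
    · rw [GelfandFuchs.lie_snd, triRes_eq_zero, zero_div]
      exact triFun_mul_mem (triFun_der_mem (triFun_der_mem (triFun_der_mem ha.1))) hb.1

/-- The projection of formal vector fields onto global vector fields, along those that vanish at
the three points. -/
def globalProj : TriVec →ₗ[ℂ] globalVec where
  toFun x := ⟨(triFun.projectionOnto triReg triFun_isCompl_triReg x.1, 0),
    (triFun.projectionOnto triReg triFun_isCompl_triReg x.1).2, rfl⟩
  map_add' x y := by
    refine Subtype.ext (Prod.ext ?_ (add_zero (0 : ℂ)).symm)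
    change (triFun.projectionOnto triReg triFun_isCompl_triReg (x.1 + y.1) : Tri) = _
    rw [map_add]
    rfl
  map_smul' r x := by
    refine Subtype.ext (Prod.ext ?_ (mul_zero r).symm)
    change (triFun.projectionOnto triReg triFun_isCompl_triReg (r • x.1) : Tri) = _
    rw [map_smul]
    rfl

theorem globalProj_coe (x : globalVec) : globalProj x = x := by
  refine Subtype.ext (Prod.ext ?_ x.2.2.symm)
  exact congrArg Subtype.val
    (Submodule.projectionOnto_apply_left triFun_isCompl_triReg ⟨x.1.1, x.2.1⟩)

theorem globalProj_eq_zero {x : TriVec} : globalProj x = 0 ↔ x.1 ∈ triReg := by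
  rw [← Submodule.projectionOnto_apply_eq_zero_iff triFun_isCompl_triReg]
  constructor
  · intro h
    exact Subtype.ext (congrArg (fun y : globalVec => (y : TriVec).1) h)
  · intro h
    exact Subtype.ext (Prod.ext (congrArg Subtype.val h) rfl)

variable (c hmid hin hout : ℂ)

/-- The functional on formal vector fields whose restriction to those that vanish at the three
points is the character of the highest weights. -/
def hwCharAux : TriVec →ₗ[ℂ] ℂ where
  toFun x := c * x.2 - hin * x.1.1.coeff 1 - hmid * x.1.2.1.coeff 1 + hout * x.1.2.2.coeff (-1)
  map_add' x y := by
    simp only [GelfandFuchs.add_fst, GelfandFuchs.add_snd, Prod.fst_add, Prod.snd_add,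
      HahnSeries.coeff_add]
    ring
  map_smul' r x := by
    change c * (r * x.2) - hin * (r * x.1.1.coeff 1) - hmid * (r * x.1.2.1.coeff 1) +
      hout * (r * x.1.2.2.coeff (-1)) = r * _
    ring

/-- The functional on formal vector fields that vanishes on global vector fields and is the
character of the highest weights on those that vanish at the three points. -/
def hwChar : TriVec →ₗ[ℂ] ℂ :=
  hwCharAux c hmid hin hout ∘ₗ (LinearMap.id - globalVec.toSubmodule.subtype ∘ₗ globalProj)

theorem hwChar_coe (x : globalVec) : hwChar c hmid hin hout x = 0 := by
  change hwCharAux c hmid hin hout ((x : TriVec) - (globalProj x : TriVec)) = 0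
  rw [globalProj_coe, sub_self, map_zero]

theorem hwChar_of_mem {x : TriVec} (h : x.1 ∈ triReg) : hwChar c hmid hin hout x =
    c * x.2 - hin * x.1.1.coeff 1 - hmid * x.1.2.1.coeff 1 + hout * x.1.2.2.coeff (-1) := by
  change hwCharAux c hmid hin hout (x - (globalProj x : TriVec)) = _
  rw [globalProj_eq_zero.mpr h]
  change hwCharAux c hmid hin hout (x - 0) = _
  rw [sub_zero]
  rfl

theorem triDer_ordGE {t : Tri} {a : ℤ} (h : OrdGE t.2.2 a) : OrdGE (triDer t).2.2 (a + 1) :=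
  fun n hn => by rw [triDer_snd_snd_coeff, h _ (by omega), mul_zero]

theorem triReg_bracket {x y : TriVec} (hx : globalProj x = 0) (hy : globalProj y = 0) :
    globalProj ⁅x, y⁆ = 0 ∧ hwChar c hmid hin hout ⁅x, y⁆ = 0 := by
  rw [globalProj_eq_zero] at hx hy
  obtain ⟨x0, x1, x2⟩ := mem_triReg.mp hx
  obtain ⟨y0, y1, y2⟩ := mem_triReg.mp hy
  have hmem : ⁅x, y⁆.1 ∈ triReg := by
    rw [GelfandFuchs.lie_fst]
    refine ⟨?_, ?_, ?_⟩
    · exact ((x0.mul (lauDer_ordGE y0)).sub ((lauDer_ordGE x0).mul y0)).mono (by omega)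
    · exact ((x1.mul (lauDer_ordGE y1)).sub ((lauDer_ordGE x1).mul y1)).mono (by omega)
    · exact ((x2.mul (triDer_ordGE y2)).sub ((triDer_ordGE x2).mul y2)).mono (by omega)
  refine ⟨globalProj_eq_zero.mpr hmem, ?_⟩
  rw [hwChar_of_mem _ _ _ _ hmem]
  have hloc : ∀ {f g : Lau}, OrdGE f 1 → OrdGE g 1 →
      (f * lauDer g - lauDer f * g).coeff 1 = 0 := by
    intro f g hf hg
    have h1 := hf.coeff_mul_add (lauDer_ordGE hg)
    have h2 := (lauDer_ordGE hf).coeff_mul_add hg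
    norm_num [lauDer_coeff] at h1 h2
    rw [HahnSeries.coeff_sub, h1, h2, sub_self]
  have h0 : ⁅x, y⁆.1.1.coeff 1 = 0 := hloc x0 y0
  have h1 : ⁅x, y⁆.1.2.1.coeff 1 = 0 := hloc x1 y1
  have h2 : ⁅x, y⁆.1.2.2.coeff (-1) = 0 := by
    have h1 := x2.coeff_mul_add (triDer_ordGE y2)
    have h2 := (triDer_ordGE x2).coeff_mul_add y2
    norm_num [triDer_snd_snd_coeff] at h1 h2
    change (x.1.2.2 * (triDer y.1).2.2 - (triDer x.1).2.2 * y.1.2.2).coeff (-1) = 0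
    rw [HahnSeries.coeff_sub, h1, h2, sub_self]
  have h3 : ⁅x, y⁆.2 = 0 := by
    rw [GelfandFuchs.lie_snd, triRes_apply]
    have hz : ∀ {f g : Lau}, OrdGE f 1 → OrdGE g 1 →
        (lauDer (lauDer (lauDer f)) * g).coeff (-1) = 0 := fun hf hg =>
      ((lauDer_ordGE_zero (lauDer_ordGE_zero (lauDer_ordGE_zero (hf.mono (by omega))))).mul hg) _
        (by omega)
    have e0 : (triDer (triDer (triDer x.1)) * y.1).1.coeff (-1) = 0 := hz x0 y0
    have e1 : (triDer (triDer (triDer x.1)) * y.1).2.1.coeff (-1) = 0 := hz x1 y1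
    have e2 : (triDer (triDer (triDer x.1)) * y.1).2.2.coeff 1 = 0 := by
      have hord : OrdGE (triDer (triDer (triDer x.1))).2.2 3 := by
        intro n hn
        by_cases h : n < 2
        · exact triDer_ordGE (triDer_ordGE (triDer_ordGE x2)) n (by omega)
        · obtain rfl : n = 2 := by omega
          rw [triDer_snd_snd_coeff, triDer_snd_snd_coeff]
          norm_num
      exact (hord.mul y2) 1 (by omega)
    rw [e0, e1, e2]
    norm_num
  rw [h0, h1, h2, h3]
  ring

/-- The module induced from the character of the highest weights. -/
abbrev Blocks : Type := Env globalVec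

/-- The action of a triple of formal vector fields on the induced module. -/
def blockOp (t : Tri) : Module.End ℂ Blocks :=
  inducedOp globalVec globalProj (hwChar c hmid hin hout) (GelfandFuchs.mk triRes_triDer t 0)

theorem blockOp_add (s t : Tri) (y : Blocks) : blockOp c hmid hin hout (s + t) y =
    blockOp c hmid hin hout s y + blockOp c hmid hin hout t y := by
  have := inducedOp_add globalVec globalProj (hwChar c hmid hin hout) (GelfandFuchs.mk
    triRes_triDer s 0)
    (GelfandFuchs.mk triRes_triDer t 0) y
  rw [blockOp, blockOp, blockOp, ← this]
  congr 2
  exact Prod.ext rfl (add_zero (0 : ℂ)).symm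

theorem blockOp_smul (r : ℂ) (t : Tri) (y : Blocks) : blockOp c hmid hin hout (r • t) y =
    r • blockOp c hmid hin hout t y := by
  have := inducedOp_smul globalVec globalProj (hwChar c hmid hin hout) r (GelfandFuchs.mk
    triRes_triDer t 0) y
  rw [blockOp, blockOp, ← this]
  congr 2
  exact Prod.ext rfl (mul_zero r).symm

theorem blockOp_zero (y : Blocks) : blockOp c hmid hin hout 0 y = 0 := by
  have := inducedOp_smul globalVec globalProj (hwChar c hmid hin hout) 0
    (GelfandFuchs.mk triRes_triDer 0 0) y
  rw [zero_smul, zero_smul] at this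
  exact this

theorem blockOp_one_of_mem {t : Tri} (ht : t ∈ triReg) : blockOp c hmid hin hout t 1 =
    (-(hin * t.1.coeff 1) - hmid * t.2.1.coeff 1 + hout * t.2.2.coeff (-1)) • (1 : Blocks) := by
  rw [blockOp, inducedOp_one, globalProj_eq_zero.mpr ht, map_zero, zero_add,
    hwChar_of_mem _ _ _ _ ht]
  congr 1
  simp only [GelfandFuchs.mk_fst, GelfandFuchs.mk_snd]
  ring

theorem blockOp_of_mem {t : Tri} (ht : t ∈ triFun) (y : Blocks) :
    ∃ x : globalVec, blockOp c hmid hin hout t y = UniversalEnvelopingAlgebra.ι ℂ x * y :=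
  ⟨⟨GelfandFuchs.mk triRes_triDer t 0, ht, rfl⟩, inducedOp_coe globalProj_coe (hwChar_coe c hmid
    hin hout) ⟨GelfandFuchs.mk triRes_triDer t 0, ht, rfl⟩ y⟩

theorem inducedOp_central (a : ℂ) (y : Blocks) :
    inducedOp globalVec globalProj (hwChar c hmid hin hout) (GelfandFuchs.mk triRes_triDer 0 a) y =
      (a * c) • y := by
  let S : Submodule ℂ Blocks :=
    { carrier := {y | inducedOp globalVec globalProj (hwChar c hmid hin hout) (GelfandFuchs.mk
      triRes_triDer 0 a) y =
        (a * c) • y}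
      add_mem' := fun {u v} hu hv => by
        rw [Set.mem_ofPred_eq] at *
        rw [map_add, hu, hv, smul_add]
      zero_mem' := by
        rw [Set.mem_ofPred_eq, map_zero, smul_zero]
      smul_mem' := fun r u hu => by
        rw [Set.mem_ofPred_eq] at *
        rw [map_smul, hu, smul_comm] }
  refine universalEnveloping_induction S ?_ (fun x y hy => ?_) y
  · change inducedOp globalVec globalProj (hwChar c hmid hin hout) (GelfandFuchs.mk triRes_triDer 0
      a) 1 = (a * c) • 1
    have hm : (GelfandFuchs.mk triRes_triDer 0 a).1 ∈ triReg := triReg.zero_mem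
    rw [inducedOp_one, globalProj_eq_zero.mpr hm, map_zero, zero_add, hwChar_of_mem _ _ _ _ hm]
    congr 1
    simp only [GelfandFuchs.mk_fst, GelfandFuchs.mk_snd, Prod.fst_zero, Prod.snd_zero,
      HahnSeries.coeff_zero]
    ring
  · change inducedOp globalVec globalProj (hwChar c hmid hin hout) (GelfandFuchs.mk triRes_triDer 0
      a) _ =
      (a * c) • _
    have hb : ⁅(x : TriVec), (GelfandFuchs.mk triRes_triDer 0 a)⁆ = 0 := by
      refine Prod.ext ?_ ?_
      · change (x : TriVec).1 * triDer 0 - triDer (x : TriVec).1 * 0 = 0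
        rw [map_zero, mul_zero, mul_zero, sub_zero]
      · change triRes (_ * (0 : Tri)) / 12 = 0
        rw [mul_zero, map_zero, zero_div]
    have h0 := inducedOp_smul globalVec globalProj (hwChar c hmid hin hout) 0 0 y
    rw [zero_smul, zero_smul] at h0
    rw [inducedOp_ι_mul, hb, h0, sub_zero,
      show inducedOp globalVec globalProj (hwChar c hmid hin hout) (GelfandFuchs.mk triRes_triDer 0
        a) y =
        (a * c) • y from hy, mul_smul_comm]

theorem blockOp_comm (s t : Tri) (y : Blocks) :
    blockOp c hmid hin hout s (blockOp c hmid hin hout t y) =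
      blockOp c hmid hin hout t (blockOp c hmid hin hout s y) +
        (blockOp c hmid hin hout (s * triDer t - triDer s * t) y +
          (triRes (triDer (triDer (triDer s)) * t) / 12 * c) • y) := by
  have h := inducedOp_lie globalProj_coe (hwChar_coe c hmid hin hout)
    (fun x y hx hy => triReg_bracket c hmid hin hout hx hy) (GelfandFuchs.mk triRes_triDer s 0)
      (GelfandFuchs.mk triRes_triDer t 0) y
  have hsplit : ⁅(GelfandFuchs.mk triRes_triDer s 0), (GelfandFuchs.mk triRes_triDer t 0)⁆ =
      GelfandFuchs.mk triRes_triDer (s * triDer t - triDer s * t) 0 +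
        GelfandFuchs.mk triRes_triDer 0 (triRes (triDer (triDer (triDer s)) * t) / 12) :=
    Prod.ext (add_zero _).symm (zero_add _).symm
  rw [hsplit, inducedOp_add, inducedOp_central] at h
  rw [← sub_eq_iff_eq_add']
  exact h.symm

/-- Families of vector fields with the commutation relations of the Virasoro algebra. -/
theorem blockOp_virasoro {e : ℤ → Tri}
    (h1 : ∀ m n, e m * triDer (e n) - triDer (e m) * e n = ((m : ℂ) - n) • e (m + n))
    (h2 : ∀ m n, triRes (triDer (triDer (triDer (e m))) * e n) =
      if m + n = 0 then (m : ℂ) ^ 3 - m else 0) (m n : ℤ) (y : Blocks) :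
    blockOp c hmid hin hout (e m) (blockOp c hmid hin hout (e n) y) =
      blockOp c hmid hin hout (e n) (blockOp c hmid hin hout (e m) y) +
        (((m : ℂ) - n) • blockOp c hmid hin hout (e (m + n)) y +
          (if m + n = 0 then (((m : ℂ) ^ 3 - m) / 12 * c) • y else 0)) := by
  rw [blockOp_comm, h1, h2, blockOp_smul]
  split_ifs <;> simp

/-- The vector field of `L_n` at `0`. -/
def vecZero (n : ℤ) : Tri := (HahnSeries.single (n + 1) (-1), 0, 0)

/-- The vector field of `L_n` at `1`. -/
def vecOne (n : ℤ) : Tri := (0, HahnSeries.single (n + 1) (-1), 0)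

/-- The vector field of `L_n` at `∞`. -/
def vecInf (n : ℤ) : Tri := (0, 0, lauX (n - 1))

theorem single_coeff (n : ℤ) (r : ℂ) (k : ℤ) :
    (HahnSeries.single n r : Lau).coeff k = if k = n then r else 0 := by
  rw [HahnSeries.coeff_single]
  congr

theorem lauDer_single (n : ℤ) (r : ℂ) :
    lauDer (HahnSeries.single n r) = HahnSeries.single (n - 1) ((n : ℂ) * r) := by
  ext k
  rw [lauDer_coeff, single_coeff, single_coeff]
  by_cases h : k = n - 1
  · rw [if_pos (by omega), if_pos h, h]
    push_cast
    ring
  · rw [if_neg (by omega), if_neg h, mul_zero]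

theorem single_bracket (m n : ℤ) :
    (HahnSeries.single (m + 1) (-1) : Lau) * lauDer (HahnSeries.single (n + 1) (-1)) -
      lauDer (HahnSeries.single (m + 1) (-1)) * HahnSeries.single (n + 1) (-1) =
      ((m : ℂ) - n) • (HahnSeries.single (m + n + 1) (-1) : Lau) := by
  rw [lauDer_single, lauDer_single, HahnSeries.single_mul_single, HahnSeries.single_mul_single,
    show m + 1 + (n + 1 - 1) = m + n + 1 by ring, show m + 1 - 1 + (n + 1) = m + n + 1 by ring]
  ext k
  rw [HahnSeries.coeff_sub, HahnSeries.coeff_smul, single_coeff, single_coeff, single_coeff,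
    smul_eq_mul]
  split_ifs
  · push_cast
    ring
  · ring

theorem single_cocycle (m n : ℤ) :
    (lauDer (lauDer (lauDer (HahnSeries.single (m + 1) (-1)))) *
      (HahnSeries.single (n + 1) (-1) : Lau)).coeff (-1) =
      if m + n = 0 then (m : ℂ) ^ 3 - m else 0 := by
  rw [lauDer_single, lauDer_single, lauDer_single, HahnSeries.single_mul_single, single_coeff]
  by_cases h : m + n = 0
  · rw [if_pos (by omega), if_pos h]
    push_cast
    ring
  · rw [if_neg (by omega), if_neg h]

theorem vecZero_bracket (m n : ℤ) : vecZero m * triDer (vecZero n) -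
    triDer (vecZero m) * vecZero n = ((m : ℂ) - n) • vecZero (m + n) := by
  refine Prod.ext (single_bracket m n) (Prod.ext ?_ ?_)
  · change 0 * lauDer 0 - lauDer 0 * 0 = ((m : ℂ) - n) • (0 : Lau)
    simp
  · change 0 * -(lauX 2 * lauDer 0) - -(lauX 2 * lauDer 0) * 0 = ((m : ℂ) - n) • (0 : Lau)
    simp

theorem vecOne_bracket (m n : ℤ) : vecOne m * triDer (vecOne n) -
    triDer (vecOne m) * vecOne n = ((m : ℂ) - n) • vecOne (m + n) := by
  refine Prod.ext ?_ (Prod.ext (single_bracket m n) ?_)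
  · change 0 * lauDer 0 - lauDer 0 * 0 = ((m : ℂ) - n) • (0 : Lau)
    simp
  · change 0 * -(lauX 2 * lauDer 0) - -(lauX 2 * lauDer 0) * 0 = ((m : ℂ) - n) • (0 : Lau)
    simp

theorem vecInf_der (n : ℤ) : triDer (vecInf n) = ((1 : ℂ) - n) • vecInf (n + 1) := by
  refine Prod.ext ?_ (Prod.ext ?_ ?_)
  · change lauDer 0 = ((1 : ℂ) - n) • (0 : Lau)
    simp
  · change lauDer 0 = ((1 : ℂ) - n) • (0 : Lau)
    simp
  · change -(lauX 2 * lauDer (lauX (n - 1))) = ((1 : ℂ) - n) • lauX (n + 1 - 1)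
    rw [lauDer_lauX, mul_smul_comm, lauX_mul, show 2 + (n - 1 - 1) = n + 1 - 1 by ring]
    ext k
    simp only [HahnSeries.coeff_smul, HahnSeries.coeff_neg, smul_eq_mul]
    push_cast
    ring

theorem vecInf_mul (m n : ℤ) : vecInf m * vecInf n = vecInf (m + n - 1) := by
  refine Prod.ext (mul_zero _) (Prod.ext (mul_zero _) ?_)
  change lauX (m - 1) * lauX (n - 1) = lauX (m + n - 1 - 1)
  rw [lauX_mul]
  congr 1
  ring

theorem vecInf_bracket (m n : ℤ) : vecInf m * triDer (vecInf n) -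
    triDer (vecInf m) * vecInf n = ((m : ℂ) - n) • vecInf (m + n) := by
  rw [vecInf_der, vecInf_der, mul_smul_comm, smul_mul_assoc, vecInf_mul, vecInf_mul,
    show m + (n + 1) - 1 = m + n by ring, show m + 1 + n - 1 = m + n by ring]
  refine Prod.ext ?_ (Prod.ext ?_ ?_)
  · change ((1 : ℂ) - n) • (0 : Lau) - ((1 : ℂ) - m) • (0 : Lau) = ((m : ℂ) - n) • (0 : Lau)
    simp
  · change ((1 : ℂ) - n) • (0 : Lau) - ((1 : ℂ) - m) • (0 : Lau) = ((m : ℂ) - n) • (0 : Lau)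
    simp
  · change ((1 : ℂ) - n) • lauX (m + n - 1) - ((1 : ℂ) - m) • lauX (m + n - 1) =
      ((m : ℂ) - n) • lauX (m + n - 1)
    ext k
    simp only [HahnSeries.coeff_sub, HahnSeries.coeff_smul, smul_eq_mul]
    ring

theorem vecZero_cocycle (m n : ℤ) :
    triRes (triDer (triDer (triDer (vecZero m))) * vecZero n) =
      if m + n = 0 then (m : ℂ) ^ 3 - m else 0 := by
  rw [triRes_apply, ← single_cocycle]
  change _ + (lauDer (lauDer (lauDer 0)) * (0 : Lau)).coeff (-1) - (_ * (0 : Lau)).coeff 1 = _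
  rw [mul_zero, mul_zero]
  change _ + (0 : ℂ) - 0 = _
  rw [add_zero, sub_zero]
  rfl

theorem vecOne_cocycle (m n : ℤ) :
    triRes (triDer (triDer (triDer (vecOne m))) * vecOne n) =
      if m + n = 0 then (m : ℂ) ^ 3 - m else 0 := by
  rw [triRes_apply, ← single_cocycle]
  change (lauDer (lauDer (lauDer 0)) * (0 : Lau)).coeff (-1) + _ - (_ * (0 : Lau)).coeff 1 = _
  rw [mul_zero, mul_zero]
  change (0 : ℂ) + _ - 0 = _
  rw [zero_add, sub_zero]
  rfl

theorem vecInf_cocycle (m n : ℤ) :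
    triRes (triDer (triDer (triDer (vecInf m))) * vecInf n) =
      if m + n = 0 then (m : ℂ) ^ 3 - m else 0 := by
  simp only [vecInf_der, Derivation.map_smul, smul_mul_assoc, vecInf_mul, map_smul, triRes_apply]
  change _ * (_ * (_ * ((0 : ℂ) + 0 - (lauX _).coeff 1))) = _
  rw [lauX_coeff]
  by_cases h : m + n = 0
  · rw [if_pos (by omega), if_pos h]
    push_cast
    ring
  · rw [if_neg (by omega), if_neg h]
    ring

end GlobalFields


section HighestWeightInduction

open IsHighestWeightVector

variable {M : Type*} [AddCommGroup M] [Module ℂ M] [Module UVir M] [IsScalarTower ℂ UVir M]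
  {c h : ℂ} {v : M}

/-- A highest weight module is generated from the highest weight vector by the `L_n` with
`n < 0`. -/
theorem IsHighestWeightVector.induction_neg (hv : IsHighestWeightVector c h v)
    (T : Submodule ℂ M) (h0 : v ∈ T) (hL : ∀ n : ℤ, n < 0 → ∀ x ∈ T, uL n • x ∈ T) (x : M) :
    x ∈ T := by
  let P : Submodule ℂ M := T ⊓ sInf {T : Submodule ℂ M | v ∈ T ∧
    ∀ n : ℤ, n < 0 → ∀ x ∈ T, op M n x ∈ T}
  have hmem : ∀ y, y ∈ P ↔ ∀ T : Submodule ℂ M, v ∈ T →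
      (∀ n : ℤ, n < 0 → ∀ x ∈ T, op M n x ∈ T) → y ∈ T := by
    intro y
    constructor
    · intro hy T' h1 h2
      exact Submodule.mem_sInf.mp hy.2 T' ⟨h1, h2⟩
    · intro hy
      exact ⟨hy T h0 hL, Submodule.mem_sInf.mpr fun T' hT' => hy T' hT'.1 hT'.2⟩
  have hPv : v ∈ P := (hmem v).mpr fun T' h1 _ => h1
  have hPL : ∀ n : ℤ, n < 0 → ∀ x ∈ P, op M n x ∈ P := fun n hn x hx =>
    (hmem _).mpr fun T' h1 h2 => h2 n hn x ((hmem x).mp hx T' h1 h2)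
  have hP : ∀ x ∈ P, ∀ m : ℤ, op M m x ∈ P := by
    intro x hx
    let Q : Submodule ℂ M := P ⊓ ⨅ m : ℤ, P.comap (op M m)
    have hQ : ∀ x, x ∈ Q ↔ x ∈ P ∧ ∀ m : ℤ, op M m x ∈ P := fun x => by
      simp [Q, Submodule.mem_iInf]
    refine ((hQ x).mp ((hmem x).mp hx Q ((hQ v).mpr ⟨hPv, fun m => ?_⟩) fun n hn x hx => ?_)).2
    · rcases lt_trichotomy m 0 with hm | rfl | hm
      · exact hPL m hm v hPv
      · rw [op_apply, hv.weight]
        exact P.smul_mem _ hPv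
      · rw [op_apply, hv.pos m hm]
        exact P.zero_mem
    · rw [hQ] at hx ⊢
      refine ⟨hPL n hn x hx.1, fun m => ?_⟩
      rw [hv.op_comm]
      refine P.add_mem (hPL n hn _ (hx.2 m)) (P.add_mem (P.smul_mem _ (hx.2 _)) ?_)
      split_ifs
      · exact P.smul_mem _ hx.1
      · exact P.zero_mem
  refine (hv.induction P hPv (fun n x hx => hP x hx n) (fun x hx => ?_) x).1
  rw [hv.uC_smul]
  exact P.smul_mem _ hx

/-- A highest weight module is generated from the highest weight vector by `L_{-1}` and
`L_{-2}`. -/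
theorem IsHighestWeightVector.induction_neg_one_neg_two (hv : IsHighestWeightVector c h v)
    (T : Submodule ℂ M) (h0 : v ∈ T) (h1 : ∀ x ∈ T, uL (-1) • x ∈ T)
    (h2 : ∀ x ∈ T, uL (-2) • x ∈ T) (x : M) : x ∈ T := by
  have key : ∀ k : ℕ, ∀ x ∈ T, uL (-(k : ℤ) - 2) • x ∈ T := by
    intro k
    induction k with
    | zero => simpa using h2
    | succ k ih =>
      intro x hx
      have e := hv.op_comm (-1) (-(k : ℤ) - 2) x
      rw [if_neg (by omega), add_zero, show -1 + (-(k : ℤ) - 2) = -((k + 1 : ℕ) : ℤ) - 2 by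
        push_cast; ring] at e
      simp only [op_apply] at e
      have e2 : ((k : ℂ) + 1) • uL (-((k + 1 : ℕ) : ℤ) - 2) • x =
          uL (-1) • uL (-(k : ℤ) - 2) • x - uL (-(k : ℤ) - 2) • uL (-1) • x := by
        rw [e, add_sub_cancel_left]
        congr 1
        push_cast
        ring
      have hk : (k : ℂ) + 1 ≠ 0 := by exact_mod_cast Nat.succ_ne_zero k
      have e3 := T.smul_mem ((k : ℂ) + 1)⁻¹ (T.sub_mem (h1 _ (ih x hx)) (ih _ (h1 x hx)))
      rwa [← e2, smul_smul, inv_mul_cancel₀ hk, one_smul] at e3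
  refine hv.induction_neg T h0 (fun n hn x hx => ?_) x
  obtain rfl | hn := eq_or_lt_of_le (show n ≤ -1 by omega)
  · exact h1 x hx
  · obtain ⟨k, rfl⟩ : ∃ k : ℕ, n = -(k : ℤ) - 2 := ⟨(-2 - n).toNat, by omega⟩
    exact key k x hx

end HighestWeightInduction

section VermaLift

/-- A representation of the Virasoro algebra on which `C` acts as the scalar `c`. -/
structure VirRep (c : ℂ) (X : Type*) [AddCommGroup X] [Module ℂ X] where
  L : ℤ → Module.End ℂ X
  comm : ∀ (m n : ℤ) (x : X), L m (L n x) = L n (L m x) + (((m : ℂ) - n) • L (m + n) x +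
    (if m + n = 0 then (((m : ℂ) ^ 3 - m) / 12 * c) • x else 0))

namespace VirRep

variable {c : ℂ} {X : Type*} [AddCommGroup X] [Module ℂ X] (R : VirRep c X)

/-- The action of the Virasoro algebra as a linear map. -/
def lin : Vir →ₗ[ℂ] Module.End ℂ X :=
  (Finsupp.linearCombination ℂ R.L).comp Vir.coord +
    LinearMap.toSpanSingleton ℂ _ (c • (1 : Module.End ℂ X)) ∘ₗ Vir.ccoord

theorem lin_L (n : ℤ) : R.lin (Vir.L n) = R.L n := by
  simp [lin]

theorem lin_C : R.lin Vir.C = c • (1 : Module.End ℂ X) := by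
  simp [lin]

theorem lin_lie (x y : Vir) : R.lin ⁅x, y⁆ = R.lin x * R.lin y - R.lin y * R.lin x := by
  let B : Vir →ₗ[ℂ] Vir →ₗ[ℂ] Module.End ℂ X :=
    (LinearMap.mul ℂ (Module.End ℂ X)).compl₁₂ R.lin R.lin
  have h : Vir.bracket.compr₂ R.lin = B - B.flip := by
    refine Vir.hom_ext (fun m => Vir.hom_ext (fun n => LinearMap.ext fun a => ?_) ?_) ?_
    · have := R.comm m n a
      simp only [LinearMap.compr₂_apply, Vir.bracket_L_L, Vir.structureConst, map_add, map_smul,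
        R.lin_L, LinearMap.flip_apply, B, LinearMap.compl₁₂_apply, LinearMap.sub_apply,
        LinearMap.mul_apply', Module.End.mul_apply, LinearMap.add_apply, LinearMap.smul_apply]
      rw [this, add_sub_cancel_left]
      split_ifs
      · rw [map_smul, R.lin_C, smul_smul]
        rfl
      · rw [map_zero]
        rfl
    · simp [B, Vir.bracket_C_right, R.lin_C]
    · refine LinearMap.ext fun y => ?_
      simp [B, Vir.bracket_C_left, R.lin_C]
  exact congrArg (fun f : Vir →ₗ[ℂ] Vir →ₗ[ℂ] Module.End ℂ X => f x y) h

/-- The action of `U(vir)`. -/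
def alg : UVir →ₐ[ℂ] Module.End ℂ X :=
  UniversalEnvelopingAlgebra.lift ℂ { R.lin with map_lie' := fun {x y} => R.lin_lie x y }

theorem alg_uL (n : ℤ) : R.alg (uL n) = R.L n :=
  (UniversalEnvelopingAlgebra.lift_ι_apply ℂ _ _).trans (R.lin_L n)

theorem alg_uC : R.alg uC = c • (1 : Module.End ℂ X) :=
  (UniversalEnvelopingAlgebra.lift_ι_apply ℂ _ _).trans R.lin_C

theorem alg_vermaIdeal {h : ℂ} {x : X} (h0 : R.L 0 x = h • x)
    (hpos : ∀ n : ℤ, 0 < n → R.L n x = 0) (u : UVir) (hu : u ∈ vermaIdeal c h) :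
    R.alg u x = 0 := by
  induction hu using Submodule.span_induction with
  | mem y hy =>
    rcases hy with (rfl | rfl) | ⟨n, hn, rfl⟩
    · rw [map_sub, alg_uC, AlgHom.commutes, ← Algebra.algebraMap_eq_smul_one, sub_self]
      rfl
    · rw [map_sub, alg_uL, AlgHom.commutes, Algebra.algebraMap_eq_smul_one, LinearMap.sub_apply, h0]
      exact sub_self _
    · rw [alg_uL, hpos n hn]
  | zero =>
    rw [map_zero]
    rfl
  | add y z _ _ hy hz => rw [map_add, LinearMap.add_apply, hy, hz, add_zero]
  | smul a y _ hy => rw [smul_eq_mul, map_mul, Module.End.mul_apply, hy, map_zero]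

variable {h : ℂ} {x : X} (h0 : R.L 0 x = h • x) (hpos : ∀ n : ℤ, 0 < n → R.L n x = 0)

/-- The homomorphism from a Verma module that a highest weight vector determines. -/
def vermaLift : Verma c h →ₗ[ℂ] X :=
  ((vermaIdeal c h).restrictScalars ℂ).liftQ (LinearMap.applyₗ x ∘ₗ R.alg.toLinearMap)
      (fun u hu => R.alg_vermaIdeal h0 hpos u hu) ∘ₗ
    (Submodule.Quotient.restrictScalarsEquiv ℂ (vermaIdeal c h)).symm.toLinearMap

theorem vermaLift_smul_hwv (u : UVir) :
    R.vermaLift h0 hpos (u • Verma.hwv c h) = R.alg u x := by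
  rw [Verma.hwv, ← map_smul, smul_eq_mul, mul_one]
  rfl

theorem vermaLift_hwv : R.vermaLift h0 hpos (Verma.hwv c h) = x := by
  have := R.vermaLift_smul_hwv h0 hpos 1
  rwa [one_smul, map_one] at this

theorem vermaLift_uL (n : ℤ) (w : Verma c h) :
    R.vermaLift h0 hpos (uL n • w) = R.L n (R.vermaLift h0 hpos w) := by
  obtain ⟨u, rfl⟩ := (Verma.isHighestWeightVector c h).cyclic w
  rw [← mul_smul, vermaLift_smul_hwv, vermaLift_smul_hwv, map_mul, alg_uL]
  rfl

theorem vermaLift_commute (A : Module.End ℂ X) (hA : ∀ n y, A (R.L n y) = R.L n (A y)) {a : ℂ}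
    (ha : A x = a • x) (w : Verma c h) :
    A (R.vermaLift h0 hpos w) = a • R.vermaLift h0 hpos w := by
  let S : Submodule ℂ (Verma c h) :=
    LinearMap.ker (A ∘ₗ R.vermaLift h0 hpos - a • R.vermaLift h0 hpos)
  have hS : ∀ w, w ∈ S ↔ A (R.vermaLift h0 hpos w) = a • R.vermaLift h0 hpos w := fun w => by
    simp [S, sub_eq_zero]
  refine (hS w).mp ((Verma.isHighestWeightVector c h).induction S ?_ ?_ ?_ w)
  · rw [hS, vermaLift_hwv, ha]
  · intro n y hy
    rw [hS] at hy ⊢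
    rw [vermaLift_uL, hA, hy, map_smul]
  · intro y hy
    rw [(Verma.isHighestWeightVector c h).uC_smul]
    exact S.smul_mem _ hy

/-- The action on linear maps into a representation. -/
def postcomp (M : Type*) [AddCommGroup M] [Module ℂ M] : VirRep c (M →ₗ[ℂ] X) where
  L n := LinearMap.llcomp ℂ M X X (R.L n)
  comm m n F := by
    refine LinearMap.ext fun w => ?_
    have := R.comm m n (F w)
    simp only [LinearMap.llcomp_apply', LinearMap.comp_apply, LinearMap.add_apply,
      LinearMap.smul_apply]
    rw [this]
    split_ifs <;> rfl

end VirRep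

end VermaLift

section Coinvariants

variable (c hmid hin hout : ℂ)

/-- Conditions under which two vector fields act by commuting operators. -/
theorem blockOp_commute {s t : Tri} (h1 : s * triDer t = 0) (h2 : triDer s * t = 0)
    (h3 : triDer (triDer (triDer s)) * t = 0) (y : Blocks) :
    blockOp c hmid hin hout s (blockOp c hmid hin hout t y) =
      blockOp c hmid hin hout t (blockOp c hmid hin hout s y) := by
  rw [blockOp_comm, h1, h2, h3, sub_zero, blockOp_zero, map_zero, zero_div, zero_mul, zero_smul,
    add_zero, add_zero]

theorem vecZero_vecInf (m n : ℤ) (y : Blocks) :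
    blockOp c hmid hin hout (vecZero m) (blockOp c hmid hin hout (vecInf n) y) =
      blockOp c hmid hin hout (vecInf n) (blockOp c hmid hin hout (vecZero m) y) := by
  refine blockOp_commute _ _ _ _ ?_ ?_ ?_ y
  · refine Prod.ext ?_ (Prod.ext ?_ ?_)
    · change _ * lauDer 0 = (0 : Lau)
      rw [map_zero, mul_zero]
    · exact zero_mul _
    · exact zero_mul _
  · refine Prod.ext (mul_zero _) (Prod.ext (mul_zero _) ?_)
    change -(lauX 2 * lauDer 0) * _ = (0 : Lau)
    rw [map_zero, mul_zero, neg_zero, zero_mul]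
  · refine Prod.ext (mul_zero _) (Prod.ext (mul_zero _) ?_)
    change -(lauX 2 * lauDer (-(lauX 2 * lauDer (-(lauX 2 * lauDer 0))))) * _ = (0 : Lau)
    simp

theorem vecOne_vecInf (m n : ℤ) (y : Blocks) :
    blockOp c hmid hin hout (vecOne m) (blockOp c hmid hin hout (vecInf n) y) =
      blockOp c hmid hin hout (vecInf n) (blockOp c hmid hin hout (vecOne m) y) := by
  refine blockOp_commute _ _ _ _ ?_ ?_ ?_ y
  · refine Prod.ext ?_ (Prod.ext ?_ ?_)
    · exact zero_mul _
    · change _ * lauDer 0 = (0 : Lau)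
      rw [map_zero, mul_zero]
    · exact zero_mul _
  · refine Prod.ext (mul_zero _) (Prod.ext (mul_zero _) ?_)
    change -(lauX 2 * lauDer 0) * _ = (0 : Lau)
    rw [map_zero, mul_zero, neg_zero, zero_mul]
  · refine Prod.ext (mul_zero _) (Prod.ext (mul_zero _) ?_)
    change -(lauX 2 * lauDer (-(lauX 2 * lauDer (-(lauX 2 * lauDer 0))))) * _ = (0 : Lau)
    simp

theorem vecOne_vecZero (m n : ℤ) (y : Blocks) :
    blockOp c hmid hin hout (vecOne m) (blockOp c hmid hin hout (vecZero n) y) =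
      blockOp c hmid hin hout (vecZero n) (blockOp c hmid hin hout (vecOne m) y) := by
  refine blockOp_commute _ _ _ _ ?_ ?_ ?_ y
  · refine Prod.ext (zero_mul _) (Prod.ext ?_ (zero_mul _))
    change _ * lauDer 0 = (0 : Lau)
    rw [map_zero, mul_zero]
  · refine Prod.ext ?_ (Prod.ext (mul_zero _) (mul_zero _))
    change lauDer 0 * _ = (0 : Lau)
    rw [map_zero, zero_mul]
  · refine Prod.ext ?_ (Prod.ext (mul_zero _) (mul_zero _))
    change lauDer (lauDer (lauDer 0)) * _ = (0 : Lau)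
    simp

theorem vecZero_mem {n : ℤ} (hn : 0 ≤ n) : vecZero n ∈ triReg := by
  refine mem_triReg.mpr ⟨fun k hk => ?_, fun _ _ => rfl, fun _ _ => rfl⟩
  exact (single_coeff _ _ _).trans (if_neg (by omega))

theorem vecOne_mem {n : ℤ} (hn : 0 ≤ n) : vecOne n ∈ triReg := by
  refine mem_triReg.mpr ⟨fun _ _ => rfl, fun k hk => ?_, fun _ _ => rfl⟩
  exact (single_coeff _ _ _).trans (if_neg (by omega))

theorem vecInf_mem {n : ℤ} (hn : 0 ≤ n) : vecInf n ∈ triReg := by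
  refine mem_triReg.mpr ⟨fun _ _ => rfl, fun _ _ => rfl, fun k hk => ?_⟩
  exact (lauX_coeff _ _).trans (if_neg (by omega))

/-- The representation of the Virasoro algebra at `0`. -/
def repZero : VirRep c Blocks :=
  ⟨fun n => blockOp c hmid hin hout (vecZero n),
    blockOp_virasoro c hmid hin hout vecZero_bracket vecZero_cocycle⟩

/-- The representation of the Virasoro algebra at `1`. -/
def repOne : VirRep c Blocks :=
  ⟨fun n => blockOp c hmid hin hout (vecOne n),
    blockOp_virasoro c hmid hin hout vecOne_bracket vecOne_cocycle⟩

/-- The representation of the Virasoro algebra at `∞`. -/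
def repInf : VirRep c Blocks :=
  ⟨fun n => blockOp c hmid hin hout (vecInf n),
    blockOp_virasoro c hmid hin hout vecInf_bracket vecInf_cocycle⟩

theorem repZero_one {n : ℤ} (hn : 0 ≤ n) : (repZero c hmid hin hout).L n 1 =
    (if n = 0 then hin else 0) • (1 : Blocks) := by
  refine (blockOp_one_of_mem c hmid hin hout (vecZero_mem hn)).trans ?_
  congr 1
  change -(hin * (HahnSeries.single (n + 1) (-1) : Lau).coeff 1) - hmid * 0 + hout * 0 = _
  rw [single_coeff]
  split_ifs <;> first | omega | ring

theorem repOne_one {n : ℤ} (hn : 0 ≤ n) : (repOne c hmid hin hout).L n 1 =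
    (if n = 0 then hmid else 0) • (1 : Blocks) := by
  refine (blockOp_one_of_mem c hmid hin hout (vecOne_mem hn)).trans ?_
  congr 1
  change -(hin * 0) - hmid * (HahnSeries.single (n + 1) (-1) : Lau).coeff 1 + hout * 0 = _
  rw [single_coeff]
  split_ifs <;> first | omega | ring

theorem repInf_one {n : ℤ} (hn : 0 ≤ n) : (repInf c hmid hin hout).L n 1 =
    (if n = 0 then hout else 0) • (1 : Blocks) := by
  refine (blockOp_one_of_mem c hmid hin hout (vecInf_mem hn)).trans ?_
  congr 1
  change -(hin * 0) - hmid * 0 + hout * (lauX (n - 1)).coeff (-1) = _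
  rw [lauX_coeff]
  split_ifs <;> first | omega | ring

/-- The homomorphism at `∞`. -/
def insInf : Verma c hout →ₗ[ℂ] Blocks :=
  (repInf c hmid hin hout).vermaLift (h := hout) (x := 1)
    ((repInf_one c hmid hin hout le_rfl).trans (by rw [if_pos rfl]))
    (fun n hn => (repInf_one c hmid hin hout hn.le).trans (by rw [if_neg hn.ne', zero_smul]))

theorem repZero_insInf {n : ℤ} (hn : 0 ≤ n) (w : Verma c hout) :
    (repZero c hmid hin hout).L n (insInf c hmid hin hout w) =
      (if n = 0 then hin else 0) • insInf c hmid hin hout w :=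
  VirRep.vermaLift_commute _ _ _ _ (fun m y => vecZero_vecInf c hmid hin hout n m y)
    (repZero_one c hmid hin hout hn) w

theorem repOne_insInf {n : ℤ} (hn : 0 ≤ n) (w : Verma c hout) :
    (repOne c hmid hin hout).L n (insInf c hmid hin hout w) =
      (if n = 0 then hmid else 0) • insInf c hmid hin hout w :=
  VirRep.vermaLift_commute _ _ _ _ (fun m y => vecOne_vecInf c hmid hin hout n m y)
    (repOne_one c hmid hin hout hn) w

/-- The homomorphism at `0` and `∞`. -/
def insZero : Verma c hin →ₗ[ℂ] Verma c hout →ₗ[ℂ] Blocks :=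
  ((repZero c hmid hin hout).postcomp (Verma c hout)).vermaLift (h := hin)
    (x := insInf c hmid hin hout)
    (LinearMap.ext fun w => (repZero_insInf c hmid hin hout le_rfl w).trans (by
      rw [if_pos rfl, LinearMap.smul_apply]))
    (fun n hn => LinearMap.ext fun w => (repZero_insInf c hmid hin hout hn.le w).trans (by
      rw [if_neg hn.ne', zero_smul, LinearMap.zero_apply]))

theorem repOne_insZero {n : ℤ} (hn : 0 ≤ n) (u : Verma c hin) :
    ((repOne c hmid hin hout).postcomp (Verma c hout)).L n (insZero c hmid hin hout u) =
      (if n = 0 then hmid else 0) • insZero c hmid hin hout u :=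
  VirRep.vermaLift_commute _ _ _ _
    (fun m F => LinearMap.ext fun w => vecOne_vecZero c hmid hin hout n m (F w))
    (LinearMap.ext fun w => repOne_insInf c hmid hin hout hn w) u

/-- The homomorphism at the three points. -/
def insOne : Verma c hmid →ₗ[ℂ] Verma c hin →ₗ[ℂ] Verma c hout →ₗ[ℂ] Blocks :=
  (((repOne c hmid hin hout).postcomp (Verma c hout)).postcomp (Verma c hin)).vermaLift
    (h := hmid) (x := insZero c hmid hin hout)
    (LinearMap.ext fun w => (repOne_insZero c hmid hin hout le_rfl w).trans (by
      rw [if_pos rfl, LinearMap.smul_apply]))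
    (fun n hn => LinearMap.ext fun w => (repOne_insZero c hmid hin hout hn.le w).trans (by
      rw [if_neg hn.ne', zero_smul, LinearMap.zero_apply]))

theorem insOne_hwv : insOne c hmid hin hout (Verma.hwv c hmid) (Verma.hwv c hin)
    (Verma.hwv c hout) = 1 := by
  rw [insOne, VirRep.vermaLift_hwv, insZero, VirRep.vermaLift_hwv, insInf, VirRep.vermaLift_hwv]

theorem insOne_mid (n : ℤ) (w : Verma c hmid) (u : Verma c hin) (x : Verma c hout) :
    insOne c hmid hin hout (uL n • w) u x =
      blockOp c hmid hin hout (vecOne n) (insOne c hmid hin hout w u x) := by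
  rw [insOne, VirRep.vermaLift_uL]
  rfl

theorem insOne_in (n : ℤ) (w : Verma c hmid) (u : Verma c hin) (x : Verma c hout) :
    insOne c hmid hin hout w (uL n • u) x =
      blockOp c hmid hin hout (vecZero n) (insOne c hmid hin hout w u x) := by
  let S : Submodule ℂ (Verma c hmid) := LinearMap.ker
    ((insOne c hmid hin hout).flip (uL n • u) -
      LinearMap.llcomp ℂ _ _ _ (blockOp c hmid hin hout (vecZero n)) ∘ₗ
        (insOne c hmid hin hout).flip u)
  have hS : ∀ w, w ∈ S ↔ ∀ x, insOne c hmid hin hout w (uL n • u) x =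
      blockOp c hmid hin hout (vecZero n) (insOne c hmid hin hout w u x) := fun w => by
    rw [LinearMap.mem_ker, LinearMap.sub_apply, sub_eq_zero]
    exact LinearMap.ext_iff
  refine (hS w).mp ((Verma.isHighestWeightVector c hmid).induction S ?_ ?_ ?_ w) x
  · rw [hS]
    intro x
    rw [insOne, VirRep.vermaLift_hwv, insZero, VirRep.vermaLift_uL]
    rfl
  · intro m y hy
    rw [hS] at hy ⊢
    intro x
    rw [insOne_mid, insOne_mid, hy, vecOne_vecZero]
  · intro y hy
    rw [(Verma.isHighestWeightVector c hmid).uC_smul]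
    exact S.smul_mem _ hy

theorem insOne_out (n : ℤ) (w : Verma c hmid) (u : Verma c hin) (x : Verma c hout) :
    insOne c hmid hin hout w u (uL n • x) =
      blockOp c hmid hin hout (vecInf n) (insOne c hmid hin hout w u x) := by
  let S : Submodule ℂ (Verma c hin) := LinearMap.ker
    ((insZero c hmid hin hout).flip (uL n • x) - blockOp c hmid hin hout (vecInf n) ∘ₗ
        (insZero c hmid hin hout).flip x)
  have hS : ∀ u, u ∈ S ↔ insZero c hmid hin hout u (uL n • x) =
      blockOp c hmid hin hout (vecInf n) (insZero c hmid hin hout u x) := fun w => by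
    rw [LinearMap.mem_ker, LinearMap.sub_apply, sub_eq_zero]
    rfl
  have h0 : ∀ u, insZero c hmid hin hout u (uL n • x) =
      blockOp c hmid hin hout (vecInf n) (insZero c hmid hin hout u x) := by
    refine fun u => (hS u).mp ((Verma.isHighestWeightVector c hin).induction S ?_ ?_ ?_ u)
    · rw [hS, insZero, VirRep.vermaLift_hwv, insInf, VirRep.vermaLift_uL]
      rfl
    · intro m y hy
      rw [hS] at hy ⊢
      rw [insZero, VirRep.vermaLift_uL]
      exact (congrArg (blockOp c hmid hin hout (vecZero m)) hy).trans
        (vecZero_vecInf c hmid hin hout m n _)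
    · intro y hy
      rw [(Verma.isHighestWeightVector c hin).uC_smul]
      exact S.smul_mem _ hy
  let S' : Submodule ℂ (Verma c hmid) := LinearMap.ker
    (((insOne c hmid hin hout).flip u).flip (uL n • x) - blockOp c hmid hin hout (vecInf n) ∘ₗ
        ((insOne c hmid hin hout).flip u).flip x)
  have hS' : ∀ w, w ∈ S' ↔ insOne c hmid hin hout w u (uL n • x) =
      blockOp c hmid hin hout (vecInf n) (insOne c hmid hin hout w u x) := fun w => by
    rw [LinearMap.mem_ker, LinearMap.sub_apply, sub_eq_zero]
    rfl
  refine (hS' w).mp ((Verma.isHighestWeightVector c hmid).induction S' ?_ ?_ ?_ w)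
  · rw [hS', insOne, VirRep.vermaLift_hwv]
    exact h0 u
  · intro m y hy
    rw [hS'] at hy ⊢
    rw [insOne_mid, insOne_mid, hy, vecOne_vecInf]
  · intro y hy
    rw [(Verma.isHighestWeightVector c hmid).uC_smul]
    exact S'.smul_mem _ hy

end Coinvariants


section Smoothness

/-- The coefficients of the three series of index less than `N` vanish. -/
def TriOrd (t : Tri) (N : ℤ) : Prop := OrdGE t.1 N ∧ OrdGE t.2.1 N ∧ OrdGE t.2.2 N

theorem TriOrd.mono {t : Tri} {a b : ℤ} (ht : TriOrd t a) (h : b ≤ a) : TriOrd t b :=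
  ⟨ht.1.mono h, ht.2.1.mono h, ht.2.2.mono h⟩

theorem TriOrd.mul {s t : Tri} {a b : ℤ} (hs : TriOrd s a) (ht : TriOrd t b) :
    TriOrd (s * t) (a + b) :=
  ⟨hs.1.mul ht.1, hs.2.1.mul ht.2.1, hs.2.2.mul ht.2.2⟩

theorem TriOrd.sub {s t : Tri} {a : ℤ} (hs : TriOrd s a) (ht : TriOrd t a) : TriOrd (s - t) a :=
  ⟨hs.1.sub ht.1, hs.2.1.sub ht.2.1, hs.2.2.sub ht.2.2⟩

theorem TriOrd.der {t : Tri} {a : ℤ} (ht : TriOrd t a) : TriOrd (triDer t) (a - 1) :=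
  ⟨lauDer_ordGE ht.1, lauDer_ordGE ht.2.1, (triDer_ordGE ht.2.2).mono (by omega)⟩

theorem exists_triOrd (t : Tri) : ∃ B, TriOrd t B := by
  obtain ⟨a, ha⟩ := lau_exists_bound t.1
  obtain ⟨b, hb⟩ := lau_exists_bound t.2.1
  obtain ⟨d, hd⟩ := lau_exists_bound t.2.2
  exact ⟨min a (min b d), fun n hn => ha n (by omega), fun n hn => hb n (by omega),
    fun n hn => hd n (by omega)⟩

variable (c hmid hin hout : ℂ)

theorem ι_mul_eq_blockOp (x : globalVec) (y : Blocks) :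
    UniversalEnvelopingAlgebra.ι ℂ x * y = blockOp c hmid hin hout (x : TriVec).1 y := by
  rw [← inducedOp_coe globalProj_coe (hwChar_coe c hmid hin hout) x y, blockOp]
  congr 2
  exact Prod.ext rfl x.2.2

theorem blockOp_smooth (y : Blocks) :
    ∃ N : ℕ, ∀ t, TriOrd t N → blockOp c hmid hin hout t y = 0 := by
  let S : Submodule ℂ Blocks :=
    { carrier := {y | ∃ N : ℕ, ∀ t, TriOrd t N → blockOp c hmid hin hout t y = 0}
      add_mem' := fun {a b} ⟨N, hN⟩ ⟨K, hK⟩ => ⟨N + K, fun t ht => by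
        rw [map_add, hN t (ht.mono (by omega)), hK t (ht.mono (by omega)), add_zero]⟩
      zero_mem' := ⟨0, fun t _ => map_zero _⟩
      smul_mem' := fun r a ⟨N, hN⟩ => ⟨N, fun t ht => by rw [map_smul, hN t ht, smul_zero]⟩ }
  refine universalEnveloping_induction S ⟨2, fun t ht => ?_⟩ ?_ y
  · rw [blockOp_one_of_mem c hmid hin hout
      ⟨ht.1.mono (by norm_num), ht.2.1.mono (by norm_num), ht.2.2.mono (by norm_num)⟩,
      ht.1 1 (by norm_num), ht.2.1 1 (by norm_num), ht.2.2 (-1) (by norm_num)]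
    simp
  · rintro x y ⟨N, hN⟩
    obtain ⟨B, hB⟩ := exists_triOrd (x : TriVec).1
    refine ⟨N + B.natAbs + 5, fun t ht => ?_⟩
    have h3 : TriOrd (triDer (triDer (triDer t)) * (x : TriVec).1) 2 :=
      (ht.der.der.der.mul hB).mono (by omega)
    rw [ι_mul_eq_blockOp c hmid hin hout, blockOp_comm, hN t (ht.mono (by omega)), map_zero,
      hN _ (((ht.mul hB.der).mono (by omega)).sub ((ht.der.mul hB).mono (by omega))),
      triRes_apply, h3.1 _ (by norm_num), h3.2.1 _ (by norm_num), h3.2.2 _ (by norm_num)]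
    simp

theorem OrdGE.sub_truncation {g : Lau} {a : ℤ} (hg : OrdGE g a) (M : ℕ) :
    OrdGE (g - ∑ i ∈ Finset.range M, g.coeff (a + i) • lauX (a + i)) (a + M) := by
  intro n hn
  have hsum : ∀ s : Finset ℕ, (∑ i ∈ s, g.coeff (a + i) • lauX (a + i)).coeff n =
      ∑ i ∈ s, g.coeff (a + i) * (if n = a + i then 1 else 0) := by
    intro s
    induction s using Finset.induction_on with
    | empty => rfl
    | insert i s hi ih =>
      rw [Finset.sum_insert hi, Finset.sum_insert hi, HahnSeries.coeff_add, ih,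
        HahnSeries.coeff_smul, lauX_coeff, smul_eq_mul]
  rw [HahnSeries.coeff_sub, hsum]
  by_cases h : n < a
  · rw [hg n h, Finset.sum_eq_zero fun i _ => by rw [if_neg (by omega), mul_zero], sub_zero]
  · rw [Finset.sum_eq_single (n - a).toNat, if_pos (by omega), mul_one,
      show a + ((n - a).toNat : ℤ) = n by omega, sub_self]
    · intro i _ hi
      rw [if_neg (by omega), mul_zero]
    · intro hi
      rw [Finset.mem_range] at hi
      omega

/-- The action on a fixed vector as a linear map. -/
def blockOpLin (y : Blocks) : Tri →ₗ[ℂ] Blocks where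
  toFun t := blockOp c hmid hin hout t y
  map_add' s t := blockOp_add c hmid hin hout s t y
  map_smul' r t := blockOp_smul c hmid hin hout r t y

theorem blockOp_eq_finsum {E : Lau →ₗ[ℂ] Tri} (hE : ∀ {g N}, OrdGE g N → 0 ≤ N → TriOrd (E g) N)
    {g : Lau} {a : ℤ} (hg : OrdGE g a) (y : Blocks) :
    (∃ N : ℕ, ∀ i : ℕ, N ≤ i → blockOp c hmid hin hout (E (lauX (a + i))) y = 0) ∧
    blockOp c hmid hin hout (E g) y =
      ∑ᶠ i : ℕ, g.coeff (a + i) • blockOp c hmid hin hout (E (lauX (a + i))) y := by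
  obtain ⟨N, hN⟩ := blockOp_smooth c hmid hin hout y
  have hv : ∀ i : ℕ, N + a.natAbs ≤ i → blockOp c hmid hin hout (E (lauX (a + i))) y = 0 :=
    fun i hi => hN _ ((hE (lauX_ordGE _) (by omega)).mono (by omega))
  refine ⟨⟨_, hv⟩, ?_⟩
  rw [finsum_eq_range (N := N + a.natAbs) fun i hi => by rw [hv i hi, smul_zero]]
  have h := hN _ ((hE (hg.sub_truncation (N + a.natAbs)) (by omega)).mono (by omega))
  rw [map_sub, map_sum] at h
  change blockOpLin c hmid hin hout y _ = 0 at h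
  rw [map_sub, map_sum, sub_eq_zero] at h
  refine h.trans (Finset.sum_congr rfl fun i _ => ?_)
  rw [map_smul, map_smul]
  rfl

/-- The embedding of the Laurent series at `0`. -/
def atZero : Lau →ₗ[ℂ] Tri := LinearMap.inl ℂ Lau (Lau × Lau)

/-- The embedding of the Laurent series at `1`. -/
def atOne : Lau →ₗ[ℂ] Tri := LinearMap.inr ℂ Lau (Lau × Lau) ∘ₗ LinearMap.inl ℂ Lau Lau

/-- The embedding of the Laurent series at `∞`. -/
def atInf : Lau →ₗ[ℂ] Tri := LinearMap.inr ℂ Lau (Lau × Lau) ∘ₗ LinearMap.inr ℂ Lau Lau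

theorem atZero_lauX (n : ℤ) : atZero (lauX n) = (-1 : ℂ) • vecZero (n - 1) := by
  refine Prod.ext ?_ (Prod.ext (smul_zero _).symm (smul_zero _).symm)
  change lauX n = (-1 : ℂ) • (HahnSeries.single (n - 1 + 1) (-1) : Lau)
  ext k
  rw [HahnSeries.coeff_smul, single_coeff, lauX_coeff, sub_add_cancel]
  split_ifs <;> simp

theorem atOne_lauX (n : ℤ) : atOne (lauX n) = (-1 : ℂ) • vecOne (n - 1) := by
  refine Prod.ext (smul_zero _).symm (Prod.ext ?_ (smul_zero _).symm)
  change lauX n = (-1 : ℂ) • (HahnSeries.single (n - 1 + 1) (-1) : Lau)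
  ext k
  rw [HahnSeries.coeff_smul, single_coeff, lauX_coeff, sub_add_cancel]
  split_ifs <;> simp

theorem atInf_lauX (n : ℤ) : atInf (lauX n) = vecInf (n + 1) := by
  rw [vecInf, add_sub_cancel_right]
  rfl

theorem eq_atZero_add_atOne_add_atInf (t : Tri) :
    t = atZero t.1 + atOne t.2.1 + atInf t.2.2 := by
  refine Prod.ext ?_ (Prod.ext ?_ ?_)
  · change t.1 = t.1 + 0 + 0
    rw [add_zero, add_zero]
  · change t.2.1 = 0 + t.2.1 + 0
    rw [add_zero, zero_add]
  · change t.2.2 = 0 + 0 + t.2.2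
    rw [add_zero, zero_add]

/-- The augmentation. -/
def augmentation : Blocks →ₐ[ℂ] ℂ := UniversalEnvelopingAlgebra.lift ℂ (0 : globalVec →ₗ⁅ℂ⁆ ℂ)

theorem augmentation_ι_mul (x : globalVec) (y : Blocks) :
    augmentation (UniversalEnvelopingAlgebra.ι ℂ x * y) = 0 := by
  rw [map_mul, augmentation, UniversalEnvelopingAlgebra.lift_ι_apply, LieHom.zero_apply, zero_mul]

/-- The three point function. -/
def threePoint : Verma c hmid →ₗ[ℂ] Verma c hin →ₗ[ℂ] Verma c hout →ₗ[ℂ] ℂ :=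
  (insOne c hmid hin hout).compr₂ (LinearMap.llcomp ℂ (Verma c hout) Blocks ℂ
    augmentation.toLinearMap)

theorem threePoint_apply (w : Verma c hmid) (u : Verma c hin) (x : Verma c hout) :
    threePoint c hmid hin hout w u x = augmentation (insOne c hmid hin hout w u x) := rfl

theorem threePoint_hwv : threePoint c hmid hin hout (Verma.hwv c hmid) (Verma.hwv c hin)
    (Verma.hwv c hout) = 1 := by
  rw [threePoint_apply, insOne_hwv, map_one]

theorem map_finsum_of_bounded {A B : Type*} [AddCommGroup A] [Module ℂ A] [AddCommGroup B]
    [Module ℂ B] (f : A →ₗ[ℂ] B) {g : ℕ → A} (hg : ∃ N : ℕ, ∀ i, N ≤ i → g i = 0) :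
    f (∑ᶠ i, g i) = ∑ᶠ i, f (g i) := by
  obtain ⟨N, hN⟩ := hg
  rw [finsum_eq_range hN, finsum_eq_range (N := N) fun i hi => by rw [hN i hi, map_zero], map_sum]

/-- The Ward identity of a vector field with poles at `0`, `1`, `∞`. -/
theorem ward {f : Tri} (hf : f ∈ triFun) {a0 a1 ai : ℤ} (h0 : OrdGE f.1 a0) (h1 : OrdGE f.2.1 a1)
    (hi : OrdGE f.2.2 ai) (w : Verma c hmid) (u : Verma c hin) (x : Verma c hout) :
    ∑ᶠ i : ℕ, f.2.1.coeff (a1 + i) * threePoint c hmid hin hout (uL (a1 + i - 1) • w) u x +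
      ∑ᶠ i : ℕ, f.1.coeff (a0 + i) * threePoint c hmid hin hout w (uL (a0 + i - 1) • u) x =
      ∑ᶠ i : ℕ, f.2.2.coeff (ai + i) * threePoint c hmid hin hout w u (uL (ai + i + 1) • x) := by
  obtain ⟨z, hz⟩ := blockOp_of_mem c hmid hin hout hf (insOne c hmid hin hout w u x)
  have h := augmentation_ι_mul z (insOne c hmid hin hout w u x)
  set y := insOne c hmid hin hout w u x with hy
  obtain ⟨⟨N0, e0⟩, s0⟩ := blockOp_eq_finsum c hmid hin hout (E := atZero)
    (fun hg _ => ⟨hg, OrdGE.zero _, OrdGE.zero _⟩) h0 y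
  obtain ⟨⟨N1, e1⟩, s1⟩ := blockOp_eq_finsum c hmid hin hout (E := atOne)
    (fun hg _ => ⟨OrdGE.zero _, hg, OrdGE.zero _⟩) h1 y
  obtain ⟨⟨Ni, ei⟩, si⟩ := blockOp_eq_finsum c hmid hin hout (E := atInf)
    (fun hg _ => ⟨OrdGE.zero _, OrdGE.zero _, hg⟩) hi y
  rw [← hz, eq_atZero_add_atOne_add_atInf f, blockOp_add, blockOp_add, s0, s1, si, map_add,
    map_add] at h
  have m0 := map_finsum_of_bounded augmentation.toLinearMap
    (g := fun i : ℕ => f.1.coeff (a0 + i) • blockOp c hmid hin hout (atZero (lauX (a0 + i))) y)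
    ⟨N0, fun i hi => by rw [e0 i hi, smul_zero]⟩
  have m1 := map_finsum_of_bounded augmentation.toLinearMap
    (g := fun i : ℕ => f.2.1.coeff (a1 + i) • blockOp c hmid hin hout (atOne (lauX (a1 + i))) y)
    ⟨N1, fun i hi => by rw [e1 i hi, smul_zero]⟩
  have mi := map_finsum_of_bounded augmentation.toLinearMap
    (g := fun i : ℕ => f.2.2.coeff (ai + i) • blockOp c hmid hin hout (atInf (lauX (ai + i))) y)
    ⟨Ni, fun i hi => by rw [ei i hi, smul_zero]⟩
  have r0 : ∀ i : ℕ, augmentation.toLinearMap (f.1.coeff (a0 + i) •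
      blockOp c hmid hin hout (atZero (lauX (a0 + i))) y) = -(f.1.coeff (a0 + i) *
        threePoint c hmid hin hout w (uL (a0 + i - 1) • u) x) := fun i => by
    rw [atZero_lauX, blockOp_smul, hy, ← insOne_in, map_smul, map_smul, threePoint_apply]
    simp
  have r1 : ∀ i : ℕ, augmentation.toLinearMap (f.2.1.coeff (a1 + i) •
      blockOp c hmid hin hout (atOne (lauX (a1 + i))) y) = -(f.2.1.coeff (a1 + i) *
        threePoint c hmid hin hout (uL (a1 + i - 1) • w) u x) := fun i => by
    rw [atOne_lauX, blockOp_smul, hy, ← insOne_mid, map_smul, map_smul, threePoint_apply]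
    simp
  have ri : ∀ i : ℕ, augmentation.toLinearMap (f.2.2.coeff (ai + i) •
      blockOp c hmid hin hout (atInf (lauX (ai + i))) y) = f.2.2.coeff (ai + i) *
        threePoint c hmid hin hout w u (uL (ai + i + 1) • x) := fun i => by
    rw [atInf_lauX, hy, ← insOne_out, map_smul, threePoint_apply]
    simp
  simp only [r0, finsum_neg_distrib] at m0
  simp only [r1, finsum_neg_distrib] at m1
  simp only [ri] at mi
  change augmentation.toLinearMap _ + augmentation.toLinearMap _ + augmentation.toLinearMap _ = 0
    at h
  rw [m0, m1, mi] at h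
  linear_combination -h

end Smoothness


section FieldFormulas

variable {c : ℂ} {W : Type*} [AddCommGroup W] [Module ℂ W]

theorem bin_neg_one (j : ℕ) : bin (-1) j = (-1) ^ j := by
  induction j with
  | zero => simp
  | succ j ih =>
    have h := bin_succ 0 j
    rw [zero_sub, ih, bin, Ring.choose_zero_pos ℤ (Nat.succ_pos j)] at h
    rw [pow_succ]
    linarith

theorem finsum_eq_add_finsum_succ {W : Type*} [AddCommGroup W] {f : ℕ → W} (hf : ∃ N : ℕ, ∀ j,
    N ≤ j → f j = 0) :
    ∑ᶠ j, f j = f 0 + ∑ᶠ j, f (j + 1) := by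
  obtain ⟨N, hN⟩ := hf
  rw [finsum_eq_range (N := N + 1) fun i hi => hN i (by omega), Finset.sum_range_succ',
    finsum_eq_range (N := N) fun i hi => hN _ (by omega), add_comm]

namespace SmoothRep

variable (R : SmoothRep c W)

theorem fieldOp_neg_two_apply (a : fields W) (k : ℤ) (w : W) :
    (R.fieldOp (-2) a).1 k w = (∑ᶠ j : ℕ, R.L (-2 - j) (a.1 (k + j) w)) +
      ∑ᶠ j : ℕ, a.1 (k - 1 - j) (R.L (j - 1) w) := by
  change (∑ᶠ j : ℕ, (lc (-2) j • (R.L (-2 - j) ∘ₗ a.1 (k + j))) w) -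
    (∑ᶠ j : ℕ, (rc (-2) j • (a.1 (k + -2 + 1 - j) ∘ₗ R.L ((j : ℤ) - 1))) w) = _
  rw [sub_eq_add_neg, ← finsum_neg_distrib]
  congr 1
  · refine finsum_congr fun j => ?_
    rw [lc, show (-2 : ℤ) + 1 = -1 by norm_num, bin_neg_one]
    push_cast
    rw [← mul_pow]
    norm_num
  · refine finsum_congr fun j => ?_
    rw [rc, neg_one_zpow_sub_natCast, show (-2 : ℤ) + 1 = -1 by norm_num, bin_neg_one,
      show k + -2 + 1 - (j : ℤ) = k - 1 - j by ring]
    push_cast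
    rw [mul_assoc, ← mul_pow]
    norm_num

theorem fieldOp_one_apply (a : fields W) (k : ℤ) (w : W) :
    (R.fieldOp 1 a).1 k w = (R.L 1 (a.1 k w) - a.1 k (R.L 1 w)) -
      (2 : ℂ) • (R.L 0 (a.1 (k + 1) w) - a.1 (k + 1) (R.L 0 w)) +
      (R.L (-1) (a.1 (k + 2) w) - a.1 (k + 2) (R.L (-1) w)) := by
  change R.left 1 a k w - R.right 1 a k w = _
  have hb : ∀ j : ℕ, 3 ≤ j → bin 2 j = 0 := fun j hj => by
    have h := Ring.choose_natCast (R := ℤ) 2 j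
    rw [Nat.choose_eq_zero_of_lt hj] at h
    simpa using h
  have h1 : bin 2 1 = 2 := Ring.choose_one_right 2
  have h2 : bin 2 2 = 1 := by
    have h := Ring.choose_natCast (R := ℤ) 2 2
    simpa using h
  have hl : R.left 1 a k w = R.L 1 (a.1 k w) - (2 : ℂ) • R.L 0 (a.1 (k + 1) w) +
      R.L (-1) (a.1 (k + 2) w) := by
    refine (finsum_eq_range (N := 3) fun j hj => ?_).trans ?_
    · simp [lc, hb j hj]
    · simp [Finset.sum_range_succ, lc, sub_eq_add_neg, h1, h2]
  have hr : R.right 1 a k w = a.1 k (R.L 1 w) - (2 : ℂ) • a.1 (k + 1) (R.L 0 w) +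
      a.1 (k + 2) (R.L (-1) w) := by
    refine (finsum_eq_range (N := 3) fun j hj => ?_).trans ?_
    · simp [rc, hb j hj]
    · simp [Finset.sum_range_succ, rc, h1, h2]
      rw [show k + 1 + 1 - 2 = k by ring, show k + 1 + 1 = k + 2 by ring]
      module
  rw [hl, hr]
  module

theorem fieldOp_combination (a : fields W) (p : ℤ) (w : W) :
    (R.fieldOp (-2) a).1 p w + (3 : ℂ) • (R.fieldOp (-1) a).1 (p - 1) w +
      (3 : ℂ) • (R.fieldOp 0 a).1 (p - 2) w + (R.fieldOp 1 a).1 (p - 3) w =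
      (∑ᶠ j : ℕ, R.L (1 - j) (a.1 (p - 3 + j) w)) +
        ∑ᶠ j : ℕ, a.1 (p - 4 - j) (R.L (j + 2) w) := by
  obtain ⟨N, hN⟩ := a.2 w
  obtain ⟨K, hK⟩ := R.smooth w
  rw [fieldOp_neg_two_apply, fieldOp_neg_one_apply, fieldOp_zero_apply, fieldOp_neg_one_apply,
    fieldOp_one_apply,
    finsum_eq_add_finsum_succ (f := fun j : ℕ => R.L (1 - j) (a.1 (p - 3 + j) w))
      ⟨N + p.natAbs + 4, fun j hj => by rw [hN _ (by omega), map_zero]⟩,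
    finsum_eq_add_finsum_succ
      (f := fun j : ℕ => R.L (1 - ((j + 1 : ℕ) : ℤ)) (a.1 (p - 3 + ((j + 1 : ℕ) : ℤ)) w))
      ⟨N + p.natAbs + 4, fun j hj => by rw [hN _ (by omega), map_zero]⟩,
    finsum_eq_add_finsum_succ
      (f := fun j : ℕ => R.L (1 - ((j + 1 + 1 : ℕ) : ℤ)) (a.1 (p - 3 + ((j + 1 + 1 : ℕ) : ℤ)) w))
      ⟨N + p.natAbs + 4, fun j hj => by rw [hN _ (by omega), map_zero]⟩,
    finsum_eq_add_finsum_succ (f := fun j : ℕ => a.1 (p - 1 - j) (R.L (j - 1) w))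
      ⟨K + 4, fun j hj => by rw [hK _ (by omega), map_zero]⟩,
    finsum_eq_add_finsum_succ
      (f := fun j : ℕ => a.1 (p - 1 - ((j + 1 : ℕ) : ℤ)) (R.L (((j + 1 : ℕ) : ℤ) - 1) w))
      ⟨K + 4, fun j hj => by rw [hK _ (by omega), map_zero]⟩,
    finsum_eq_add_finsum_succ
      (f := fun j : ℕ => a.1 (p - 1 - ((j + 1 + 1 : ℕ) : ℤ)) (R.L (((j + 1 + 1 : ℕ) : ℤ) - 1) w))
      ⟨K + 4, fun j hj => by rw [hK _ (by omega), map_zero]⟩]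
  have e1 : ∀ j : ℕ, R.L (1 - ((j + 1 + 1 + 1 : ℕ) : ℤ)) (a.1 (p - 3 + ((j + 1 + 1 + 1 : ℕ) : ℤ)) w)
      = R.L (-2 - j) (a.1 (p + j) w) := fun j => by
    rw [show 1 - ((j + 1 + 1 + 1 : ℕ) : ℤ) = -2 - j by push_cast; ring,
      show p - 3 + ((j + 1 + 1 + 1 : ℕ) : ℤ) = p + j by push_cast; ring]
  have e2 : ∀ j : ℕ, a.1 (p - 1 - ((j + 1 + 1 + 1 : ℕ) : ℤ)) (R.L (((j + 1 + 1 + 1 : ℕ) : ℤ) - 1) w)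
      = a.1 (p - 4 - j) (R.L (j + 2) w) := fun j => by
    rw [show p - 1 - ((j + 1 + 1 + 1 : ℕ) : ℤ) = p - 4 - j by push_cast; ring,
      show ((j + 1 + 1 + 1 : ℕ) : ℤ) - 1 = j + 2 by push_cast; ring]
  simp only [e1, e2]
  norm_num
  rw [show p - 3 + 1 = p - 2 by ring, show p - 3 + 2 = p - 1 by ring,
    show p - 2 + 1 = p - 1 by ring,
    show p - 1 - 1 = p - 2 by ring, show p - 1 - 2 = p - 3 by ring]
  module

end SmoothRep

end FieldFormulas

section DividedPowers

open IsHighestWeightVector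

/-- The divided powers `L_1^i / i!` on `V_c`, equal to zero for `i < 0`. -/
def divPow (c : ℂ) (i : ℤ) : Module.End ℂ (Vc c) :=
  if 0 ≤ i then ((i.toNat.factorial : ℂ)⁻¹) • op (Vc c) 1 ^ i.toNat else 0

variable {c : ℂ}

theorem divPow_natCast (i : ℕ) : divPow c i = ((i.factorial : ℂ)⁻¹) • op (Vc c) 1 ^ i := by
  rw [divPow, if_pos (by omega), Int.toNat_natCast]

theorem divPow_neg {i : ℤ} (hi : i < 0) : divPow c i = 0 := by
  rw [divPow, if_neg (by omega)]

theorem divPow_succ (i : ℤ) (v : Vc c) :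
    uL 1 • divPow c i v = ((i : ℂ) + 1) • divPow c (i + 1) v := by
  rcases lt_trichotomy i (-1) with h | rfl | h
  · rw [divPow_neg (by omega), divPow_neg (by omega), LinearMap.zero_apply, smul_zero, smul_zero]
  · rw [divPow_neg (by omega), LinearMap.zero_apply, smul_zero]
    norm_num
  · obtain ⟨k, rfl⟩ := Int.eq_ofNat_of_zero_le (show 0 ≤ i by omega)
    rw [show (k : ℤ) + 1 = ((k + 1 : ℕ) : ℤ) by push_cast; rfl, divPow_natCast, divPow_natCast,
      LinearMap.smul_apply, LinearMap.smul_apply, ← op_apply, map_smul, smul_smul, pow_succ',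
      Module.End.mul_apply, Nat.factorial_succ]
    congr 1
    have hk : (k : ℂ) + 1 ≠ 0 := by exact_mod_cast Nat.succ_ne_zero k
    have hf : (k.factorial : ℂ) ≠ 0 := by exact_mod_cast Nat.factorial_ne_zero k
    push_cast
    field_simp

theorem divPow_eq_zero {d : ℕ} {v : Vc c} (hv : v ∈ Vgr c d) {i : ℤ} (hi : i < 0 ∨ d < i) :
    divPow c i v = 0 := by
  rcases hi with hi | hi
  · rw [divPow_neg hi, LinearMap.zero_apply]
  · obtain ⟨k, rfl⟩ := Int.eq_ofNat_of_zero_le (show 0 ≤ i by omega)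
    rw [divPow_natCast, LinearMap.smul_apply, uL_one_pow_eq_zero hv (by omega), smul_zero]

theorem divPow_weight {d : ℕ} {v : Vc c} (hv : v ∈ Vgr c d) (i : ℤ) :
    uL 0 • divPow c i v = ((d : ℂ) - i) • divPow c i v := by
  by_cases hi : i < 0
  · rw [divPow_neg hi, LinearMap.zero_apply, smul_zero, smul_zero]
  · obtain ⟨k, rfl⟩ := Int.eq_ofNat_of_zero_le (show 0 ≤ i by omega)
    rw [divPow_natCast, LinearMap.smul_apply, ← op_apply, map_smul, op_apply,
      uL_one_pow_weight hv, smul_comm]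
    simp

theorem uL_one_uL (n : ℤ) (x : Vc c) :
    uL 1 • uL n • x = uL n • uL 1 • x + ((1 : ℂ) - n) • uL (1 + n) • x := by
  have h := (vacuum_isHighestWeightVector c).op_comm 1 n x
  simp only [op_apply] at h
  rw [h]
  congr 1
  push_cast
  norm_num

theorem uL_smul_smul (n : ℤ) (r : ℂ) (x : Vc c) : uL n • r • x = r • uL n • x :=
  map_smul (op (Vc c) n) r x

theorem divPow_zero : divPow c 0 = 1 := by
  have := divPow_natCast (c := c) 0
  simpa using this

theorem divPow_uL_neg_one (v : Vc c) (i : ℤ) : divPow c i (uL (-1) • v) =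
    uL (-1) • divPow c i v + (2 : ℂ) • uL 0 • divPow c (i - 1) v +
      uL 1 • divPow c (i - 2) v := by
  by_cases hi : i < 0
  · rw [divPow_neg hi, divPow_neg (by omega), divPow_neg (by omega)]
    simp
  · obtain ⟨k, rfl⟩ := Int.eq_ofNat_of_zero_le (show 0 ≤ i by omega)
    clear hi
    induction k with
    | zero =>
      rw [Nat.cast_zero, divPow_zero, divPow_neg (by omega), divPow_neg (by omega)]
      simp
    | succ k ih =>
      have hk : ((k : ℤ) : ℂ) + 1 ≠ 0 := by exact_mod_cast Nat.succ_ne_zero k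
      refine smul_right_injective _ hk ?_
      have s1 := divPow_succ (k : ℤ) v
      have s2 := divPow_succ (k - 1 : ℤ) v
      have s3 := divPow_succ (k - 2 : ℤ) v
      rw [sub_add_cancel] at s2
      rw [show (k : ℤ) - 2 + 1 = k - 1 by ring] at s3
      push_cast at s1 s2 s3 ⊢
      rw [show ((k : ℤ) + 1 - 1 : ℤ) = k by ring, show ((k : ℤ) + 1 - 2 : ℤ) = k - 1 by ring,
        show ((k : ℂ) + 1) = ((k : ℤ) : ℂ) + 1 by push_cast; rfl, ← divPow_succ, ih]
      simp only [smul_add, uL_smul_smul, uL_one_uL, s1, s2, s3]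
      norm_num
      simp only [s2, ← op_apply]
      module

theorem divPow_uL_neg_two (v : Vc c) (i : ℤ) : divPow c i (uL (-2) • v) =
    uL (-2) • divPow c i v + (3 : ℂ) • uL (-1) • divPow c (i - 1) v +
      (3 : ℂ) • uL 0 • divPow c (i - 2) v + uL 1 • divPow c (i - 3) v := by
  by_cases hi : i < 0
  · rw [divPow_neg hi, divPow_neg (by omega), divPow_neg (by omega), divPow_neg (by omega)]
    simp
  · obtain ⟨k, rfl⟩ := Int.eq_ofNat_of_zero_le (show 0 ≤ i by omega)
    clear hi
    induction k with
    | zero =>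
      rw [Nat.cast_zero, divPow_zero, divPow_neg (by omega), divPow_neg (by omega),
        divPow_neg (by omega)]
      simp
    | succ k ih =>
      have hk : ((k : ℤ) : ℂ) + 1 ≠ 0 := by exact_mod_cast Nat.succ_ne_zero k
      refine smul_right_injective _ hk ?_
      have s1 := divPow_succ (k : ℤ) v
      have s2 := divPow_succ (k - 1 : ℤ) v
      have s3 := divPow_succ (k - 2 : ℤ) v
      have s4 := divPow_succ (k - 3 : ℤ) v
      rw [sub_add_cancel] at s2
      rw [show (k : ℤ) - 2 + 1 = k - 1 by ring] at s3
      rw [show (k : ℤ) - 3 + 1 = k - 2 by ring] at s4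
      push_cast at s1 s2 s3 s4 ⊢
      rw [show ((k : ℤ) + 1 - 1 : ℤ) = k by ring, show ((k : ℤ) + 1 - 2 : ℤ) = k - 1 by ring,
        show ((k : ℤ) + 1 - 3 : ℤ) = k - 2 by ring,
        show ((k : ℂ) + 1) = ((k : ℤ) : ℂ) + 1 by push_cast; rfl, ← divPow_succ, ih]
      simp only [smul_add, uL_smul_smul, uL_one_uL, s1, s2, s3, s4]
      norm_num
      simp only [s3, ← op_apply]
      module

end DividedPowers


section OppositeModes

open IsHighestWeightVector

namespace SmoothRep

variable {c : ℂ} {W : Type*} [AddCommGroup W] [Module ℂ W] (R : SmoothRep c W)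

theorem divPow_support {d : ℕ} {v : Vc c} (hv : v ∈ Vgr c d) {X : Type*} [AddCommGroup X]
    [Module ℂ X] (f : ℤ → Vc c →ₗ[ℂ] X) (s : ℤ) :
    (Function.support fun i : ℤ => f i (divPow c (i - s) v)).Finite := by
  refine (Set.finite_Icc s (s + d)).subset fun i hi => ?_
  by_contra h
  refine hi ?_
  dsimp only
  rw [divPow_eq_zero hv, map_zero]
  rw [Set.mem_Icc] at h
  omega

/-- The mode `n` of `Y(v, z)`, as a linear function of `v` and at a fixed vector `w`. -/
def modeAt (n : ℤ) (w : W) : Vc c →ₗ[ℂ] W :=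
  LinearMap.applyₗ w ∘ₗ LinearMap.proj n ∘ₗ (fields W).subtype ∘ₗ R.Y

theorem modeAt_apply (n : ℤ) (w : W) (v : Vc c) : R.modeAt n w v = (R.Y v).1 n w := rfl

theorem modeAt_smul (n : ℤ) (w : W) (r : ℂ) (v : Vc c) :
    R.modeAt n w (r • v) = r • R.modeAt n w v := map_smul _ _ _

/-- The coefficients of `Y(e^{z L_1} v, z⁻¹)`. -/
def expMode (q : ℤ) (v : Vc c) (w : W) : W := ∑ᶠ i : ℤ, R.modeAt (q - i) w (divPow c i v)

theorem oppositeMode_eq {d : ℕ} {v : Vc c} (hv : v ∈ Vgr c d) (n : ℤ) (w : W) :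
    R.oppositeMode d n v w = (-1 : ℂ) ^ d • R.expMode (2 * d - n - 2) v w := by
  rw [oppositeMode_apply, expMode, finsum_eq_sum_of_support_subset
    (s := (Finset.range (d + 1)).map Nat.castEmbedding), Finset.sum_map, LinearMap.smul_apply,
    LinearMap.sum_apply]
  · congr 1
    refine Finset.sum_congr rfl fun i _ => ?_
    rw [Nat.castEmbedding_apply, divPow_natCast, LinearMap.smul_apply, LinearMap.smul_apply,
      map_smul, modeAt_apply, show 2 * (d : ℤ) - n - 2 - i = 2 * (d : ℤ) - i - n - 2 by ring]
  · intro i hi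
    by_contra h
    refine hi ?_
    dsimp only
    rw [divPow_eq_zero hv, map_zero]
    by_contra h2
    refine h (Finset.mem_coe.mpr (Finset.mem_map.mpr ⟨i.toNat, ?_, ?_⟩))
    · rw [Finset.mem_range]
      omega
    · rw [Nat.castEmbedding_apply]
      omega

theorem finsum_shift {X : Type*} [AddCommGroup X] (f : ℤ → X) (s : ℤ) :
    ∑ᶠ i, f (i - s) = ∑ᶠ i, f i :=
  finsum_comp_equiv (Equiv.subRight s)

theorem uL_neg_one_mem {d : ℕ} {v : Vc c} (hv : v ∈ Vgr c d) : uL (-1) • v ∈ Vgr c (d + 1) := by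
  have h := op_weight (vacuum_isHighestWeightVector c) (-1) hv
  rw [show (d : ℂ) - ((-1 : ℤ) : ℂ) = ((d + 1 : ℕ) : ℂ) by push_cast; ring] at h
  exact h

theorem uL_neg_two_mem {d : ℕ} {v : Vc c} (hv : v ∈ Vgr c d) : uL (-2) • v ∈ Vgr c (d + 2) := by
  have h := op_weight (vacuum_isHighestWeightVector c) (-2) hv
  rw [show (d : ℂ) - ((-2 : ℤ) : ℂ) = ((d + 2 : ℕ) : ℂ) by push_cast; ring] at h
  exact h

theorem oppositeMode_uL_neg_one {d : ℕ} {v : Vc c} (hv : v ∈ Vgr c d) (n : ℤ) (w : W) :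
    R.oppositeMode (d + 1) n (uL (-1) • v) w = (-(n : ℂ)) • R.oppositeMode d (n - 1) v w := by
  rw [R.oppositeMode_eq (uL_neg_one_mem hv), R.oppositeMode_eq hv]
  have key : R.expMode (2 * (d + 1 : ℕ) - n - 2) (uL (-1) • v) w =
      (n : ℂ) • R.expMode (2 * d - (n - 1) - 2) v w := by
    set q : ℤ := 2 * (d + 1 : ℕ) - n - 2 with hq
    have e1 : ∀ i : ℤ, R.modeAt (q - i) w (divPow c i (uL (-1) • v)) =
        ((i : ℂ) - q) • R.modeAt (q - 1 - i) w (divPow c i v) +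
          ((2 : ℂ) * (d - ((i - 1 : ℤ) : ℂ)) + ((i - 1 : ℤ) : ℂ)) •
            R.modeAt (q - 1 - (i - 1)) w (divPow c (i - 1) v) := by
      intro i
      have h1 := divPow_succ (i - 2) v
      rw [show i - 2 + 1 = i - 1 by ring] at h1
      rw [divPow_uL_neg_one, h1, divPow_weight hv, map_add, map_add, modeAt_smul, modeAt_smul,
        modeAt_smul, modeAt_apply _ _ _ (uL (-1) • _), R.Y_derivative, der_apply, ← modeAt_apply,
        show q - 1 - (i - 1) = q - i by ring, show q - i - 1 = q - 1 - i by ring]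
      push_cast
      module
    have e2 : ∀ i : ℤ, ((i : ℂ) - q) • R.modeAt (q - 1 - i) w (divPow c i v) +
        ((2 : ℂ) * (d - (i : ℤ)) + (i : ℤ)) • R.modeAt (q - 1 - i) w (divPow c i v) =
        (n : ℂ) • R.modeAt (q - 1 - i) w (divPow c i v) := by
      intro i
      rw [← add_smul]
      congr 1
      rw [hq]
      push_cast
      ring
    have f1 : (Function.support fun i : ℤ =>
        ((i : ℂ) - q) • R.modeAt (q - 1 - i) w (divPow c i v)).Finite := by
      have := divPow_support hv (fun i => ((i : ℂ) - q) • R.modeAt (q - 1 - i) w) 0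
      simp only [sub_zero] at this
      exact this
    have f2 : (Function.support fun i : ℤ => ((2 : ℂ) * (d - (i : ℤ)) + (i : ℤ)) •
        R.modeAt (q - 1 - i) w (divPow c i v)).Finite := by
      have := divPow_support hv (fun i => ((2 : ℂ) * (d - (i : ℤ)) + (i : ℤ)) •
        R.modeAt (q - 1 - i) w) 0
      simp only [sub_zero] at this
      exact this
    have f3 : (Function.support fun i : ℤ => ((2 : ℂ) * (d - ((i - 1 : ℤ) : ℂ)) + ((i - 1 : ℤ) :
      ℂ)) •
        R.modeAt (q - 1 - (i - 1)) w (divPow c (i - 1) v)).Finite :=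
      divPow_support hv (fun i => ((2 : ℂ) * (d - ((i - 1 : ℤ) : ℂ)) + ((i - 1 : ℤ) : ℂ)) •
        R.modeAt (q - 1 - (i - 1)) w) 1
    rw [expMode, finsum_congr e1, finsum_add_distrib f1 f3,
      finsum_shift (fun i : ℤ => ((2 : ℂ) * (d - (i : ℤ)) + (i : ℤ)) •
        R.modeAt (q - 1 - i) w (divPow c i v)) 1, ← finsum_add_distrib f1 f2, finsum_congr e2,
      ← smul_finsum, expMode, show 2 * (d : ℤ) - (n - 1) - 2 = q - 1 by
        rw [hq]; push_cast; ring]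
  rw [key, pow_succ]
  module

theorem finsum_finsum_comm {X : Type*} [AddCommGroup X] (f : ℤ → ℕ → X)
    (h1 : ∃ s : Finset ℤ, ∀ i, i ∉ s → ∀ j, f i j = 0)
    (h2 : ∀ i, ∃ N : ℕ, ∀ j, N ≤ j → f i j = 0) :
    ∑ᶠ i, ∑ᶠ j, f i j = ∑ᶠ j, ∑ᶠ i, f i j := by
  obtain ⟨s, hs⟩ := h1
  rw [finsum_eq_sum_of_support_subset (s := s)]
  · rw [sum_finsum_comm]
    · refine finsum_congr fun j => ?_
      rw [finsum_eq_sum_of_support_subset (s := s)]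
      intro i hi
      by_contra h
      exact hi (hs i h j)
    · intro i _
      obtain ⟨N, hN⟩ := h2 i
      refine (Set.finite_lt_nat N).subset fun j hj => ?_
      by_contra h
      exact hj (hN j (not_lt.mp h))
  · intro i hi
    by_contra h
    refine hi ?_
    dsimp only
    rw [finsum_congr (hs i h), finsum_zero]

theorem expMode_eq_zero {d : ℕ} {v : Vc c} (hv : v ∈ Vgr c d) (w : W) :
    ∃ N : ℕ, ∀ q : ℤ, N ≤ q → R.expMode q v w = 0 := by
  choose K hK using fun i : ℕ => (R.Y (divPow c i v)).2 w
  refine ⟨d + ∑ i ∈ Finset.range (d + 1), K i, fun q hq => ?_⟩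
  rw [expMode]
  refine (finsum_congr fun i => ?_).trans finsum_zero
  by_cases hi : i < 0 ∨ d < i
  · rw [divPow_eq_zero hv hi, map_zero]
  · obtain ⟨k, rfl⟩ := Int.eq_ofNat_of_zero_le (show 0 ≤ i by omega)
    have := Finset.single_le_sum (f := K) (fun i _ => Nat.zero_le _)
      (Finset.mem_range.mpr (show k < d + 1 by omega))
    exact hK k _ (by omega)

theorem oppositeMode_eq_zero {d : ℕ} {v : Vc c} (hv : v ∈ Vgr c d) (w : W) :
    ∃ N : ℕ, ∀ n : ℤ, n ≤ -(N : ℤ) → R.oppositeMode d n v w = 0 := by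
  obtain ⟨N, hN⟩ := R.expMode_eq_zero hv w
  refine ⟨N + 2, fun n hn => ?_⟩
  rw [R.oppositeMode_eq hv, hN _ (by omega), smul_zero]

theorem oppositeMode_uL_neg_two {d : ℕ} {v : Vc c} (hv : v ∈ Vgr c d) (n : ℤ) (w : W) :
    R.oppositeMode (d + 2) n (uL (-2) • v) w =
      (∑ᶠ j : ℕ, R.L (1 - j) (R.oppositeMode d (n - 1 - j) v w)) +
        ∑ᶠ j : ℕ, R.oppositeMode d (n + j) v (R.L (j + 2) w) := by
  have key : R.expMode (2 * (d + 2 : ℕ) - n - 2) (uL (-2) • v) w =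
      (∑ᶠ j : ℕ, R.L (1 - j) (R.expMode (2 * d - (n - 1 - j) - 2) v w)) +
        ∑ᶠ j : ℕ, R.expMode (2 * d - (n + j) - 2) v (R.L (j + 2) w) := by
    set q : ℤ := 2 * (d + 2 : ℕ) - n - 2 with hq
    have fin : ∀ (m : ℤ) (r : ℂ) (s : ℤ), (Function.support fun i : ℤ =>
        r • R.modeAt (q - i) w (uL m • divPow c (i - s) v)).Finite := fun m r s =>
      divPow_support hv (fun i => r • R.modeAt (q - i) w ∘ₗ op (Vc c) m) s
    have fin0 : ∀ (m : ℤ) (r : ℂ) (s : ℤ), (Function.support fun i : ℤ =>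
        r • R.modeAt (q - s - i) w (uL m • divPow c i v)).Finite := fun m r s => by
      have := divPow_support hv (fun i => r • R.modeAt (q - s - i) w ∘ₗ op (Vc c) m) 0
      simp only [sub_zero] at this
      exact this
    have shift : ∀ (m : ℤ) (r : ℂ) (s : ℤ),
        ∑ᶠ i : ℤ, r • R.modeAt (q - i) w (uL m • divPow c (i - s) v) =
        ∑ᶠ i : ℤ, r • R.modeAt (q - s - i) w (uL m • divPow c i v) := fun m r s => by
      rw [← finsum_shift (fun i : ℤ => r • R.modeAt (q - s - i) w (uL m • divPow c i v)) s]
      refine finsum_congr fun i => ?_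
      rw [show q - s - (i - s) = q - i by ring]
    have e1 : ∀ i : ℤ, R.modeAt (q - i) w (divPow c i (uL (-2) • v)) =
        (1 : ℂ) • R.modeAt (q - i) w (uL (-2) • divPow c (i - 0) v) +
          (3 : ℂ) • R.modeAt (q - i) w (uL (-1) • divPow c (i - 1) v) +
          (3 : ℂ) • R.modeAt (q - i) w (uL 0 • divPow c (i - 2) v) +
          (1 : ℂ) • R.modeAt (q - i) w (uL 1 • divPow c (i - 3) v) := by
      intro i
      rw [divPow_uL_neg_two, map_add, map_add, map_add, modeAt_smul, modeAt_smul, sub_zero,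
        one_smul,
        one_smul]
    have e2 : ∀ i : ℤ, (1 : ℂ) • R.modeAt (q - 0 - i) w (uL (-2) • divPow c i v) +
          (3 : ℂ) • R.modeAt (q - 1 - i) w (uL (-1) • divPow c i v) +
          (3 : ℂ) • R.modeAt (q - 2 - i) w (uL 0 • divPow c i v) +
          (1 : ℂ) • R.modeAt (q - 3 - i) w (uL 1 • divPow c i v) =
        (∑ᶠ j : ℕ, R.L (1 - j) (R.modeAt (q - 3 + j - i) w (divPow c i v))) +
        ∑ᶠ j : ℕ, R.modeAt (q - 4 - j - i) (R.L (j + 2) w) (divPow c i v) := by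
      intro i
      have h := R.fieldOp_combination (R.Y (divPow c i v)) (q - i) w
      simp only [modeAt_apply, R.Y_uL, one_smul]
      rw [show q - 0 - i = q - i by ring, show q - 1 - i = q - i - 1 by ring,
        show q - 2 - i = q - i - 2 by ring, show q - 3 - i = q - i - 3 by ring, h]
      congr 1
      · refine finsum_congr fun j => ?_
        rw [show q - 3 + j - i = q - i - 3 + j by ring]
      · refine finsum_congr fun j => ?_
        rw [show q - 4 - j - i = q - i - 4 - j by ring]
    have hI : ∀ i : ℤ, i ∉ Finset.Icc (0 : ℤ) d → divPow c i v = 0 := fun i hi => by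
      rw [Finset.mem_Icc] at hi
      exact divPow_eq_zero hv (by omega)
    have f1 : (Function.support fun i : ℤ =>
        ∑ᶠ j : ℕ, R.L (1 - j) (R.modeAt (q - 3 + j - i) w (divPow c i v))).Finite := by
      refine (Finset.Icc (0 : ℤ) d).finite_toSet.subset fun i hi => ?_
      by_contra h
      refine hi ((finsum_congr fun j => ?_).trans finsum_zero)
      rw [hI i h, map_zero, map_zero]
    have f2 : (Function.support fun i : ℤ =>
        ∑ᶠ j : ℕ, R.modeAt (q - 4 - j - i) (R.L (j + 2) w) (divPow c i v)).Finite := by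
      refine (Finset.Icc (0 : ℤ) d).finite_toSet.subset fun i hi => ?_
      by_contra h
      refine hi ((finsum_congr fun j => ?_).trans finsum_zero)
      rw [hI i h, map_zero]
    obtain ⟨K, hK⟩ := R.smooth w
    rw [expMode, finsum_congr e1,
      finsum_add_distrib (((fin _ _ _).union (fin _ _ _)).union (fin _ _ _) |>.subset
        ((Function.support_add _ _).trans (Set.union_subset_union_left _
          (Function.support_add _ _)))) (fin _ _ _),
      finsum_add_distrib (((fin _ _ _).union (fin _ _ _)).subset (Function.support_add _ _))
        (fin _ _ _),
      finsum_add_distrib (fin _ _ _) (fin _ _ _), shift, shift, shift, shift,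
      ← finsum_add_distrib (fin0 _ _ _) (fin0 _ _ _),
      ← finsum_add_distrib (((fin0 _ _ _).union (fin0 _ _ _)).subset (Function.support_add _ _))
        (fin0 _ _ _),
      ← finsum_add_distrib (((fin0 _ _ _).union (fin0 _ _ _)).union (fin0 _ _ _) |>.subset
        ((Function.support_add _ _).trans (Set.union_subset_union_left _
          (Function.support_add _ _)))) (fin0 _ _ _),
      finsum_congr e2, finsum_add_distrib f1 f2]
    congr 1
    · rw [finsum_finsum_comm]
      · refine finsum_congr fun j => ?_
        rw [expMode, show 2 * (d : ℤ) - (n - 1 - j) - 2 = q - 3 + j by rw [hq]; push_cast; ring]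
        refine (LinearMap.toAddMonoidHom (R.L (1 - j))).map_finsum ?_ |>.symm
        have := divPow_support hv (fun i => R.modeAt (q - 3 + j - i) w) 0
        simp only [sub_zero] at this
        exact this
      · exact ⟨_, fun i hi j => by rw [hI i hi, map_zero, map_zero]⟩
      · intro i
        obtain ⟨N, hN⟩ := (R.Y (divPow c i v)).2 w
        exact ⟨N + (q - 3 - i).natAbs, fun j hj => by
          rw [modeAt_apply, hN _ (by omega), map_zero]⟩
    · rw [finsum_finsum_comm]
      · refine finsum_congr fun j => ?_
        rw [expMode, show 2 * (d : ℤ) - (n + j) - 2 = q - 4 - j by rw [hq]; push_cast; ring]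
      · exact ⟨_, fun i hi j => by rw [hI i hi, map_zero]⟩
      · intro i
        exact ⟨K, fun j hj => by rw [modeAt_apply, hK _ (by omega), map_zero]⟩
  rw [R.oppositeMode_eq (uL_neg_two_mem hv), key, smul_add, smul_finsum, smul_finsum,
    show (-1 : ℂ) ^ (d + 2) = (-1) ^ d by rw [pow_add]; norm_num]
  simp only [R.oppositeMode_eq hv, map_smul]

end SmoothRep

end OppositeModes


section Coefficients

theorem coeff_mul_eq_finsum_of_ordGE {f : Lau} {a : ℤ} (hf : OrdGE f a) (g : Lau) (N : ℤ) :
    (f * g).coeff N = ∑ᶠ i : ℕ, f.coeff (a + i) * g.coeff (N - a - i) := by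
  have h0 : OrdGE (lauX (-a) * f) 0 := fun n hn => by
    rw [lauX_mul_coeff, hf _ (by omega)]
  have h := coeff_mul_eq_finsum h0 g (N - a)
  rw [mul_assoc, lauX_mul_coeff, sub_neg_eq_add, sub_add_cancel] at h
  rw [h]
  refine finsum_congr fun i => ?_
  rw [lauX_mul_coeff, sub_neg_eq_add, add_comm]

theorem triMono_mul_fst_coeff (k m : ℤ) (G : Tri) (N : ℤ) : (triMono k m * G).1.coeff N =
    ∑ᶠ i : ℕ, (-1 : ℂ) ^ m * ((-1) ^ i * (bin m i : ℂ)) * G.1.coeff (N - k - i) := by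
  refine (coeff_mul_eq_finsum_of_ordGE (triMono_fst_ordGE k m) _ _).trans
    (finsum_congr fun i => ?_)
  rw [triMono_fst_coeff]

theorem triMono_mul_snd_fst_coeff (k m : ℤ) (G : Tri) (N : ℤ) :
    (triMono k m * G).2.1.coeff N = ∑ᶠ i : ℕ, (bin k i : ℂ) * G.2.1.coeff (N - m - i) := by
  refine (coeff_mul_eq_finsum_of_ordGE (triMono_snd_fst_ordGE k m) _ _).trans
    (finsum_congr fun i => ?_)
  rw [triMono_snd_fst_coeff]

theorem triMono_mul_snd_snd_coeff (k m : ℤ) (G : Tri) (N : ℤ) :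
    (triMono k m * G).2.2.coeff N =
      ∑ᶠ i : ℕ, (-1) ^ i * (bin m i : ℂ) * G.2.2.coeff (N + k + m - i) := by
  refine (coeff_mul_eq_finsum_of_ordGE (triMono_snd_snd_ordGE k m) _ _).trans
    (finsum_congr fun i => ?_)
  rw [triMono_snd_snd_coeff, show N - (-k - m) - (i : ℤ) = N + k + m - i by ring]

theorem triMono_zero_right_mul_fst_coeff (k : ℤ) (G : Tri) (N : ℤ) :
    (triMono k 0 * G).1.coeff N = G.1.coeff (N - k) := by
  change (((-1 : ℂ) ^ (0 : ℤ)) • (lauX k * lauBin (-1) 0) * G.1).coeff N = _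
  rw [lauBin_zero, mul_one, zpow_zero, one_smul, lauX_mul_coeff]

theorem triMono_zero_left_mul_snd_fst_coeff (m : ℤ) (G : Tri) (N : ℤ) :
    (triMono 0 m * G).2.1.coeff N = G.2.1.coeff (N - m) := by
  change (lauX m * lauBin 1 0 * G.2.1).coeff N = _
  rw [lauBin_zero, mul_one, lauX_mul_coeff]

theorem triMono_zero_right_mul_snd_snd_coeff (k : ℤ) (G : Tri) (N : ℤ) :
    (triMono k 0 * G).2.2.coeff N = G.2.2.coeff (N + k) := by
  change (lauX (-k - 0) * lauBin (-1) 0 * G.2.2).coeff N = _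
  rw [lauBin_zero, mul_one, lauX_mul_coeff, sub_zero, sub_neg_eq_add]

theorem sum_fst_coeff (s : Finset ℕ) (G : ℕ → Tri) (N : ℤ) :
    (∑ i ∈ s, G i).1.coeff N = ∑ i ∈ s, (G i).1.coeff N :=
  map_sum (lauCoeff N ∘ₗ LinearMap.fst ℂ Lau (Lau × Lau)) G s

theorem sum_snd_fst_coeff (s : Finset ℕ) (G : ℕ → Tri) (N : ℤ) :
    (∑ i ∈ s, G i).2.1.coeff N = ∑ i ∈ s, (G i).2.1.coeff N :=
  map_sum (lauCoeff N ∘ₗ LinearMap.fst ℂ Lau Lau ∘ₗ LinearMap.snd ℂ Lau (Lau × Lau)) G s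

theorem sum_snd_snd_coeff (s : Finset ℕ) (G : ℕ → Tri) (N : ℤ) :
    (∑ i ∈ s, G i).2.2.coeff N = ∑ i ∈ s, (G i).2.2.coeff N :=
  map_sum (lauCoeff N ∘ₗ LinearMap.snd ℂ Lau Lau ∘ₗ LinearMap.snd ℂ Lau (Lau × Lau)) G s

end Coefficients

section BinomialInversion

theorem bin_neg_one_sub (j p : ℕ) : bin (-1 - j) p = (-1) ^ p * ((j + p).choose p : ℤ) := by
  have h := Ring.choose_neg ((j : ℤ) + 1) p
  rw [show (j : ℤ) + 1 + p - 1 = ((j + p : ℕ) : ℤ) by push_cast; ring, Ring.choose_natCast,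
    show -((j : ℤ) + 1) = -1 - j by ring] at h
  rw [bin, h]
  rw [Units.smul_def, Int.coe_negOnePow_natCast, smul_eq_mul]

theorem bin_reciprocity (j p : ℕ) : (-1 : ℂ) ^ (-1 - j : ℤ) * ((-1) ^ p * (bin (-1 - j) p : ℂ)) =
    -(bin (-1 - p) j : ℂ) := by
  rw [bin_neg_one_sub, bin_neg_one_sub, SmoothRep.neg_one_zpow_sub_natCast, add_comm p j,
    ← Nat.choose_symm_add (a := j) (b := p)]
  push_cast
  have h : (-1 : ℂ) ^ p * (-1) ^ p = 1 := by rw [← mul_pow]; norm_num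
  rw [show (-1 : ℂ) ^ (-1 : ℤ) = -1 by norm_num]
  linear_combination (-(-1 : ℂ) ^ j * ((j + p).choose j : ℂ)) * h

theorem bin_natCast_eq (i q : ℕ) : bin ((i + q : ℕ) : ℤ) i = (-1) ^ q * bin (-1 - i) q := by
  rw [bin_neg_one_sub, bin, Ring.choose_natCast, ← mul_assoc, ← mul_pow,
    Nat.choose_symm_add]
  norm_num

theorem finsum_bin_natCast (i : ℕ) (f : ℕ → ℂ) :
    ∑ᶠ p : ℕ, (bin p i : ℂ) * f p = ∑ᶠ q : ℕ, (-1) ^ q * (bin (-1 - i) q : ℂ) * f (i + q) := by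
  have h : ∀ q : ℕ, (-1) ^ q * (bin (-1 - i) q : ℂ) * f (i + q) =
      (fun p : ℕ => (bin p i : ℂ) * f p) (i + q) := fun q => by
    dsimp only
    rw [bin_natCast_eq]
    push_cast
    rfl
  rw [finsum_congr h, ← finsum_mem_range (f := fun p : ℕ => (bin p i : ℂ) * f p)
    (add_right_injective i), finsum_mem_def]
  refine finsum_congr fun p => ?_
  by_cases hp : p ∈ Set.range fun q : ℕ => i + q
  · rw [Set.indicator_of_mem hp]
  · rw [Set.indicator_of_notMem hp, bin, Ring.choose_natCast, Nat.choose_eq_zero_of_lt]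
    · simp
    · by_contra hlt
      exact hp ⟨p - i, by dsimp only; omega⟩

theorem finsum_exchange {A : ℕ → ℂ} {F : ℕ → ℕ → ℂ} {N M : ℕ} (hA : ∀ p, A p = ∑ᶠ i, F i p)
    (h1 : ∀ i p, N ≤ i → F i p = 0) (h2 : ∀ i p, M ≤ p → F i p = 0) :
    ∑ᶠ p, A p = ∑ i ∈ Finset.range N, ∑ᶠ p, F i p := by
  have e1 : ∀ p, A p = ∑ i ∈ Finset.range N, F i p := fun p => by
    rw [hA, finsum_eq_range fun i hi => h1 i p hi]
  rw [finsum_eq_range (N := M) fun p hp => by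
    rw [e1, Finset.sum_eq_zero fun i _ => h2 i p hp]]
  simp only [e1]
  rw [Finset.sum_comm]
  refine Finset.sum_congr rfl fun i _ => ?_
  rw [finsum_eq_range fun p hp => h2 i p hp]

end BinomialInversion

section SpecialWard

variable (c hmid hin hout : ℂ) (w : Verma c hmid) (u : Verma c hin) (x : Verma c hout)

/-- The Ward identity of `ζ^k`. -/
theorem ward_zero (k : ℤ) :
    ∑ᶠ i : ℕ, (bin k i : ℂ) * threePoint c hmid hin hout (uL (i - 1) • w) u x +
      threePoint c hmid hin hout w (uL (k - 1) • u) x =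
      threePoint c hmid hin hout w u (uL (1 - k) • x) := by
  have h := ward c hmid hin hout (triMono_mem k 0) (triMono_fst_ordGE k 0)
    (triMono_snd_fst_ordGE k 0) (triMono_snd_snd_ordGE k 0) w u x
  simp only [triMono_fst_coeff, triMono_snd_fst_coeff, triMono_snd_snd_coeff] at h
  have hb : ∀ i : ℕ, i ≠ 0 → bin 0 i = 0 := fun i hi => by
    rw [bin, Ring.choose_zero_pos ℤ (Nat.pos_of_ne_zero hi)]
  rw [finsum_eq_single (fun i : ℕ => (-1 : ℂ) ^ (0 : ℤ) * ((-1) ^ i * (bin 0 i : ℂ)) *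
      threePoint c hmid hin hout w (uL (k + i - 1) • u) x) 0 fun i hi => by rw [hb i hi]; simp,
    finsum_eq_single (fun i : ℕ => ((-1) ^ i * (bin 0 i : ℂ)) *
      threePoint c hmid hin hout w u (uL (-k - 0 + i + 1) • x)) 0
      fun i hi => by rw [hb i hi]; simp] at h
  simp only [zero_add] at h
  rw [show -k - 0 + ((0 : ℕ) : ℤ) + 1 = 1 - k by push_cast; ring,
    show k + ((0 : ℕ) : ℤ) - 1 = k - 1 by push_cast; ring] at h
  simpa using h

/-- The Ward identity of `(ζ - 1)^m`. -/
theorem ward_one (m : ℤ) :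
    threePoint c hmid hin hout (uL (m - 1) • w) u x +
      ∑ᶠ i : ℕ, (-1 : ℂ) ^ m * ((-1) ^ i * (bin m i : ℂ)) *
        threePoint c hmid hin hout w (uL (i - 1) • u) x =
      ∑ᶠ i : ℕ, (-1) ^ i * (bin m i : ℂ) *
        threePoint c hmid hin hout w u (uL (-m + i + 1) • x) := by
  have h := ward c hmid hin hout (triMono_mem 0 m) (triMono_fst_ordGE 0 m)
    (triMono_snd_fst_ordGE 0 m) (triMono_snd_snd_ordGE 0 m) w u x
  simp only [triMono_fst_coeff, triMono_snd_fst_coeff, triMono_snd_snd_coeff] at h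
  have hb : ∀ i : ℕ, i ≠ 0 → bin 0 i = 0 := fun i hi => by
    rw [bin, Ring.choose_zero_pos ℤ (Nat.pos_of_ne_zero hi)]
  rw [finsum_eq_single (fun i : ℕ => (bin 0 i : ℂ) *
      threePoint c hmid hin hout (uL (m + i - 1) • w) u x) 0 fun i hi => by rw [hb i hi]; simp]
    at h
  simp only [zero_add, neg_zero, zero_sub] at h
  rw [show m + ((0 : ℕ) : ℤ) - 1 = m - 1 by push_cast; ring] at h
  simpa using h

end SpecialWard


section FourPoint

open IsHighestWeightVector

variable (c hmid hin hout : ℂ)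

/-- `G` is the function of `ζ` with poles at `0`, `1`, `∞` obtained by insertion of `v` at `ζ` in
the three point function of `w`, `u`, `x`. -/
def IsFourPoint (d : ℕ) (v : Vc c) (w : Verma c hmid) (u : Verma c hin) (x : Verma c hout)
    (G : Tri) : Prop :=
  (∀ n : ℤ, G.2.1.coeff (-n - 1) =
    threePoint c hmid hin hout (((vermaRep c hmid).Y v).1 n w) u x) ∧
  (∀ n : ℤ, G.1.coeff (-n - 1) =
    threePoint c hmid hin hout w (((vermaRep c hin).Y v).1 n u) x) ∧
  ∀ n : ℤ, G.2.2.coeff (n + 1) =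
    threePoint c hmid hin hout w u ((vermaRep c hout).oppositeMode d n v x)

/-- The vectors of weight `d` whose insertion in three point functions yields functions with
poles at `0`, `1`, `∞`. -/
def fourPoint (d : ℕ) : Submodule ℂ (Vc c) where
  carrier := {v | v ∈ Vgr c d ∧ ∀ w u x, ∃ G ∈ triFun, IsFourPoint c hmid hin hout d v w u x G}
  add_mem' := fun {a b} ha hb => by
    refine ⟨(Vgr c d).add_mem ha.1 hb.1, fun w u x => ?_⟩
    obtain ⟨G, hG, g1, g0, gi⟩ := ha.2 w u x
    obtain ⟨H, hH, k1, k0, ki⟩ := hb.2 w u x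
    refine ⟨G + H, triFun.add_mem hG hH, fun n => ?_, fun n => ?_, fun n => ?_⟩
    · rw [Prod.snd_add, Prod.fst_add, HahnSeries.coeff_add, g1, k1, map_add]
      simp
    · rw [Prod.fst_add, HahnSeries.coeff_add, g0, k0, map_add]
      simp
    · rw [Prod.snd_add, Prod.snd_add, HahnSeries.coeff_add, gi, ki, map_add]
      simp
  zero_mem' := ⟨(Vgr c d).zero_mem, fun w u x => ⟨0, triFun.zero_mem, fun n => by simp,
    fun n => by simp, fun n => by simp⟩⟩
  smul_mem' := fun r a ha => by
    refine ⟨(Vgr c d).smul_mem r ha.1, fun w u x => ?_⟩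
    obtain ⟨G, hG, g1, g0, gi⟩ := ha.2 w u x
    refine ⟨r • G, triFun.smul_mem r hG, fun n => ?_, fun n => ?_, fun n => ?_⟩
    · change r * G.2.1.coeff (-n - 1) = _
      rw [g1, map_smul]
      simp
    · change r * G.1.coeff (-n - 1) = _
      rw [g0, map_smul]
      simp
    · change r * G.2.2.coeff (n + 1) = _
      rw [gi, map_smul]
      simp

theorem one_coeff (n : ℤ) : (1 : Lau).coeff n = if n = 0 then 1 else 0 := by
  rw [← lauX_zero, lauX_coeff]

theorem vacuum_mem_fourPoint : vacuum c ∈ fourPoint c hmid hin hout 0 := by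
  have hv : vacuum c ∈ Vgr c 0 := mem_Vgr.mpr (by
    rw [Nat.cast_zero]
    exact (vacuum_isHighestWeightVector c).weight)
  refine ⟨hv, fun w u x => ⟨threePoint c hmid hin hout w u x • 1,
    triFun.smul_mem _ triFun_one_mem, fun n => ?_, fun n => ?_, fun n => ?_⟩⟩
  · change _ * (1 : Lau).coeff _ = _
    rw [one_coeff, SmoothRep.Y_vacuum, SmoothRep.idField_apply]
    split_ifs <;> first | omega | simp
  · change _ * (1 : Lau).coeff _ = _
    rw [one_coeff, SmoothRep.Y_vacuum, SmoothRep.idField_apply]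
    split_ifs <;> first | omega | simp
  · change _ * (1 : Lau).coeff _ = _
    rw [one_coeff, SmoothRep.oppositeMode_apply]
    simp only [zero_add, Finset.sum_range_one, pow_zero, Module.End.one_apply,
      SmoothRep.Y_vacuum, LinearMap.smul_apply, SmoothRep.idField_apply]
    split_ifs <;> first | omega | simp

theorem uL_neg_one_mem_fourPoint {d : ℕ} {v : Vc c} (hv : v ∈ fourPoint c hmid hin hout d) :
    uL (-1) • v ∈ fourPoint c hmid hin hout (d + 1) := by
  refine ⟨SmoothRep.uL_neg_one_mem hv.1, fun w u x => ?_⟩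
  obtain ⟨G, hG, g1, g0, gi⟩ := hv.2 w u x
  refine ⟨triDer G, triFun_der_mem hG, fun n => ?_, fun n => ?_, fun n => ?_⟩
  · rw [triDer_snd_fst, lauDer_coeff, SmoothRep.Y_derivative, der_apply, map_smul,
      LinearMap.smul_apply, LinearMap.smul_apply, ← g1, smul_eq_mul,
      show -n - 1 + 1 = -(n - 1) - 1 by ring]
    push_cast
    ring
  · rw [triDer_fst, lauDer_coeff, SmoothRep.Y_derivative, der_apply, map_smul,
      LinearMap.smul_apply, ← g0, smul_eq_mul, show -n - 1 + 1 = -(n - 1) - 1 by ring]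
    push_cast
    ring
  · rw [triDer_snd_snd_coeff, SmoothRep.oppositeMode_uL_neg_one _ hv.1, map_smul, ← gi,
      smul_eq_mul, show n + 1 - 1 = n - 1 + 1 by ring]
    push_cast
    ring

theorem exists_uL_eq_zero {h : ℂ} (w : Verma c h) :
    ∃ N : ℕ, ∀ n : ℤ, (N : ℤ) ≤ n → uL n • w = 0 := (vermaRep c h).smooth w

theorem vermaRep_L {h : ℂ} (n : ℤ) (w : Verma c h) : (vermaRep c h).L n w = uL n • w := rfl

theorem Y_neg_two_apply {h : ℂ} (v : Vc c) (n : ℤ) (w : Verma c h) (f : Verma c h →ₗ[ℂ] ℂ) :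
    f (((vermaRep c h).Y (uL (-2) • v)).1 n w) =
      (∑ᶠ j : ℕ, f (uL (-2 - j) • ((vermaRep c h).Y v).1 (n + j) w)) +
        ∑ᶠ j : ℕ, f (((vermaRep c h).Y v).1 (n - 1 - j) (uL (j - 1) • w)) := by
  obtain ⟨K, hK⟩ := ((vermaRep c h).Y v).2 w
  obtain ⟨N, hN⟩ := exists_uL_eq_zero c w
  rw [SmoothRep.Y_uL, SmoothRep.fieldOp_neg_two_apply, map_add, map_finsum_of_bounded,
    map_finsum_of_bounded]
  · rfl
  · exact ⟨N + 1, fun j hj => by rw [vermaRep_L, hN _ (by omega), map_zero]⟩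
  · exact ⟨K + n.natAbs, fun j hj => by rw [hK _ (by omega), map_zero]⟩

theorem oppositeMode_neg_two_apply {d : ℕ} {h : ℂ} {v : Vc c} (hv : v ∈ Vgr c d) (n : ℤ)
    (w : Verma c h) (f : Verma c h →ₗ[ℂ] ℂ) :
    f ((vermaRep c h).oppositeMode (d + 2) n (uL (-2) • v) w) =
      (∑ᶠ j : ℕ, f (uL (1 - j) • (vermaRep c h).oppositeMode d (n - 1 - j) v w)) +
        ∑ᶠ j : ℕ, f ((vermaRep c h).oppositeMode d (n + j) v (uL (j + 2) • w)) := by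
  obtain ⟨K, hK⟩ := (vermaRep c h).oppositeMode_eq_zero hv w
  obtain ⟨N, hN⟩ := exists_uL_eq_zero c w
  rw [SmoothRep.oppositeMode_uL_neg_two _ hv, map_add, map_finsum_of_bounded,
    map_finsum_of_bounded]
  · rfl
  · exact ⟨N + 1, fun j hj => by rw [vermaRep_L, hN _ (by omega), map_zero]⟩
  · exact ⟨K + n.natAbs, fun j hj => by rw [hK _ (by omega), map_zero]⟩

theorem uL_neg_two_mem_fourPoint {d : ℕ} {v : Vc c} (hv : v ∈ fourPoint c hmid hin hout d) :
    uL (-2) • v ∈ fourPoint c hmid hin hout (d + 2) := by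
  refine ⟨SmoothRep.uL_neg_two_mem hv.1, fun w u x => ?_⟩
  obtain ⟨N, hNw, hNu, hNx⟩ : ∃ N : ℕ, (∀ j : ℕ, N ≤ j → uL (j - 1) • w = 0) ∧
      (∀ j : ℕ, N ≤ j → uL (j - 1) • u = 0) ∧ (∀ j : ℕ, N ≤ j → uL (j + 2) • x = 0) := by
    obtain ⟨N, hN⟩ := exists_uL_eq_zero c w
    obtain ⟨K, hK⟩ := exists_uL_eq_zero c u
    obtain ⟨M, hM⟩ := exists_uL_eq_zero c x
    exact ⟨N + K + M + 1, fun j hj => hN _ (by omega), fun j hj => hK _ (by omega),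
      fun j hj => hM _ (by omega)⟩
  choose Gw hGw w1 w0 wi using fun j : ℕ => hv.2 (uL (j - 1) • w) u x
  choose Gu hGu u1 u0 ui using fun j : ℕ => hv.2 w (uL (j - 1) • u) x
  choose Gx hGx x1 x0 xi using fun j : ℕ => hv.2 w u (uL (j + 2) • x)
  refine ⟨(∑ j ∈ Finset.range N, triMono 0 (-1 - j) * Gw j) +
      (∑ j ∈ Finset.range N, triMono (-1 - j) 0 * Gu j) +
      ∑ j ∈ Finset.range N, triMono j 0 * Gx j, ?_, fun n => ?_, fun n => ?_, fun n => ?_⟩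
  · refine triFun.add_mem (triFun.add_mem ?_ ?_) ?_ <;>
      exact triFun.sum_mem fun j _ => triFun_mul_mem (triMono_mem _ _)
        (by first | exact hGw j | exact hGu j | exact hGx j)
  · obtain ⟨M, hM⟩ : ∃ M : ℕ, ∀ p : ℕ, M ≤ p → ((vermaRep c hmid).Y v).1 (n + p) w = 0 := by
      obtain ⟨M, hM⟩ := ((vermaRep c hmid).Y v).2 w
      exact ⟨M + n.natAbs, fun p hp => hM _ (by omega)⟩
    set W : ℕ → Verma c hmid := fun p => ((vermaRep c hmid).Y v).1 (n + p) w with hW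
    have hA : ∀ p : ℕ, threePoint c hmid hin hout (uL (-2 - p) • W p) u x =
        ∑ᶠ i : ℕ, ((bin (-1 - i) p : ℂ) * threePoint c hmid hin hout (W p) (uL (i - 1) • u) x +
          (bin i p : ℂ) * threePoint c hmid hin hout (W p) u (uL (i + 2) • x)) := by
      intro p
      have h := ward_one c hmid hin hout (W p) u x (-1 - p)
      have e1 : ∀ i : ℕ, (-1 : ℂ) ^ i * (bin (-1 - p) i : ℂ) *
          threePoint c hmid hin hout (W p) u (uL (-(-1 - p) + i + 1) • x) =
          (-1 : ℂ) ^ i * (bin (-1 - p) i : ℂ) * (fun q : ℕ =>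
            threePoint c hmid hin hout (W p) u (uL (q + 2) • x)) (p + i) := fun i => by
        dsimp only
        rw [show -(-1 - p : ℤ) + i + 1 = ((p + i : ℕ) : ℤ) + 2 by push_cast; ring]
      rw [finsum_congr e1, ← finsum_bin_natCast p fun q : ℕ =>
        threePoint c hmid hin hout (W p) u (uL (q + 2) • x)] at h
      simp only [bin_reciprocity, neg_mul, finsum_neg_distrib] at h
      rw [finsum_add_distrib, ← h, show (-1 - p : ℤ) - 1 = -2 - p by ring]
      · ring
      · exact (Set.finite_lt_nat N).subset fun i hi => by
          by_contra hlt
          exact hi (by dsimp only; rw [hNu i (not_lt.mp hlt)]; simp)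
      · exact (Set.finite_lt_nat N).subset fun i hi => by
          by_contra hlt
          exact hi (by dsimp only; rw [hNx i (not_lt.mp hlt)]; simp)
    have hex := finsum_exchange (N := N) (M := M) hA
      (fun i p hi => by rw [hNu i hi, hNx i hi]; simp) (fun i p hp => by
        rw [show W p = 0 from hM p hp]; simp)
    refine Eq.trans ?_ (Y_neg_two_apply c v n w ((LinearMap.applyₗ x ∘ₗ LinearMap.applyₗ u) ∘ₗ
      threePoint c hmid hin hout)).symm
    change _ = (∑ᶠ j : ℕ, threePoint c hmid hin hout (uL (-2 - j) • W j) u x) + ∑ᶠ j : ℕ,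
      threePoint c hmid hin hout (((vermaRep c hmid).Y v).1 (n - 1 - j) (uL (j - 1) • w)) u x
    rw [hex, finsum_eq_range (N := N) (fun j hj => by rw [hNw j hj]; simp), Prod.snd_add,
      Prod.snd_add, Prod.fst_add, Prod.fst_add, HahnSeries.coeff_add, HahnSeries.coeff_add,
      sum_snd_fst_coeff, sum_snd_fst_coeff, sum_snd_fst_coeff, add_assoc, add_comm,
      ← Finset.sum_add_distrib]
    congr 1
    · refine Finset.sum_congr rfl fun i _ => ?_
      rw [finsum_add_distrib, triMono_mul_snd_fst_coeff, triMono_mul_snd_fst_coeff]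
      · congr 1
        · refine finsum_congr fun p => ?_
          rw [show -n - 1 - 0 - (p : ℤ) = -(n + p) - 1 by ring, u1]
        · refine finsum_congr fun p => ?_
          rw [show -n - 1 - 0 - (p : ℤ) = -(n + p) - 1 by ring, x1]
      · exact (Set.finite_lt_nat M).subset fun p hp => by
          by_contra hlt
          exact hp (by dsimp only; rw [show W p = 0 from hM p (not_lt.mp hlt)]; simp)
      · exact (Set.finite_lt_nat M).subset fun p hp => by
          by_contra hlt
          exact hp (by dsimp only; rw [show W p = 0 from hM p (not_lt.mp hlt)]; simp)
    · refine Finset.sum_congr rfl fun j _ => ?_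
      rw [triMono_zero_left_mul_snd_fst_coeff,
        show -n - 1 - (-1 - j : ℤ) = -(n - 1 - j) - 1 by ring, w1]
  · obtain ⟨M, hM⟩ : ∃ M : ℕ, ∀ p : ℕ, M ≤ p → ((vermaRep c hin).Y v).1 (n + p) u = 0 := by
      obtain ⟨M, hM⟩ := ((vermaRep c hin).Y v).2 u
      exact ⟨M + n.natAbs, fun p hp => hM _ (by omega)⟩
    set U : ℕ → Verma c hin := fun p => ((vermaRep c hin).Y v).1 (n + p) u with hU
    have hA : ∀ p : ℕ, threePoint c hmid hin hout w (uL (-2 - p) • U p) x -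
        threePoint c hmid hin hout w (U p) (uL (p + 2) • x) =
        ∑ᶠ i : ℕ, -(bin (-1 - p) i : ℂ) *
          threePoint c hmid hin hout (uL (i - 1) • w) (U p) x := by
      intro p
      have h := ward_zero c hmid hin hout w (U p) x (-1 - p)
      simp only [neg_mul, finsum_neg_distrib]
      rw [show (-1 - p : ℤ) - 1 = -2 - p by ring, show 1 - (-1 - p : ℤ) = p + 2 by ring] at h
      linear_combination h
    have hex := finsum_exchange (N := N) (M := M) hA
      (fun i p hi => by rw [hNw i hi]; simp) (fun i p hp => by
        rw [show U p = 0 from hM p hp]; simp)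
    rw [finsum_sub_distrib, sub_eq_iff_eq_add,
      finsum_eq_range (N := N) (f := fun p : ℕ =>
        threePoint c hmid hin hout w (U p) (uL (p + 2) • x))
        (fun j hj => by rw [hNx j hj]; simp)] at hex
    rotate_left
    · exact (Set.finite_lt_nat M).subset fun p hp => by
        by_contra hlt
        exact hp (by dsimp only; rw [show U p = 0 from hM p (not_lt.mp hlt)]; simp)
    · exact (Set.finite_lt_nat M).subset fun p hp => by
        by_contra hlt
        exact hp (by dsimp only; rw [show U p = 0 from hM p (not_lt.mp hlt)]; simp)
    refine Eq.trans ?_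
      (Y_neg_two_apply c v n u (LinearMap.applyₗ x ∘ₗ threePoint c hmid hin hout w)).symm
    change _ = (∑ᶠ j : ℕ, threePoint c hmid hin hout w (uL (-2 - j) • U j) x) + ∑ᶠ j : ℕ,
      threePoint c hmid hin hout w (((vermaRep c hin).Y v).1 (n - 1 - j) (uL (j - 1) • u)) x
    rw [hex, finsum_eq_range (N := N) (fun j hj => by rw [hNu j hj]; simp), Prod.fst_add,
      Prod.fst_add, HahnSeries.coeff_add, HahnSeries.coeff_add,
      sum_fst_coeff, sum_fst_coeff, sum_fst_coeff, add_right_comm]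
    congr 1
    · congr 1
      · refine Finset.sum_congr rfl fun i _ => ?_
        rw [triMono_mul_fst_coeff]
        refine finsum_congr fun p => ?_
        rw [bin_reciprocity, show -n - 1 - 0 - (p : ℤ) = -(n + p) - 1 by ring, w0]
      · refine Finset.sum_congr rfl fun j _ => ?_
        rw [triMono_zero_right_mul_fst_coeff, show -n - 1 - (j : ℤ) = -(n + j) - 1 by ring, x0]
    · refine Finset.sum_congr rfl fun j _ => ?_
      rw [triMono_zero_right_mul_fst_coeff,
        show -n - 1 - (-1 - j : ℤ) = -(n - 1 - j) - 1 by ring, u0]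
  · obtain ⟨M, hM⟩ : ∃ M : ℕ, ∀ p : ℕ, M ≤ p →
        (vermaRep c hout).oppositeMode d (n - 1 - p) v x = 0 := by
      obtain ⟨M, hM⟩ := (vermaRep c hout).oppositeMode_eq_zero hv.1 x
      exact ⟨M + n.natAbs, fun p hp => hM _ (by omega)⟩
    set X : ℕ → Verma c hout := fun p => (vermaRep c hout).oppositeMode d (n - 1 - p) v x with hX
    have hA : ∀ p : ℕ, threePoint c hmid hin hout w u (uL (1 - p) • X p) -
        threePoint c hmid hin hout w (uL (p - 1) • u) (X p) =
        ∑ᶠ i : ℕ, (bin p i : ℂ) *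
          threePoint c hmid hin hout (uL (i - 1) • w) u (X p) := by
      intro p
      have h := ward_zero c hmid hin hout w u (X p) p
      linear_combination -h
    have hex := finsum_exchange (N := N) (M := M) hA
      (fun i p hi => by rw [hNw i hi]; simp) (fun i p hp => by
        rw [show X p = 0 from hM p hp]; simp)
    rw [finsum_sub_distrib, sub_eq_iff_eq_add,
      finsum_eq_range (N := N) (f := fun p : ℕ =>
        threePoint c hmid hin hout w (uL (p - 1) • u) (X p))
        (fun j hj => by rw [hNu j hj]; simp)] at hex
    rotate_left
    · exact (Set.finite_lt_nat M).subset fun p hp => by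
        by_contra hlt
        exact hp (by dsimp only; rw [show X p = 0 from hM p (not_lt.mp hlt)]; simp)
    · exact (Set.finite_lt_nat M).subset fun p hp => by
        by_contra hlt
        exact hp (by dsimp only; rw [show X p = 0 from hM p (not_lt.mp hlt)]; simp)
    rw [oppositeMode_neg_two_apply c hv.1 n x (threePoint c hmid hin hout w u), hex,
      finsum_eq_range (N := N) (fun j hj => by rw [hNx j hj]; simp), Prod.snd_add,
      Prod.snd_add, Prod.snd_add, Prod.snd_add, HahnSeries.coeff_add, HahnSeries.coeff_add,
      sum_snd_snd_coeff, sum_snd_snd_coeff, sum_snd_snd_coeff]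
    congr 1
    · congr 1
      · refine Finset.sum_congr rfl fun i _ => ?_
        rw [triMono_mul_snd_snd_coeff, finsum_bin_natCast]
        refine finsum_congr fun q => ?_
        rw [show n + 1 + 0 + (-1 - i : ℤ) - q = n - 1 - ((i + q : ℕ) : ℤ) + 1 by push_cast; ring,
          wi]
      · refine Finset.sum_congr rfl fun j _ => ?_
        rw [triMono_zero_right_mul_snd_snd_coeff,
          show n + 1 + (-1 - j : ℤ) = n - 1 - j + 1 by ring, ui]
    · refine Finset.sum_congr rfl fun j _ => ?_
      rw [triMono_zero_right_mul_snd_snd_coeff, show n + 1 + (j : ℤ) = n + j + 1 by ring, xi]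

/-- The vectors of `V_c` whose homogeneous parts have four point functions span `V_c`. -/
theorem iSup_fourPoint : ⨆ d : ℕ, fourPoint c hmid hin hout d = ⊤ := by
  refine eq_top_iff.mpr fun v _ =>
    (vacuum_isHighestWeightVector c).induction_neg_one_neg_two _
      (Submodule.mem_iSup_of_mem 0 (vacuum_mem_fourPoint c hmid hin hout)) ?_ ?_ v
  · intro x hx
    have : (⨆ d : ℕ, fourPoint c hmid hin hout d) ≤
        (⨆ d : ℕ, fourPoint c hmid hin hout d).comap (op (Vc c) (-1)) :=
      iSup_le fun d y hy =>
        Submodule.mem_iSup_of_mem (d + 1) (uL_neg_one_mem_fourPoint c hmid hin hout hy)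
    exact this hx
  · intro x hx
    have : (⨆ d : ℕ, fourPoint c hmid hin hout d) ≤
        (⨆ d : ℕ, fourPoint c hmid hin hout d).comap (op (Vc c) (-2)) :=
      iSup_le fun d y hy =>
        Submodule.mem_iSup_of_mem (d + 2) (uL_neg_two_mem_fourPoint c hmid hin hout hy)
    exact this hx

end FourPoint


section WeightSpaces

open IsHighestWeightVector

variable {c h : ℂ}

/-- The space of vectors of weight `η` of a Verma module. -/
def weightSpace (c h η : ℂ) : Submodule ℂ (Verma c h) := (vermaRep c h).L 0 |>.eigenspace η

theorem mem_weightSpace {η : ℂ} {w : Verma c h} : w ∈ weightSpace c h η ↔ uL 0 • w = η • w :=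
  Module.End.mem_eigenspace_iff

theorem iSup_weightSpace_nat : ⨆ d : ℕ, weightSpace c h (h + d) = ⊤ :=
  iSup_eigenspace_eq_top (Verma.isHighestWeightVector c h)

theorem weightSpace_isInternal (c h : ℂ) : DirectSum.IsInternal (weightSpace c h) := by
  refine DirectSum.isInternal_submodule_of_iSupIndep_of_iSup_eq_top
    ((vermaRep c h).L 0).eigenspaces_iSupIndep ?_
  rw [eq_top_iff, ← iSup_weightSpace_nat]
  exact iSup_le fun d => le_iSup (weightSpace c h) (h + d)

theorem weightSpace_induction (S : Submodule ℂ (Verma c h))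
    (hS : ∀ η, ∀ w ∈ weightSpace c h η, w ∈ S) (w : Verma c h) : w ∈ S := by
  have : (⊤ : Submodule ℂ (Verma c h)) ≤ S := by
    rw [← iSup_weightSpace_nat]
    exact iSup_le fun d w hw => hS _ w hw
  exact this trivial

/-- The decomposition of a Verma module into its weight spaces. -/
def weightEquiv (c h : ℂ) : (DirectSum ℂ fun η => weightSpace c h η) ≃ₗ[ℂ] Verma c h :=
  LinearEquiv.ofBijective (DirectSum.coeLinearMap (weightSpace c h)) (weightSpace_isInternal c h)

theorem weightEquiv_symm {η : ℂ} {w : Verma c h} (hw : w ∈ weightSpace c h η) :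
    (weightEquiv c h).symm w = DirectSum.lof ℂ ℂ (fun η => weightSpace c h η) η ⟨w, hw⟩ := by
  rw [LinearEquiv.symm_apply_eq]
  exact (DirectSum.coeLinearMap_lof (weightSpace c h) η ⟨w, hw⟩).symm

/-- The linear map on a Verma module given by linear maps on the weight spaces. -/
def ofWeights {X : Type*} [AddCommMonoid X] [Module ℂ X] (f : ℂ → Verma c h →ₗ[ℂ] X) :
    Verma c h →ₗ[ℂ] X :=
  DirectSum.toModule ℂ ℂ X (fun η => f η ∘ₗ (weightSpace c h η).subtype) ∘ₗ
    (weightEquiv c h).symm.toLinearMap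

theorem ofWeights_apply {X : Type*} [AddCommMonoid X] [Module ℂ X] (f : ℂ → Verma c h →ₗ[ℂ] X)
    {η : ℂ} {w : Verma c h} (hw : w ∈ weightSpace c h η) : ofWeights f w = f η w := by
  change DirectSum.toModule ℂ ℂ X _ ((weightEquiv c h).symm w) = _
  rw [weightEquiv_symm hw, DirectSum.toModule_lof]
  rfl

/-- The projection onto a weight space. -/
def weightProj (c h η : ℂ) : Module.End ℂ (Verma c h) :=
  ofWeights fun η' => if η' = η then LinearMap.id else 0

theorem weightProj_apply (η : ℂ) {η' : ℂ} {w : Verma c h} (hw : w ∈ weightSpace c h η') :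
    weightProj c h η w = if η' = η then w else 0 := by
  rw [weightProj, ofWeights_apply _ hw]
  split_ifs <;> rfl

theorem weightProj_eq_zero {η : ℂ} (hη : ∀ d : ℕ, h + d ≠ η) : weightProj c h η = 0 := by
  refine LinearMap.ext fun w => ?_
  have : (⊤ : Submodule ℂ (Verma c h)) ≤ LinearMap.ker (weightProj c h η) := by
    rw [← iSup_weightSpace_nat]
    exact iSup_le fun d w hw => by
      rw [LinearMap.mem_ker, weightProj_apply η hw, if_neg (hη d)]
  exact this (x := w) trivial

theorem exists_weightProj_eq_zero (c h η : ℂ) :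
    ∃ N : ℕ, ∀ n : ℕ, N ≤ n → weightProj c h (η - n) = 0 := by
  by_cases he : ∃ n d : ℕ, h + d = η - n
  · obtain ⟨n, d, e⟩ := he
    refine ⟨n + d + 1, fun n' hn' => weightProj_eq_zero fun d' e' => ?_⟩
    have : ((d + n : ℕ) : ℂ) = ((d' + n' : ℕ) : ℂ) := by
      push_cast
      linear_combination e - e'
    have := Nat.cast_injective this
    omega
  · push Not at he
    exact ⟨0, fun n _ => weightProj_eq_zero (he n)⟩

/-- The restriction of a functional to a weight space, extended by zero. -/
def cutoff (c h η : ℂ) : Module.Dual ℂ (Verma c h) →ₗ[ℂ] (vermaRep c h).restrictedDual where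
  toFun f := ⟨f ∘ₗ weightProj c h η, by
    refine (Set.finite_singleton η).subset ?_
    rintro η' ⟨w, hw, hne⟩
    by_contra hη
    refine hne ?_
    rw [LinearMap.comp_apply, weightProj_apply η hw, if_neg (show η' ≠ η from hη), map_zero]⟩
  map_add' _ _ := Subtype.ext (LinearMap.add_comp _ _ _)
  map_smul' _ _ := Subtype.ext (LinearMap.smul_comp _ _ _)

theorem cutoff_apply (η : ℂ) (f : Module.Dual ℂ (Verma c h)) (w : Verma c h) :
    (cutoff c h η f).1 w = f (weightProj c h η w) := rfl

theorem restrictedDual_ext {f g : (vermaRep c h).restrictedDual}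
    (hfg : ∀ η, ∀ w ∈ weightSpace c h η, f.1 w = g.1 w) : f = g := by
  refine Subtype.ext (LinearMap.ext fun w => ?_)
  have := weightSpace_induction (LinearMap.ker (f.1 - g.1))
    (fun η w hw => by rw [LinearMap.mem_ker, LinearMap.sub_apply, hfg η w hw, sub_self]) w
  rwa [LinearMap.mem_ker, LinearMap.sub_apply, sub_eq_zero] at this

theorem mode_mem_weightSpace {d : ℕ} {v : Vc c} (hv : v ∈ Vgr c d) (m : ℤ) {η : ℂ}
    {w : Verma c h} (hw : w ∈ weightSpace c h η) :
    ((vermaRep c h).Y v).1 m w ∈ weightSpace c h (η + d - m - 1) :=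
  Module.End.mem_eigenspace_iff.mpr
    ((vermaRep c h).mode_weight (mem_Vgr.mp hv) m (Module.End.mem_eigenspace_iff.mp hw))

theorem oppositeMode_mem_weightSpace {d : ℕ} {v : Vc c} (hv : v ∈ Vgr c d) (n : ℤ) {η : ℂ}
    {w : Verma c h} (hw : w ∈ weightSpace c h η) :
    (vermaRep c h).oppositeMode d n v w ∈ weightSpace c h (η + n + 1 - d) := by
  rw [SmoothRep.oppositeMode_apply, LinearMap.smul_apply, LinearMap.sum_apply]
  refine Submodule.smul_mem _ _ (Submodule.sum_mem _ fun i _ => ?_)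
  rw [LinearMap.smul_apply]
  refine Submodule.smul_mem _ _ (Module.End.mem_eigenspace_iff.mpr ?_)
  rw [(vermaRep c h).mode_weight (uL_one_pow_weight hv i) _ (Module.End.mem_eigenspace_iff.mp hw)]
  congr 1
  push_cast
  ring

theorem uL_mem_weightSpace (n : ℤ) {η : ℂ} {w : Verma c h} (hw : w ∈ weightSpace c h η) :
    uL n • w ∈ weightSpace c h (η - n) :=
  op_weight (Verma.isHighestWeightVector c h) n hw

end WeightSpaces

section Construction

variable (c hmid hin hout : ℂ)

/-- The components of the intertwining operator on vectors of weight `η`. -/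
def intertwinerAux (η : ℂ) : Verma c hmid →ₗ[ℂ]
    (ℂ → (Verma c hin →ₗ[ℂ] (vermaRep c hout).restrictedDual)) where
  toFun w α := ofWeights fun η' => cutoff c hout (η + η' + α) ∘ₗ threePoint c hmid hin hout w
  map_add' w w' := by
    refine funext fun α => LinearMap.ext fun u => ?_
    refine sub_eq_zero.mp (LinearMap.mem_ker.mp (weightSpace_induction (LinearMap.ker
      (_ - (_ + _) : Verma c hin →ₗ[ℂ] (vermaRep c hout).restrictedDual)) (fun η' u hu => ?_) u))
    rw [LinearMap.mem_ker, LinearMap.sub_apply, LinearMap.add_apply, ofWeights_apply _ hu,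
      ofWeights_apply _ hu, ofWeights_apply _ hu, map_add, LinearMap.comp_apply,
      LinearMap.comp_apply, LinearMap.comp_apply, LinearMap.add_apply, map_add, sub_self]
  map_smul' r w := by
    refine funext fun α => LinearMap.ext fun u => ?_
    refine sub_eq_zero.mp (LinearMap.mem_ker.mp (weightSpace_induction (LinearMap.ker
      (_ - r • _ : Verma c hin →ₗ[ℂ] (vermaRep c hout).restrictedDual)) (fun η' u hu => ?_) u))
    rw [LinearMap.mem_ker, LinearMap.sub_apply, LinearMap.smul_apply, ofWeights_apply _ hu,
      ofWeights_apply _ hu, map_smul, LinearMap.comp_apply,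
      LinearMap.comp_apply, LinearMap.smul_apply, map_smul, sub_self]

/-- The intertwining operator whose matrix coefficients are the three point functions. -/
def intertwiner : Verma c hmid →ₗ[ℂ]
    (ℂ → (Verma c hin →ₗ[ℂ] (vermaRep c hout).restrictedDual)) :=
  ofWeights (intertwinerAux c hmid hin hout)

variable {c hmid hin hout} {η₁ η₂ η₃ : ℂ} {w : Verma c hmid} {u : Verma c hin} {x : Verma c hout}

theorem intertwiner_apply (hw : w ∈ weightSpace c hmid η₁) (hu : u ∈ weightSpace c hin η₂)
    (α : ℂ) : intertwiner c hmid hin hout w α u =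
      cutoff c hout (η₁ + η₂ + α) (threePoint c hmid hin hout w u) := by
  rw [intertwiner, ofWeights_apply _ hw]
  exact ofWeights_apply _ hu

theorem intertwiner_apply_apply (hw : w ∈ weightSpace c hmid η₁) (hu : u ∈ weightSpace c hin η₂)
    (hx : x ∈ weightSpace c hout η₃) (α : ℂ) : (intertwiner c hmid hin hout w α u).1 x =
      if η₃ = η₁ + η₂ + α then threePoint c hmid hin hout w u x else 0 := by
  rw [intertwiner_apply hw hu, cutoff_apply, weightProj_apply _ hx]
  split_ifs
  · rfl
  · exact map_zero _

theorem intertwiner_truncation (w : Verma c hmid) (u : Verma c hin) (α : ℂ) :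
    ∃ N : ℕ, ∀ n : ℕ, N ≤ n → intertwiner c hmid hin hout w (α - n) u = 0 := by
  let S : Submodule ℂ (Verma c hmid) :=
    { carrier := {w | ∀ u, ∃ N : ℕ, ∀ n : ℕ, N ≤ n →
        intertwiner c hmid hin hout w (α - n) u = 0}
      add_mem' := fun {a b} ha hb u => by
        obtain ⟨N, hN⟩ := ha u
        obtain ⟨K, hK⟩ := hb u
        refine ⟨N + K, fun n hn => ?_⟩
        rw [map_add, Pi.add_apply, LinearMap.add_apply, hN n (by omega), hK n (by omega),
          add_zero]
      zero_mem' := fun u => ⟨0, fun n _ => by rw [map_zero]; rfl⟩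
      smul_mem' := fun r a ha u => by
        obtain ⟨N, hN⟩ := ha u
        refine ⟨N, fun n hn => ?_⟩
        rw [map_smul, Pi.smul_apply, LinearMap.smul_apply, hN n hn, smul_zero] }
  refine weightSpace_induction S (fun η₁ w hw u => ?_) w u
  let S' : Submodule ℂ (Verma c hin) :=
    { carrier := {u | ∃ N : ℕ, ∀ n : ℕ, N ≤ n → intertwiner c hmid hin hout w (α - n) u = 0}
      add_mem' := fun {a b} ⟨N, hN⟩ ⟨K, hK⟩ => ⟨N + K, fun n hn => by
        rw [map_add, hN n (by omega), hK n (by omega), add_zero]⟩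
      zero_mem' := ⟨0, fun n _ => map_zero _⟩
      smul_mem' := fun r a ⟨N, hN⟩ => ⟨N, fun n hn => by rw [map_smul, hN n hn, smul_zero]⟩ }
  refine weightSpace_induction S' (fun η₂ u hu => ?_) u
  obtain ⟨N, hN⟩ := exists_weightProj_eq_zero c hout (η₁ + η₂ + α)
  refine ⟨N, fun n hn => ?_⟩
  rw [intertwiner_apply hw hu]
  refine Subtype.ext (LinearMap.ext fun x => ?_)
  rw [cutoff_apply, ← add_sub_assoc, hN n hn, LinearMap.zero_apply, map_zero]
  rfl

end Construction


section FinsumIdentities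

variable {A B : Type*} [AddCommGroup A] [Module ℂ A] [AddCommGroup B] [Module ℂ B]

/-- An identity of locally finite sums of linear maps holds on a linear subspace. -/
theorem exists_finsum_identity (f g k : ℕ → A →ₗ[ℂ] B)
    (hf : ∀ a, ∃ N : ℕ, ∀ n, N ≤ n → f n a = 0) (hg : ∀ a, ∃ N : ℕ, ∀ n, N ≤ n → g n a = 0)
    (hk : ∀ a, ∃ N : ℕ, ∀ n, N ≤ n → k n a = 0) :
    ∃ S : Submodule ℂ A, ∀ a, a ∈ S ↔ (∑ᶠ n, f n a) - ∑ᶠ n, g n a = ∑ᶠ n, k n a := by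
  refine ⟨LinearMap.ker (sumEnd f hf - sumEnd g hg - sumEnd k hk), fun a => ?_⟩
  rw [LinearMap.mem_ker, LinearMap.sub_apply, sub_eq_zero]
  rfl

end FinsumIdentities

section IntertwiningProperty

variable (c hmid hin hout : ℂ)

theorem intertwiner_translation (w : Verma c hmid) (α : ℂ) :
    intertwiner c hmid hin hout (((vermaRep c hmid).Y (conformalVector c)).1 0 w) α =
      (α + 1) • intertwiner c hmid hin hout w (α + 1) := by
  rw [SmoothRep.Y_conformalVector, zero_sub]
  let S : Submodule ℂ (Verma c hmid) :=
    { carrier := {w | intertwiner c hmid hin hout ((vermaRep c hmid).L (-1) w) α =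
        (α + 1) • intertwiner c hmid hin hout w (α + 1)}
      add_mem' := fun {a b} ha hb => by
        rw [Set.mem_ofPred_eq] at ha hb ⊢
        rw [map_add, map_add, map_add, Pi.add_apply, Pi.add_apply, ha, hb, smul_add]
      zero_mem' := by
        rw [Set.mem_ofPred_eq, map_zero, map_zero, Pi.zero_apply, Pi.zero_apply, smul_zero]
      smul_mem' := fun r a ha => by
        rw [Set.mem_ofPred_eq] at ha ⊢
        rw [map_smul, map_smul, map_smul, Pi.smul_apply, Pi.smul_apply, ha, smul_comm] }
  refine weightSpace_induction S (fun η₁ w hw => ?_) w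
  change intertwiner c hmid hin hout (uL (-1) • w) α =
    (α + 1) • intertwiner c hmid hin hout w (α + 1)
  refine LinearMap.ext fun u => ?_
  refine sub_eq_zero.mp (LinearMap.mem_ker.mp
    (weightSpace_induction (LinearMap.ker (intertwiner c hmid hin hout (uL (-1) • w) α -
    (α + 1) • intertwiner c hmid hin hout w (α + 1))) (fun η₂ u hu => ?_) u))
  rw [LinearMap.mem_ker, LinearMap.sub_apply, sub_eq_zero]
  refine restrictedDual_ext fun η₃ x hx => ?_
  change (intertwiner c hmid hin hout (uL (-1) • w) α u).1 x =
    (α + 1) * (intertwiner c hmid hin hout w (α + 1) u).1 x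
  rw [intertwiner_apply_apply (uL_mem_weightSpace (-1) hw) hu hx,
    intertwiner_apply_apply hw hu hx]
  by_cases h : η₃ = η₁ + η₂ + (α + 1)
  · rw [if_pos h, if_pos (by rw [h]; push_cast; ring)]
    have hb : ∀ i : ℕ, 2 ≤ i → bin 1 i = 0 := fun i hi => by
      have h := Ring.choose_natCast (R := ℤ) 1 i
      rw [Nat.choose_eq_zero_of_lt hi] at h
      simpa using h
    have hward := ward_zero c hmid hin hout w u x 1
    rw [finsum_eq_range (N := 2) (fun i hi => by rw [hb i hi]; simp), Finset.sum_range_succ,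
      Finset.sum_range_one] at hward
    norm_num at hward
    rw [mem_weightSpace.mp hw, mem_weightSpace.mp hu, mem_weightSpace.mp hx, map_smul _ η₁ w,
      map_smul _ η₂ u, map_smul _ η₃ x] at hward
    simp only [LinearMap.smul_apply, smul_eq_mul, h] at hward
    linear_combination hward
  · rw [if_neg h, if_neg, mul_zero]
    intro h2
    refine h (h2.trans ?_)
    push_cast
    ring

theorem jacobi_four_point {d : ℕ} {v : Vc c} (hv : v ∈ fourPoint c hmid hin hout d)
    (w : Verma c hmid) (u : Verma c hin) (x : Verma c hout) (m k : ℤ) :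
    (∑ᶠ n : ℕ, (-1 : ℂ) ^ n * (bin m n : ℂ) *
      threePoint c hmid hin hout w u ((vermaRep c hout).oppositeMode d (m + k - n) v x)) -
      (∑ᶠ n : ℕ, (-1 : ℂ) ^ (m + n) * (bin m n : ℂ) *
        threePoint c hmid hin hout w (((vermaRep c hin).Y v).1 (k + n) u) x) =
      ∑ᶠ n : ℕ, (bin k n : ℂ) *
        threePoint c hmid hin hout (((vermaRep c hmid).Y v).1 (m + n) w) u x := by
  obtain ⟨G, hG, g1, g0, gi⟩ := hv.2 w u x
  have h := triRes_eq_zero (triFun_mul_mem (triMono_mem k m) hG)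
  rw [triRes_apply, triMono_mul_fst_coeff, triMono_mul_snd_fst_coeff,
    triMono_mul_snd_snd_coeff] at h
  have e0 : ∀ n : ℕ, (-1 : ℂ) ^ (m + n) * (bin m n : ℂ) *
      threePoint c hmid hin hout w (((vermaRep c hin).Y v).1 (k + n) u) x =
      (-1 : ℂ) ^ m * ((-1) ^ n * (bin m n : ℂ)) * G.1.coeff (-1 - k - n) := fun n => by
    rw [← g0, zpow_add₀ (by norm_num), zpow_natCast,
      show -(k + (n : ℤ)) - 1 = -1 - k - n by ring]
    ring
  have e1 : ∀ n : ℕ, (bin k n : ℂ) *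
      threePoint c hmid hin hout (((vermaRep c hmid).Y v).1 (m + n) w) u x =
      (bin k n : ℂ) * G.2.1.coeff (-1 - m - n) := fun n => by
    rw [← g1, show -(m + (n : ℤ)) - 1 = -1 - m - n by ring]
  have ei : ∀ n : ℕ, (-1 : ℂ) ^ n * (bin m n : ℂ) *
      threePoint c hmid hin hout w u ((vermaRep c hout).oppositeMode d (m + k - n) v x) =
      (-1 : ℂ) ^ n * (bin m n : ℂ) * G.2.2.coeff (1 + k + m - n) := fun n => by
    rw [← gi, show m + k - (n : ℤ) + 1 = 1 + k + m - n by ring]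
  rw [finsum_congr e0, finsum_congr e1, finsum_congr ei]
  linear_combination -h

/-- Evaluation of elements of the restricted dual. -/
def evalAt {c h : ℂ} (x : Verma c h) : (vermaRep c h).restrictedDual →ₗ[ℂ] ℂ :=
  LinearMap.applyₗ x ∘ₗ (vermaRep c h).restrictedDual.subtype

theorem evalAt_apply {c h : ℂ} (x : Verma c h) (f : (vermaRep c h).restrictedDual) :
    evalAt x f = f.1 x := rfl

theorem intertwiner_jacobi_homogeneous {d : ℕ} {v : Vc c} (hv : v ∈ fourPoint c hmid hin hout d)
    {η₁ η₂ η₃ : ℂ} {w : Verma c hmid} {u : Verma c hin} {x : Verma c hout}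
    (hw : w ∈ weightSpace c hmid η₁) (hu : u ∈ weightSpace c hin η₂)
    (hx : x ∈ weightSpace c hout η₃) (m k : ℤ) (α : ℂ) :
    (∑ᶠ n : ℕ, evalAt x (((-1 : ℂ) ^ n * (bin m n : ℂ)) •
      (vermaRep c hout).contragredientY v (m + k - n)
        (intertwiner c hmid hin hout w (α - n) u))) -
      (∑ᶠ n : ℕ, evalAt x (((-1 : ℂ) ^ (m + n) * (bin m n : ℂ)) •
        intertwiner c hmid hin hout w (α - m + n) (((vermaRep c hin).Y v).1 (k + n) u))) =
      ∑ᶠ n : ℕ, evalAt x ((bin k n : ℂ) •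
        intertwiner c hmid hin hout (((vermaRep c hmid).Y v).1 (m + n) w) (α - k + n) u) := by
  have e1 : ∀ n : ℕ, evalAt x (((-1 : ℂ) ^ n * (bin m n : ℂ)) •
      (vermaRep c hout).contragredientY v (m + k - n)
        (intertwiner c hmid hin hout w (α - n) u)) =
      if η₃ + m + k + 1 - d = η₁ + η₂ + α then (-1 : ℂ) ^ n * (bin m n : ℂ) *
        threePoint c hmid hin hout w u ((vermaRep c hout).oppositeMode d (m + k - n) v x)
      else 0 := fun n => by
    rw [map_smul, evalAt_apply, SmoothRep.contragredientY_apply _ hv.1,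
      intertwiner_apply_apply hw hu (oppositeMode_mem_weightSpace hv.1 _ hx), smul_eq_mul,
      mul_ite, mul_zero]
    refine if_congr ?_ rfl rfl
    push_cast
    constructor <;> intro h <;> linear_combination h
  have e2 : ∀ n : ℕ, evalAt x (((-1 : ℂ) ^ (m + n) * (bin m n : ℂ)) •
      intertwiner c hmid hin hout w (α - m + n) (((vermaRep c hin).Y v).1 (k + n) u)) =
      if η₃ + m + k + 1 - d = η₁ + η₂ + α then (-1 : ℂ) ^ (m + n) * (bin m n : ℂ) *
        threePoint c hmid hin hout w (((vermaRep c hin).Y v).1 (k + n) u) x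
      else 0 := fun n => by
    rw [map_smul, evalAt_apply, intertwiner_apply_apply hw (mode_mem_weightSpace hv.1 _ hu) hx,
      smul_eq_mul, mul_ite, mul_zero]
    refine if_congr ?_ rfl rfl
    push_cast
    constructor <;> intro h <;> linear_combination h
  have e3 : ∀ n : ℕ, evalAt x ((bin k n : ℂ) •
      intertwiner c hmid hin hout (((vermaRep c hmid).Y v).1 (m + n) w) (α - k + n) u) =
      if η₃ + m + k + 1 - d = η₁ + η₂ + α then (bin k n : ℂ) *
        threePoint c hmid hin hout (((vermaRep c hmid).Y v).1 (m + n) w) u x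
      else 0 := fun n => by
    rw [map_smul, evalAt_apply, intertwiner_apply_apply (mode_mem_weightSpace hv.1 _ hw) hu hx,
      smul_eq_mul, mul_ite, mul_zero]
    refine if_congr ?_ rfl rfl
    push_cast
    constructor <;> intro h <;> linear_combination h
  rw [finsum_congr e1, finsum_congr e2, finsum_congr e3]
  by_cases h : η₃ + m + k + 1 - d = η₁ + η₂ + α
  · simp only [if_pos h]
    exact jacobi_four_point c hmid hin hout hv w u x m k
  · simp only [if_neg h, finsum_zero, sub_zero]

theorem intertwiner_isIntertwining : IsIntertwining (conformalVector c) (vermaRep c hmid).Y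
    (vermaRep c hin).Y (vermaRep c hout).contragredientY (intertwiner c hmid hin hout) where
  truncation := intertwiner_truncation
  translation := intertwiner_translation c hmid hin hout
  jacobi v w u m k α := by
    have t1 : ∀ (v : Vc c) (w : Verma c hmid) (u : Verma c hin), ∃ N : ℕ, ∀ n : ℕ, N ≤ n →
        ((-1 : ℂ) ^ n * (bin m n : ℂ)) • (vermaRep c hout).contragredientY v (m + k - n)
          (intertwiner c hmid hin hout w (α - n) u) = 0 := fun v w u => by
      obtain ⟨N, hN⟩ := intertwiner_truncation (hout := hout) w u α
      exact ⟨N, fun n hn => by rw [hN n hn, map_zero, smul_zero]⟩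
    have t2 : ∀ (v : Vc c) (w : Verma c hmid) (u : Verma c hin), ∃ N : ℕ, ∀ n : ℕ, N ≤ n →
        ((-1 : ℂ) ^ (m + n) * (bin m n : ℂ)) • intertwiner c hmid hin hout w (α - m + n)
          (((vermaRep c hin).Y v).1 (k + n) u) = 0 := fun v w u => by
      obtain ⟨N, hN⟩ := ((vermaRep c hin).Y v).2 u
      exact ⟨N + k.natAbs, fun n hn => by rw [hN (k + n) (by omega), map_zero, smul_zero]⟩
    have t3 : ∀ (v : Vc c) (w : Verma c hmid) (u : Verma c hin), ∃ N : ℕ, ∀ n : ℕ, N ≤ n →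
        (bin k n : ℂ) • intertwiner c hmid hin hout (((vermaRep c hmid).Y v).1 (m + n) w)
          (α - k + n) u = 0 := fun v w u => by
      obtain ⟨N, hN⟩ := ((vermaRep c hmid).Y v).2 w
      exact ⟨N + m.natAbs, fun n hn => by
        rw [hN (m + n) (by omega), map_zero, Pi.zero_apply, LinearMap.zero_apply, smul_zero]⟩
    obtain ⟨S, hS⟩ := exists_finsum_identity
      (fun n : ℕ => ((-1 : ℂ) ^ n * (bin m n : ℂ)) •
        (LinearMap.applyₗ (intertwiner c hmid hin hout w (α - n) u) ∘ₗ
          LinearMap.proj (m + k - n) ∘ₗ (vermaRep c hout).contragredientY))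
      (fun n : ℕ => ((-1 : ℂ) ^ (m + n) * (bin m n : ℂ)) •
        (intertwiner c hmid hin hout w (α - m + n) ∘ₗ LinearMap.applyₗ u ∘ₗ
          LinearMap.proj (k + n) ∘ₗ (fields _).subtype ∘ₗ (vermaRep c hin).Y))
      (fun n : ℕ => (bin k n : ℂ) • (LinearMap.applyₗ u ∘ₗ LinearMap.proj (α - k + n) ∘ₗ
        intertwiner c hmid hin hout ∘ₗ LinearMap.applyₗ w ∘ₗ LinearMap.proj (m + n) ∘ₗ
          (fields _).subtype ∘ₗ (vermaRep c hmid).Y))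
      (fun v => t1 v w u) (fun v => t2 v w u) (fun v => t3 v w u)
    refine (hS v).mp ?_
    have hle : ⨆ d : ℕ, fourPoint c hmid hin hout d ≤ S := by
      refine iSup_le fun d v hv => (hS v).mpr ?_
      obtain ⟨S₁, hS₁⟩ := exists_finsum_identity
        (fun n : ℕ => ((-1 : ℂ) ^ n * (bin m n : ℂ)) •
          ((vermaRep c hout).contragredientY v (m + k - n) ∘ₗ LinearMap.applyₗ u ∘ₗ
            LinearMap.proj (α - n) ∘ₗ intertwiner c hmid hin hout))
        (fun n : ℕ => ((-1 : ℂ) ^ (m + n) * (bin m n : ℂ)) •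
          (LinearMap.applyₗ (((vermaRep c hin).Y v).1 (k + n) u) ∘ₗ
            LinearMap.proj (α - m + n) ∘ₗ intertwiner c hmid hin hout))
        (fun n : ℕ => (bin k n : ℂ) • (LinearMap.applyₗ u ∘ₗ LinearMap.proj (α - k + n) ∘ₗ
          intertwiner c hmid hin hout ∘ₗ ((vermaRep c hmid).Y v).1 (m + n)))
        (fun w => t1 v w u) (fun w => t2 v w u) (fun w => t3 v w u)
      refine (hS₁ w).mp (weightSpace_induction S₁ (fun η₁ w hw => (hS₁ w).mpr ?_) w)
      obtain ⟨S₂, hS₂⟩ := exists_finsum_identity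
        (fun n : ℕ => ((-1 : ℂ) ^ n * (bin m n : ℂ)) •
          ((vermaRep c hout).contragredientY v (m + k - n) ∘ₗ
            intertwiner c hmid hin hout w (α - n)))
        (fun n : ℕ => ((-1 : ℂ) ^ (m + n) * (bin m n : ℂ)) •
          (intertwiner c hmid hin hout w (α - m + n) ∘ₗ ((vermaRep c hin).Y v).1 (k + n)))
        (fun n : ℕ => (bin k n : ℂ) •
          intertwiner c hmid hin hout (((vermaRep c hmid).Y v).1 (m + n) w) (α - k + n))
        (fun u => t1 v w u) (fun u => t2 v w u) (fun u => t3 v w u)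
      refine (hS₂ u).mp (weightSpace_induction S₂ (fun η₂ u hu => (hS₂ u).mpr ?_) u)
      refine restrictedDual_ext fun η₃ x hx => ?_
      change evalAt x (_ - _) = evalAt x _
      rw [map_sub]
      refine Eq.trans ?_ ((intertwiner_jacobi_homogeneous c hmid hin hout hv hw hu hx m k α).trans
        (map_finsum_of_bounded (evalAt x) (t3 v w u)).symm)
      exact congrArg₂ (· - ·) (map_finsum_of_bounded (evalAt x) (t1 v w u))
        (map_finsum_of_bounded (evalAt x) (t2 v w u))
    rw [iSup_fourPoint] at hle
    exact hle trivial

end IntertwiningProperty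


section Uniqueness

open IsHighestWeightVector

variable {c hmid hin hout : ℂ}

theorem conformalVector_mem_Vgr (c : ℂ) : conformalVector c ∈ Vgr c 2 := by
  have h := op_weight (vacuum_isHighestWeightVector c) (-2)
    (Module.End.mem_eigenspace_iff.mpr (vacuum_isHighestWeightVector c).weight)
  rw [Module.End.mem_eigenspace_iff] at h
  rw [mem_Vgr]
  refine h.trans ?_
  norm_num
  rfl

theorem uL_neg_one_vacuum (c : ℂ) : (uL (-1) • vacuum c : Vc c) = 0 := by
  rw [vacuum, ← map_smul, Submodule.mkQ_apply, Submodule.Quotient.mk_eq_zero]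
  exact Submodule.subset_span rfl

theorem uL_one_conformalVector (c : ℂ) : op (Vc c) 1 (conformalVector c) = 0 := by
  have h := (vacuum_isHighestWeightVector c).op_comm 1 (-2) (vacuum c)
  have h1 : op (Vc c) 1 (vacuum c) = 0 := (vacuum_isHighestWeightVector c).pos 1 one_pos
  have h2 : op (Vc c) (-1) (vacuum c) = 0 := uL_neg_one_vacuum c
  rw [h1, map_zero, show (1 : ℤ) + -2 = -1 by norm_num, h2, smul_zero, if_neg (by norm_num),
    add_zero,
    add_zero] at h
  exact h

theorem oppositeMode_conformalVector {W : Type*} [AddCommGroup W] [Module ℂ W]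
    (R : SmoothRep c W) (n : ℤ) : R.oppositeMode 2 n (conformalVector c) = R.L (1 - n) := by
  rw [SmoothRep.oppositeMode_apply, Finset.sum_range_succ', Finset.sum_eq_zero]
  · rw [pow_zero, Module.End.one_apply, R.Y_conformalVector]
    norm_num
    congr 1
    ring
  · intro i _
    rw [pow_succ, Module.End.mul_apply, uL_one_conformalVector, map_zero, map_zero]
    simp

/-- The action of the conformal vector on the contragredient module. -/
theorem contragredientY_conformalVector (n : ℤ) (f : (vermaRep c hout).restrictedDual)
    (x : Verma c hout) :
    ((vermaRep c hout).contragredientY (conformalVector c) n f).1 x = f.1 (uL (1 - n) • x) := by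
  rw [SmoothRep.contragredientY_apply _ (conformalVector_mem_Vgr c), oppositeMode_conformalVector]
  rfl

theorem bin_zero (n : ℤ) : bin n 0 = 1 := Ring.choose_zero_right n

theorem bin_one (n : ℤ) : bin n 1 = n := Ring.choose_one_right n

variable {J : Verma c hmid →ₗ[ℂ] (ℂ → (Verma c hin →ₗ[ℂ] (vermaRep c hout).restrictedDual))}

theorem bin_zero_of_pos {n : ℕ} (hn : n ≠ 0) : bin 0 n = 0 := by
  simpa using (Ring.choose_zero_pos ℤ (Nat.pos_of_ne_zero hn))

/-- The commutator formula for the conformal vector. -/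
theorem IsIntertwining.commutator (hJ : IsIntertwining (conformalVector c) (vermaRep c hmid).Y
    (vermaRep c hin).Y (vermaRep c hout).contragredientY J) (n : ℤ) (w : Verma c hmid) (α : ℂ)
    (u : Verma c hin) (x : Verma c hout) :
    (J w α (uL n • u)).1 x = (J w α u).1 (uL (-n) • x) -
      ∑ᶠ i : ℕ, (bin (n + 1) i : ℂ) * (J (uL (i - 1) • w) (α - (n + 1 : ℤ) + i) u).1 x := by
  have h := hJ.jacobi (conformalVector c) w u 0 (n + 1) α
  rw [finsum_eq_single _ 0 (fun i hi => by rw [bin_zero_of_pos hi]; simp),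
    finsum_eq_single _ 0 (fun i hi => by rw [bin_zero_of_pos hi]; simp)] at h
  have h' := congrArg (evalAt x) h
  rw [map_sub, map_finsum_of_bounded] at h'
  · simp only [map_smul, evalAt_apply, contragredientY_conformalVector,
      SmoothRep.Y_conformalVector, smul_eq_mul] at h'
    simp only [zero_add, Nat.cast_zero, Int.cast_zero, sub_zero, add_zero, zpow_zero, pow_zero,
      bin_zero, Int.cast_one, one_mul, add_sub_cancel_right,
      show (1 : ℤ) - (n + 1) = -n by ring] at h'
    exact eq_sub_of_add_eq (sub_eq_iff_eq_add'.mp h').symm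
  · obtain ⟨N, hN⟩ := ((vermaRep c hmid).Y (conformalVector c)).2 w
    exact ⟨N, fun i hi => by
      rw [hN (0 + i) (by omega), map_zero, Pi.zero_apply, LinearMap.zero_apply, smul_zero]⟩

/-- The associativity formula for the conformal vector: the values on `L_n w` are determined by
those on `w`. -/
theorem IsIntertwining.uL_eq_zero (hJ : IsIntertwining (conformalVector c) (vermaRep c hmid).Y
    (vermaRep c hin).Y (vermaRep c hout).contragredientY J) {w : Verma c hmid}
    (hw : J w = 0) (n : ℤ) : J (uL n • w) = 0 := by
  refine funext fun α => LinearMap.ext fun u => ?_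
  have h := hJ.jacobi (conformalVector c) w u (n + 1) 0 α
  rw [finsum_eq_single (fun i : ℕ => (bin 0 i : ℂ) • _) 0
    (fun i hi => by rw [bin_zero_of_pos hi]; simp)] at h
  simp only [hw, Pi.zero_apply, LinearMap.zero_apply, map_zero, smul_zero, finsum_zero, sub_zero,
    SmoothRep.Y_conformalVector, bin_zero, Int.cast_one, one_smul, Nat.cast_zero, add_zero,
    Int.cast_zero, add_sub_cancel_right] at h
  exact h.symm

theorem IsIntertwining.uL_neg_one (hJ : IsIntertwining (conformalVector c) (vermaRep c hmid).Y
    (vermaRep c hin).Y (vermaRep c hout).contragredientY J) (w : Verma c hmid) (α : ℂ) :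
    J (uL (-1) • w) α = (α + 1) • J w (α + 1) := by
  have h := hJ.translation w α
  rwa [SmoothRep.Y_conformalVector, zero_sub] at h

/-- On a highest weight vector of the first module, the commutator formula has two terms. -/
theorem IsIntertwining.commutator_hwv (hJ : IsIntertwining (conformalVector c)
    (vermaRep c hmid).Y (vermaRep c hin).Y (vermaRep c hout).contragredientY J) (n : ℤ) (α : ℂ)
    (u : Verma c hin) (x : Verma c hout) :
    (J (Verma.hwv c hmid) α (uL n • u)).1 x = (J (Verma.hwv c hmid) α u).1 (uL (-n) • x) -
      (α - n + (n + 1) * hmid) * (J (Verma.hwv c hmid) (α - n) u).1 x := by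
  have hv := Verma.isHighestWeightVector c hmid
  rw [hJ.commutator, finsum_eq_range (N := 2), Finset.sum_range_succ, Finset.sum_range_one]
  · rw [Nat.cast_zero, zero_sub, hJ.uL_neg_one, Nat.cast_one, sub_self, hv.weight, map_smul J hmid,
      bin_zero, bin_one, LinearMap.smul_apply]
    simp only [Pi.smul_apply, LinearMap.smul_apply, Submodule.coe_smul, smul_eq_mul]
    push_cast
    rw [show α - ((n : ℂ) + 1) + 0 + 1 = α - n by ring, show α - ((n : ℂ) + 1) + 1 = α - n by ring]
    ring
  · intro i hi
    rw [hv.pos _ (by omega), map_zero]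
    simp

theorem IsIntertwining.eq_zero (hJ : IsIntertwining (conformalVector c) (vermaRep c hmid).Y
    (vermaRep c hin).Y (vermaRep c hout).contragredientY J)
    (h0 : (J (Verma.hwv c hmid) (hout - hmid - hin) (Verma.hwv c hin)).1 (Verma.hwv c hout) = 0) :
    J = 0 := by
  have hin' := Verma.isHighestWeightVector c hin
  have hout' := Verma.isHighestWeightVector c hout
  have hmid' := Verma.isHighestWeightVector c hmid
  have s0 : ∀ α, (J (Verma.hwv c hmid) α (Verma.hwv c hin)).1 (Verma.hwv c hout) = 0 := by
    intro α
    have h := hJ.commutator_hwv 0 α (Verma.hwv c hin) (Verma.hwv c hout)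
    rw [neg_zero, hin'.weight, hout'.weight, map_smul, map_smul] at h
    simp only [Submodule.coe_smul, LinearMap.smul_apply, smul_eq_mul, Int.cast_zero, sub_zero,
      zero_add, one_mul] at h
    have h' : (α - (hout - hmid - hin)) *
        (J (Verma.hwv c hmid) α (Verma.hwv c hin)).1 (Verma.hwv c hout) = 0 := by
      linear_combination h
    rcases mul_eq_zero.mp h' with h1 | h1
    · rwa [sub_eq_zero.mp h1]
    · exact h1
  have s1 : ∀ x α, (J (Verma.hwv c hmid) α (Verma.hwv c hin)).1 x = 0 := by
    let T : Submodule ℂ (Verma c hout) :=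
      ⨅ α, LinearMap.ker (J (Verma.hwv c hmid) α (Verma.hwv c hin)).1
    have hT : ∀ x, x ∈ T ↔ ∀ α, (J (Verma.hwv c hmid) α (Verma.hwv c hin)).1 x = 0 := fun x => by
      simp [T, Submodule.mem_iInf]
    refine fun x => (hT x).mp (hout'.induction_neg T ((hT _).mpr s0) (fun n hn x hx => ?_) x)
    rw [hT] at hx ⊢
    intro α
    have h := hJ.commutator_hwv (-n) α (Verma.hwv c hin) x
    rw [hin'.pos (-n) (by omega), map_zero, neg_neg, hx, mul_zero, sub_zero] at h
    exact h.symm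
  have s2 : ∀ u α, J (Verma.hwv c hmid) α u = 0 := by
    let T : Submodule ℂ (Verma c hin) := ⨅ α, LinearMap.ker (J (Verma.hwv c hmid) α)
    have hT : ∀ u, u ∈ T ↔ ∀ α, J (Verma.hwv c hmid) α u = 0 := fun u => by
      simp [T, Submodule.mem_iInf]
    refine fun u => (hT u).mp (hin'.induction_neg T ((hT _).mpr fun α =>
      Subtype.ext (LinearMap.ext fun x => s1 x α)) (fun n hn u hu => ?_) u)
    rw [hT] at hu ⊢
    refine fun α => Subtype.ext (LinearMap.ext fun x => ?_)
    rw [hJ.commutator_hwv, hu, hu]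
    simp
  refine LinearMap.ext fun w => ?_
  refine LinearMap.mem_ker.mp (hmid'.induction_neg (LinearMap.ker J)
    (LinearMap.mem_ker.mpr (funext fun α => LinearMap.ext fun u => s2 u α))
    (fun n _ w hw => ?_) w)
  exact LinearMap.mem_ker.mpr (hJ.uL_eq_zero (LinearMap.mem_ker.mp hw) n)

theorem finrank_intertwiningOperators_eq_one {V W₁ W₂ W₃ : Type*} [AddCommGroup V] [Module ℂ V]
    [AddCommGroup W₁] [Module ℂ W₁] [AddCommGroup W₂] [Module ℂ W₂] [AddCommGroup W₃]
    [Module ℂ W₃] {ω : V} {Y₁ : V →ₗ[ℂ] fields W₁} {Y₂ : V →ₗ[ℂ] fields W₂}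
    {Y₃ : V →ₗ[ℂ] (ℤ → Module.End ℂ W₃)} {I : W₁ →ₗ[ℂ] (ℂ → (W₂ →ₗ[ℂ] W₃))}
    (hI : IsIntertwining ω Y₁ Y₂ Y₃ I) (w : W₁) (α : ℂ) (u : W₂) (φ : W₃ →ₗ[ℂ] ℂ)
    (h1 : φ (I w α u) = 1)
    (h0 : ∀ J, IsIntertwining ω Y₁ Y₂ Y₃ J → φ (J w α u) = 0 → J = 0) :
    Module.finrank ℂ (intertwiningOperators ω Y₁ Y₂ Y₃) = 1 := by
  refine finrank_eq_one (⟨I, hI⟩ : intertwiningOperators ω Y₁ Y₂ Y₃) ?_ fun J => ?_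
  · intro h
    rw [show I = 0 from congrArg Subtype.val h] at h1
    exact zero_ne_one ((map_zero φ).symm.trans h1)
  · refine ⟨φ (J.1 w α u), Subtype.ext (neg_add_eq_zero.mp ?_)⟩
    rw [Submodule.coe_smul, ← neg_smul]
    refine h0 _ (IsIntertwining.smul_add_mem hI J.2 _) ?_
    rw [LinearMap.add_apply, Pi.add_apply, LinearMap.add_apply, map_add, LinearMap.smul_apply,
      Pi.smul_apply, LinearMap.smul_apply, map_smul, h1, smul_eq_mul, mul_one, neg_add_cancel]

theorem intertwiner_hwv (c hmid hin hout : ℂ) :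
    (intertwiner c hmid hin hout (Verma.hwv c hmid) (hout - hmid - hin) (Verma.hwv c hin)).1
      (Verma.hwv c hout) = 1 := by
  rw [intertwiner_apply_apply
    (mem_weightSpace.mpr (Verma.isHighestWeightVector c hmid).weight)
    (mem_weightSpace.mpr (Verma.isHighestWeightVector c hin).weight)
    (mem_weightSpace.mpr (Verma.isHighestWeightVector c hout).weight), if_pos (by ring),
    threePoint_hwv]

end Uniqueness

end

end VirVOA

theorem mainTheorem6 (c hmid hin hout : ℂ) :
    Module.finrank ℂ
      (VirVOA.intertwiningOperators (VirVOA.conformalVector c)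
        (VirVOA.vermaRep c hmid).Y (VirVOA.vermaRep c hin).Y
        (VirVOA.vermaRep c hout).contragredientY) = 1 :=
  VirVOA.finrank_intertwiningOperators_eq_one
    (VirVOA.intertwiner_isIntertwining c hmid hin hout) (VirVOA.Verma.hwv c hmid)
    (hout - hmid - hin) (VirVOA.Verma.hwv c hin) (VirVOA.evalAt (VirVOA.Verma.hwv c hout))
    (VirVOA.intertwiner_hwv c hmid hin hout) fun _ hJ h0 => hJ.eq_zero h0
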